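/- We use coordinates $x,y,z,w$ on $\mathbb C^4$. There are eight series of isolated complete intersection singularities, $J'_2,K'_1,K^\flat_1,L_1,L^\sharp_1,M_1,M^\sharp_1,I_1$. The virtual ($k=-1$) member $X$ of each series is the pair $(\mathbf h_1,\mathbf h_2)=(xy-a(z,w),\,c(x,z,w)+y\,b(z,w))$ coming from a matrix factorization $xc+ab$ of the polynomial $\mathbf h$ of one of the virtual hypersurface singularities $Q_{2,-1},S_{1,-1},S^\sharp_{1,-1},U_{1,-1}$ (up to renaming coordinates). The pairs are: - $J'_{2,-1}$: $(xy-w^2,\,-x^2z+yw+z^2+xw^2)$ - $K'_{1,-1}$: $(xy-w^2,\,-x^2w+z^2+yz+xw^2)$ - $K^\flat_{1,-1}$: $(xy-w^2,\,-x^2w+z^2+yz+x^2z)$ - $L_{1,-1}$: $(xy-zw,\,-x^2w+z^2+yw+xw^2)$ - $L^\sharp_{1,-1}$: $(xy-zw,\,-x^2w+z^2+yw+x^2z)$ - $M_{1,-1}$: $(xy-w^2,\,-yz+xw+z^3+w^2)$ - $M^\sharp_{1,-1}$: $(xy-zw,\,-z^2+yw+x^2w+yz)$ - $I_{1,-1}$: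 $(xy-w^3,\,-xw+z^2+yz+xz)$ **Duality.** To the series one associates the polynomials $f=\sum_{i=1}^4x^{E_{i1}}y^{E_{i2}}z^{E_{i3}}w^{E_{i4}}$, obtained from the second equation of the $k=0$ member, with coefficients $1$, by a monomial substitution for $X,Y,Z,W$ that solves the first equation: - $J'_{2,0}$: second equation $X^3W+YW+Z^2+XW^2$ - $K'_{1,0}$: second equation $X^4+Z^2+YZ+X^2Z$ - $K^\flat_{1,0}$: second equation $XW^2+Z^2+YZ+X^2Z$ - $L_{1,0}$: second equation $X^4+Z^2+YW+X^2Z$ - $L^\sharp_{1,0}$: second equation $XW^2+Z^2+YW+X^2Z$ - $M_{1,0}$: second equation $Z^3+W^2+YZ+XW$ - $M^\sharp_{1,0}$: second equation $X^2W+YZ+YW+X^2Z$ - $I_{1,0}$: second equation $X^2+Y^2+Z^2+W^3$ The first equation and the substitution $(X,Y,Z,W)$ are: - for $J',K',K^\flat$: $XY-W^2$ and $(x^2w,\,y^2w,\,z,\,xyw)$; - for $L,L^\sharp,M^\sharp$: $XY-ZW$ and $(xw,\,yz,\,xz,\,yw)$; - for $M$: $XY-Z^2W$ and $(y^2z^2,\,x^2w^2,\,xz,\,y^2w^2)$;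 - for $I$: $XY-W^3$ and $(x^6w^3,\,y^6w^3,\,z,\,x^2y^2w^2)$. Two series, and their virtual members, are dual if the polynomial $f$ of the second is the Berglund–Hübsch transpose of the polynomial $f$ of the first, i.e. is given by the transposed exponent matrix (up to reordering the terms of the first polynomial). **Dolgachev numbers.** The convex hull of the origin and the support of $\mathbf h_2$, taken in the space $\mathbb R^4$ of exponents modulo the line of exponent vectors identified by $\mathbf h_1=0$ (spanned by the difference of the two exponents of $\mathbf h_1$), has exactly two maximal faces $\Sigma_1,\Sigma_2$ not containing the origin. Let $\mathbf h_{2,i}$ be the sum of the terms of $\mathbf h_2$ on $\Sigma_i$, and let $V_i=\{\mathbf h_1=\mathbf h_{2,i}=0\}\subset\mathbb C^4$, with the $\mathbb C^*$-action given by the reduced positive weights for which both equations are weighted homogeneous. An orbit in $V_i\setminus\{0\}$ with non-trivial isotropy group is called principal if it satisfies the following condition: - (A) if $V_i$ contains a plane $L$ obtained by setting two coordinates to zero: it is not contained in $L$; - (B) if $\mathbf h_1=g_1(x,y,w)$ and $\mathbf h_{2,i}=z\,g_2(x,y,z)$: it is not contained in $U=\{g_1=z=0\}$; - (C) otherwise: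 it does not coincide with the singular locus of $V_i\setminus\{0\}$. There are exactly two principal orbits in each case. The Dolgachev numbers $\alpha_1,\alpha_2;\alpha_3,\alpha_4$ are the orders of the isotropy groups of the two principal orbits in $V_1$ and of the two in $V_2$. **Gabrielov numbers.** Put $\mathbf h_1'=xy-w^2-z^2$ for $J'_{2,-1},K'_{1,-1},K^\flat_{1,-1}$, and $\mathbf h_1'=\mathbf h_1$ for the other five. The Gabrielov numbers of $X$ are the numbers $\gamma_1,\gamma_2;\gamma_3,\gamma_4$ for which the germ at $0$ of $(\mathbf h_1',\,\mathbf h_2-zw)$ is $\mathcal K$-equivalent to $$(xy-z^{\gamma_1}-w^{\gamma_2},\;x^{\gamma_3}+y^{\gamma_4}-zw),$$ the cusp singularity $T^2_{\gamma_1,\gamma_3,\gamma_2,\gamma_4}$. Both kinds of numbers are regarded as an unordered pair of unordered pairs. **Theorem.** The virtual singularities $K^\flat_{1,-1}$ and $L_{1,-1}$ are dual to each other and to nothing else, and each of the other six is dual precisely to itself. The Gabrielov numbers and the Dolgachev numbers of each virtual singularity exist and are unique. If $X$ and $\widetilde X$ are dual, then the Gabrielov numbers of $X$ coincide with the Dolgachev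 numbers of $\widetilde X$, and the Dolgachev numbers of $X$ coincide with the Gabrielov numbers of $\widetilde X$. -/

import Mathlib

noncomputable section

namespace QuadrangleDuality

open MvPolynomial

/-- Polynomials in the four coordinates `x = X 0`, `y = X 1`, `z = X 2`, `w = X 3` of `ℂ⁴`. -/
abbrev Poly4 : Type := MvPolynomial (Fin 4) ℂ

/-- The names of the eight series `J'₂`, `K'₁`, `K♭₁`, `L₁`, `L♯₁`, `M₁`, `M♯₁`, `I₁` of isolated
complete intersection singularities. Each of them has a member `k = 0` (a quadrangle complete
intersection singularity) and a virtual member `k = -1`. -/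
inductive Series : Type
  | J | K | Kflat | L | Lsharp | M | Msharp | I

/-! ### The members `k = 0` and Berglund–Hübsch transposition -/

/-- The first equation `F_{Q,1}` of the member `k = 0`. -/
def quadrangleEq1 : Series → Poly4
  | .J | .K | .Kflat => X 0 * X 1 - X 3 ^ 2
  | .L | .Lsharp | .Msharp => X 0 * X 1 - X 2 * X 3
  | .M => X 0 * X 1 - X 2 ^ 2 * X 3
  | .I => X 0 * X 1 - X 3 ^ 3

/-- The second equation `F_{Q,2}` of the member `k = 0` (all coefficients set to `1`). -/
def quadrangleEq2 : Series → Poly4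
  | .J => X 0 ^ 3 * X 3 + X 1 * X 3 + X 2 ^ 2 + X 0 * X 3 ^ 2
  | .K => X 0 ^ 4 + X 2 ^ 2 + X 1 * X 2 + X 0 ^ 2 * X 2
  | .Kflat => X 0 * X 3 ^ 2 + X 2 ^ 2 + X 1 * X 2 + X 0 ^ 2 * X 2
  | .L => X 0 ^ 4 + X 2 ^ 2 + X 1 * X 3 + X 0 ^ 2 * X 2
  | .Lsharp => X 0 * X 3 ^ 2 + X 2 ^ 2 + X 1 * X 3 + X 0 ^ 2 * X 2
  | .M => X 2 ^ 3 + X 3 ^ 2 + X 1 * X 2 + X 0 * X 3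
  | .Msharp => X 0 ^ 2 * X 3 + X 1 * X 2 + X 1 * X 3 + X 0 ^ 2 * X 2
  | .I => X 0 ^ 2 + X 1 ^ 2 + X 2 ^ 2 + X 3 ^ 3

/-- The monomial substitution for the coordinates; it depends only on the first equation, and
solves it (`bind_substitution_quadrangleEq1`). -/
def substitution : Series → Fin 4 → Poly4
  | .J | .K | .Kflat => ![X 0 ^ 2 * X 3, X 1 ^ 2 * X 3, X 2, X 0 * X 1 * X 3]
  | .L | .Lsharp | .Msharp => ![X 0 * X 3, X 1 * X 2, X 0 * X 2, X 1 * X 3]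
  | .M => ![X 1 ^ 2 * X 2 ^ 2, X 0 ^ 2 * X 3 ^ 2, X 0 * X 2, X 1 ^ 2 * X 3 ^ 2]
  | .I => ![X 0 ^ 6 * X 3 ^ 3, X 1 ^ 6 * X 3 ^ 3, X 2, X 0 ^ 2 * X 1 ^ 2 * X 3 ^ 2]

theorem bind_substitution_quadrangleEq1 (s : Series) :
    bind₁ (substitution s) (quadrangleEq1 s) = 0 := by
  cases s <;> simp [substitution, quadrangleEq1] <;> ring

/-- The polynomial `f`, with four terms in four variables, associated to the member `k = 0`. -/
def transformed (s : Series) : Poly4 := bind₁ (substitution s) (quadrangleEq2 s)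

/-- The polynomial `∑ᵢ x^{E i 0} y^{E i 1} z^{E i 2} w^{E i 3}` of a matrix `E` of exponents. -/
def ofExponents (E : Matrix (Fin 4) (Fin 4) ℕ) : Poly4 :=
  ∑ i, ∏ j, X j ^ E i j

/-- `g` is a Berglund–Hübsch transpose of `f`. The rows of the matrix of `f` may be taken in any
order, so `g` is determined up to renaming the variables. -/
def IsBerglundHubschTranspose (f g : Poly4) : Prop :=
  ∃ E : Matrix (Fin 4) (Fin 4) ℕ, f = ofExponents E ∧ g = ofExponents E.transpose

/-- The series `t` (hence its virtual member) is dual to the series `s`. -/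
def IsDual (s t : Series) : Prop :=
  IsBerglundHubschTranspose (transformed s) (transformed t)

/-- The explicit table of the duality. -/
def dualSeries : Series → Series
  | .Kflat => .L
  | .L => .Kflat
  | s => s

/-! ### The virtual singularities

They come from factorizations `h = x c + a b` with `a`, `b` in `ℂ[z, w]` and `c` in `ℂ[x, z, w]`. -/

/-- The factor `a(z, w)`. -/
def factorA : Series → Poly4
  | .J | .K | .Kflat | .M => X 3 ^ 2
  | .L | .Lsharp | .Msharp => X 2 * X 3
  | .I => X 3 ^ 3

/-- The factor `b(z, w)`. -/
def factorB : Series → Poly4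
  | .J | .L | .Lsharp => X 3
  | .K | .Kflat | .I => X 2
  | .M => -X 2
  | .Msharp => X 2 + X 3

/-- The factor `c(x, z, w)`. -/
def factorC : Series → Poly4
  | .J => -(X 0 ^ 2 * X 2) + X 2 ^ 2 + X 0 * X 3 ^ 2
  | .K | .L => -(X 0 ^ 2 * X 3) + X 2 ^ 2 + X 0 * X 3 ^ 2
  | .Kflat | .Lsharp => -(X 0 ^ 2 * X 3) + X 2 ^ 2 + X 0 ^ 2 * X 2
  | .M => X 0 * X 3 + X 2 ^ 3 + X 3 ^ 2
  | .Msharp => -X 2 ^ 2 + X 0 ^ 2 * X 3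
  | .I => -(X 0 * X 3) + X 2 ^ 2 + X 0 * X 2

/-- The polynomial `h(x, z, w)` of the virtual hypersurface singularity `Q_{2,-1}` (for `J`),
`S_{1,-1}` (for `K`, `L`), `S♯_{1,-1}` (for `K♭`, `L♯`), `U_{1,-1}` (for `M`, `M♯`, `I`). -/
def hypersurfaceEq : Series → Poly4
  | .J => X 3 ^ 3 + X 0 ^ 2 * X 3 ^ 2 + X 0 * X 2 ^ 2 - X 0 ^ 3 * X 2
  | .K | .L => X 0 * X 2 ^ 2 + X 2 * X 3 ^ 2 + X 0 ^ 2 * X 3 ^ 2 - X 3 * X 0 ^ 3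
  | .Kflat | .Lsharp => X 0 * X 2 ^ 2 + X 0 ^ 3 * X 2 + X 2 * X 3 ^ 2 - X 0 ^ 3 * X 3
  | .M | .Msharp | .I => X 0 ^ 2 * X 3 + X 0 * X 3 ^ 2 + X 0 * X 2 ^ 3 - X 2 * X 3 ^ 2

/-- The renaming of the coordinates under which `h` is factorized. -/
def coordinateChange : Series → Fin 4 → Fin 4
  | .Msharp => ![3, 1, 0, 2]
  | .I => ![2, 1, 3, 0]
  | _ => id

/-- The matrix factorization `q₀ q₁ = h • 1`. -/
theorem matrixFactorization (s : Series) :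
    !![factorA s, -X 0; factorC s, factorB s] * !![factorB s, X 0; -factorC s, factorA s] =
      Matrix.diagonal fun _ => rename (coordinateChange s) (hypersurfaceEq s) := by
  ext i j
  congr 1
  cases s <;> fin_cases i <;> fin_cases j <;>
    simp [Matrix.mul_apply, Fin.sum_univ_two, factorA, factorB, factorC, hypersurfaceEq,
      coordinateChange, Matrix.diagonal] <;> ring

/-- The first equation `h₁` of the virtual singularity. -/
def h₁ (s : Series) : Poly4 := X 0 * X 1 - factorA s

/-- The second equation `h₂` of the virtual singularity. -/
def h₂ (s : Series) : Poly4 := factorC s + X 1 * factorB s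

/-! ### The decomposition of `h₂` by its Newton polytope at infinity -/

/-- An exponent as a vector of `ℝ⁴`. -/
def expVec (m : Fin 4 →₀ ℕ) : Fin 4 → ℝ := fun i => (m i : ℝ)

/-- The span of the differences of the exponents of `p`; for a binomial `p` the line of exponent
vectors that are identified by the relation `p = 0`. -/
def relationSpace (p : Poly4) : Submodule ℝ (Fin 4 → ℝ) :=
  Submodule.span ℝ {v | ∃ a ∈ p.support, ∃ b ∈ p.support, v = expVec a - expVec b}

/-- The class of an exponent in the space of exponents modulo the relation `p = 0`. -/
def expClass (p : Poly4) (m : Fin 4 →₀ ℕ) : (Fin 4 → ℝ) ⧸ relationSpace p :=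
  (relationSpace p).mkQ (expVec m)

/-- The Newton polytope at infinity of `q`, modulo the relation `p = 0`. -/
def newtonPolytope (p q : Poly4) : Set ((Fin 4 → ℝ) ⧸ relationSpace p) :=
  convexHull ℝ (insert 0 (expClass p '' (q.support : Set (Fin 4 →₀ ℕ))))

/-- The maximal faces of the Newton polytope at infinity among those not containing the origin. -/
def outerFaces (p q : Poly4) : Set (Set ((Fin 4 → ℝ) ⧸ relationSpace p)) :=
  {S | Maximal (fun S' => S'.Nonempty ∧ IsExposed ℝ (newtonPolytope p q) S' ∧ 0 ∉ S') S}

open Classical in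
/-- The sum of the terms of `q` whose exponents lie on `S`. -/
def facePart (p q : Poly4) (S : Set ((Fin 4 → ℝ) ⧸ relationSpace p)) : Poly4 :=
  ∑ m ∈ q.support with expClass p m ∈ S, monomial m (coeff m q)

/-! ### Principal orbits and Dolgachev numbers

Below, `p` and `q` are the two equations of the variety `V = {p = q = 0}` in `ℂ⁴`. -/

/-- `w` is the reduced system of weights for which `p` and `q` are weighted homogeneous. -/
def IsReducedWeightSystem (p q : Poly4) (w : Fin 4 → ℕ) : Prop :=
  (∀ i, 0 < w i) ∧ Finset.univ.gcd w = 1 ∧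
    (∃ d, IsWeightedHomogeneous w p d) ∧ ∃ d, IsWeightedHomogeneous w q d

/-- The `ℂ*`-action on `ℂ⁴` with weights `w`. -/
def act (w : Fin 4 → ℕ) (t : ℂˣ) (v : Fin 4 → ℂ) : Fin 4 → ℂ :=
  fun i => (t : ℂ) ^ w i * v i

/-- The orbit of a point. -/
def orbit (w : Fin 4 → ℕ) (v : Fin 4 → ℂ) : Set (Fin 4 → ℂ) :=
  Set.range fun t : ℂˣ => act w t v

/-- The isotropy group of a point. -/
def isotropy (w : Fin 4 → ℕ) (v : Fin 4 → ℂ) : Subgroup ℂˣ where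
  carrier := {t | act w t v = v}
  one_mem' := by
    funext i
    simp [act]
  mul_mem' := by
    intro a b ha hb
    simp only [Set.mem_ofPred_eq, funext_iff, act, Units.val_mul, mul_pow] at *
    intro i
    rw [mul_assoc, hb i, ha i]
  inv_mem' := by
    intro a ha
    simp only [Set.mem_ofPred_eq, funext_iff, act] at *
    intro i
    have h := ha i
    have hne : (a : ℂ) ^ w i ≠ 0 := pow_ne_zero _ a.ne_zero
    rw [Units.val_inv_eq_inv_val, inv_pow]
    field_simp
    exact h.symm

/-- The variety `V`. -/
def variety (p q : Poly4) : Set (Fin 4 → ℂ) := {v | eval v p = 0 ∧ eval v q = 0}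

/-- The singular locus of the complete intersection `V`: the Jacobian matrix has rank less than
two. -/
def singularLocus (p q : Poly4) : Set (Fin 4 → ℂ) :=
  {v ∈ variety p q |
    ¬ LinearIndependent ℂ ![fun i => eval v (pderiv i p), fun i => eval v (pderiv i q)]}

/-- The plane of codimension two obtained by setting the coordinates `i` and `j` to zero. -/
def coordPlane (i j : Fin 4) : Set (Fin 4 → ℂ) := {v | v i = 0 ∧ v j = 0}

/-- Case (A): `V` contains a coordinate plane. -/
def CaseA (p q : Poly4) : Prop := ∃ i j, i ≠ j ∧ coordPlane i j ⊆ variety p q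

/-- Case (B): `p = g₁(x, y, w)` and `q = z g₂(x, y, z)`. -/
def CaseB (p q : Poly4) : Prop :=
  (2 : Fin 4) ∉ p.vars ∧ ∃ g : Poly4, (3 : Fin 4) ∉ g.vars ∧ q = X 2 * g

/-- The component `U = {g₁(x, y, w) = z = 0}` in case (B). -/
def componentU (p : Poly4) : Set (Fin 4 → ℂ) := {v | eval v p = 0 ∧ v 2 = 0}

/-- `v` is a point of a principal exceptional orbit of the action on `V \ {0}`. -/
def IsPrincipalPoint (p q : Poly4) (w : Fin 4 → ℕ) (v : Fin 4 → ℂ) : Prop :=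
  v ∈ variety p q ∧ v ≠ 0 ∧ isotropy w v ≠ ⊥ ∧
    (∀ i j, i ≠ j → coordPlane i j ⊆ variety p q → ¬ orbit w v ⊆ coordPlane i j) ∧
    (CaseB p q → ¬ orbit w v ⊆ componentU p) ∧
    (¬ CaseA p q → ¬ CaseB p q → orbit w v ≠ singularLocus p q \ {0})

/-- There are exactly two principal orbits, and `n` is the pair of orders of their isotropy
groups. -/
def HasDolgachevPair (p q : Poly4) (n : Sym2 ℕ) : Prop :=
  ∃ w, IsReducedWeightSystem p q w ∧
    ∃ u v, orbit w u ≠ orbit w v ∧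
      {O | ∃ v', IsPrincipalPoint p q w v' ∧ O = orbit w v'} = {orbit w u, orbit w v} ∧
      n = s(Nat.card (isotropy w u), Nat.card (isotropy w v))

/-- `n = {{α₁, α₂}, {α₃, α₄}}` are the Dolgachev numbers `α₁, α₂; α₃, α₄` of the virtual
singularity `(h₁, h₂)`. -/
def HasDolgachevNumbers (s : Series) (n : Sym2 (Sym2 ℕ)) : Prop :=
  ∃ S T, S ≠ T ∧ outerFaces (h₁ s) (h₂ s) = {S, T} ∧
    ∃ a b : Sym2 ℕ, HasDolgachevPair (h₁ s) (facePart (h₁ s) (h₂ s) S) a ∧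
      HasDolgachevPair (h₁ s) (facePart (h₁ s) (h₂ s) T) b ∧ n = s(a, b)

/-! ### Contact equivalence and Gabrielov numbers -/

/-- `𝒦`-equivalence of the map germs at the origin `(ℂ⁴, 0) → ℂ²` given by two pairs of
polynomials: `F ∘ φ = N · G` for the germ `φ` of a biholomorphic map of `(ℂ⁴, 0)` and a germ `N` of
a holomorphic map to the invertible matrices. -/
def KEquivalent (F G : Fin 2 → Poly4) : Prop :=
  ∃ (φ : (Fin 4 → ℂ) → Fin 4 → ℂ) (N : (Fin 4 → ℂ) → Matrix (Fin 2) (Fin 2) ℂ),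
    AnalyticAt ℂ φ 0 ∧ φ 0 = 0 ∧ Function.Bijective (fderiv ℂ φ 0) ∧
    (∀ i j, AnalyticAt ℂ (fun v => N v i j) 0) ∧ (N 0).det ≠ 0 ∧
    ∀ᶠ v in nhds 0, (fun k => eval (φ v) (F k)) = (N v).mulVec fun k => eval v (G k)

/-- The first equation used for the Gabrielov numbers: in the first three cases, `z²` is
subtracted from `h₁`. -/
def gabrielovEq1 : Series → Poly4
  | .J => h₁ .J - X 2 ^ 2
  | .K => h₁ .K - X 2 ^ 2
  | .Kflat => h₁ .Kflat - X 2 ^ 2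
  | s => h₁ s

/-- The normal form `(x y - z^γ₁ - w^γ₂, x^γ₃ + y^γ₄ - z w)` of the cusp singularity
`T²_{γ₁,γ₃,γ₂,γ₄}`. -/
def cusp (γ₁ γ₂ γ₃ γ₄ : ℕ) : Fin 2 → Poly4 :=
  ![X 0 * X 1 - X 2 ^ γ₁ - X 3 ^ γ₂, X 0 ^ γ₃ + X 1 ^ γ₄ - X 2 * X 3]

/-- `n = {{γ₁, γ₂}, {γ₃, γ₄}}` are the Gabrielov numbers `γ₁, γ₂; γ₃, γ₄` of the virtual
singularity `(h₁, h₂)`. -/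
def HasGabrielovNumbers (s : Series) (n : Sym2 (Sym2 ℕ)) : Prop :=
  ∃ γ₁ γ₂ γ₃ γ₄ : ℕ, n = s(s(γ₁, γ₂), s(γ₃, γ₄)) ∧
    KEquivalent ![gabrielovEq1 s, h₂ s - X 2 * X 3] (cusp γ₁ γ₂ γ₃ γ₄)

end QuadrangleDuality

end

/-!
Three statements are combined: the table of the duality, the Dolgachev numbers, and the Gabrielov
numbers of the eight virtual singularities. The theorem follows as the Gabrielov numbers of `s` turn
out to be the Dolgachev numbers of `dualSeries s`, and `dualSeries` is an involution.

*Duality* (`isDual_iff`). A sum of monomials with coefficients `1` determines its matrix of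
exponents up to the order of the rows. Hence the multisets of row sums and of column sums and the
sum of the squares of the entries are invariants, the first two of which are exchanged by
transposition. They exclude every pair that is not in the table; for the pairs in the table suitable
orders of the rows give transposed matrices.

*Dolgachev numbers* (`hasDolgachevNumbers_iff_eq`). A system of weights for which `h₁` is
homogeneous is a linear functional on the exponents modulo the relation `h₁ = 0`. For each
singularity there are two systems of weights whose functional is maximal on three of the four terms
of `h₂`, and a linear relation between the four exponents shows that no outer face contains both
of the two terms that are missing on one of these faces, so that there are no further outer faces
(`maximal_exposed_faces`). On a face, a point has trivial isotropy group if two of its nonzero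
coordinates have coprime weights, so an exceptional point has few nonzero coordinates, and solving
the equations leaves exactly the two principal orbits (`exists_eq_mul_pow`).

*Existence of the Gabrielov numbers* (`kEquivalent_cusp_of_congr`). Let `I` be the ideal generated
by the six monomials of the equations `x y - z^a - w^b`, `x^c + y^d - z w` of a cusp. Two equations
that have this form, up to nonzero coefficients, modulo `𝔪 I` are sums of these monomials with
analytic coefficients. The substitutions that add to a coordinate of a pair `x, y` or `z, w` a power
of its partner preserve sums of this kind, and the implicit function theorem adjusts their
parameters so that the sums become combinations of the two equations of the cusp; at the origin this
amounts to the linear system for the logarithms of the scaling factors, whose determinant is nonzero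
because `(a + b) (c + d) ≠ a b c d`. It remains to exhibit for each singularity a polynomial
substitution that brings it to the normal form modulo `𝔪 I`, which is a computation with truncated
polynomials.

*Uniqueness of the Gabrielov numbers* (`KEquivalent.cusp_exponents_unique`). A contact equivalence
maps arcs along which the equations, or the equations and the `2 × 2` minors of their Jacobian
matrix, vanish to order `k` to arcs of the same kind; its derivative maps the tangent directions of
such arcs to each other. For a cusp with exponents at least two and for `k ≥ 3`, the directions of
the second kind are the coordinate axes whose exponent is at least `k`, which recovers the
exponents. The sum of vectors on two axes with exponents at least three is the direction of an arc
along which the equations vanish to order three if and only if the axes belong to different pairs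
`x, y` and `z, w`, which recovers the pairing. That the exponents are at least two means that the
equations have no terms of order less than two, which is invariant as well.
-/

noncomputable section

namespace QuadrangleDuality

open MvPolynomial
open Filter Topology

/-! ### Transformation of sums of monomials into the equations of a cusp -/

/-- The analytic implicit function theorem for the equation `H (e, u) = 0`; by `hinj` the derivative
of `H` with respect to `u` is injective. -/
theorem exists_analyticAt_implicit {E U V : Type*} [NormedAddCommGroup E] [NormedSpace ℂ E]
    [CompleteSpace E] [NormedAddCommGroup U] [NormedSpace ℂ U] [FiniteDimensional ℂ U]
    [NormedAddCommGroup V] [NormedSpace ℂ V] [FiniteDimensional ℂ V]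
    (hUV : Module.finrank ℂ U = Module.finrank ℂ V)
    {H : E × U → V} {e₀ : E} {u₀ : U} (hH : AnalyticAt ℂ H (e₀, u₀)) (h₀ : H (e₀, u₀) = 0)
    (hinj : ∀ du : U, HasDerivAt (fun s : ℂ => H (e₀, u₀ + s • du)) 0 0 → du = 0) :
    ∃ u : E → U, AnalyticAt ℂ u e₀ ∧ u e₀ = u₀ ∧ ∀ᶠ v in 𝓝 e₀, H (v, u v) = 0 := by
  have : CompleteSpace U := FiniteDimensional.complete ℂ U
  have : CompleteSpace V := FiniteDimensional.complete ℂ V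
  have hc : ContDiffAt ℂ ⊤ H (e₀, u₀) := hH.contDiffAt
  have hn : (⊤ : WithTop ℕ∞) ≠ 0 := by simp
  set D := fderiv ℂ H (e₀, u₀) ∘L .inr ℂ E U with hD
  have hDinj : Function.Injective D := by
    rw [injective_iff_map_eq_zero]
    intro du hdu
    apply hinj
    have h1 : HasFDerivAt H (fderiv ℂ H (e₀, u₀)) (e₀, u₀ + (0 : ℂ) • du) := by
      simpa using hH.differentiableAt.hasFDerivAt
    have h2 : HasDerivAt (fun s : ℂ => ((e₀, u₀ + s • du) : E × U)) ((0 : E), du) 0 := by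
      refine (hasDerivAt_const _ _).prodMk ?_
      simpa using ((hasDerivAt_id (0 : ℂ)).smul_const du).const_add u₀
    have h3 := h1.comp_hasDerivAt (0 : ℂ) h2
    have h4 : fderiv ℂ H (e₀, u₀) ((0 : E), du) = 0 := by simpa [hD] using hdu
    rw [h4] at h3
    exact h3
  have hDinv : D.IsInvertible :=
    ⟨(LinearEquiv.ofInjectiveOfFinrankEq (D : U →ₗ[ℂ] V) hDinj hUV).toContinuousLinearEquiv, by
      ext; rfl⟩
  refine ⟨hc.implicitFunction hn hDinv, ?_, hc.implicitFunction_apply_self hn hDinv, ?_⟩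
  · exact (hc.contDiffAt_implicitFunction hn hDinv).analyticAt
  · have := hc.eventually_apply_implicitFunction hn hDinv
    simpa [h₀] using this

/-- The polynomial `R` with `(A + B)^(n+2) = A^(n+2) + B^(n+2) + A B R(A, B)`. -/
def mixedPart : ℕ → ℂ → ℂ → ℂ
  | 0, _, _ => 2
  | n + 1, A, B => (A + B) * mixedPart n A B + A ^ (n + 1) + B ^ (n + 1)

theorem add_pow_eq_mixedPart (n : ℕ) (A B : ℂ) :
    (A + B) ^ (n + 2) = A ^ (n + 2) + B ^ (n + 2) + A * B * mixedPart n A B := by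
  induction n with
  | zero => simp [mixedPart]; ring
  | succ n ih =>
    rw [show n + 1 + 2 = (n + 2) + 1 from rfl, pow_succ (A + B), ih, mixedPart]
    ring

theorem mixedPart_zero_zero (n : ℕ) : mixedPart n 0 0 = 2 * 0 ^ n := by
  induction n with
  | zero => simp [mixedPart]
  | succ n ih => simp [mixedPart]

theorem analyticAt_mixedPart {E : Type*} [NormedAddCommGroup E] [NormedSpace ℂ E] (n : ℕ)
    {f g : E → ℂ} {e : E} (hf : AnalyticAt ℂ f e) (hg : AnalyticAt ℂ g e) :
    AnalyticAt ℂ (fun v => mixedPart n (f v) (g v)) e := by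
  induction n with
  | zero => exact analyticAt_const
  | succ n ih => exact (((hf.add hg).mul ih).add (hf.pow _)).add (hg.pow _)

/-- The sum of the six monomials `x y`, `z w`, `z ^ (a + 2)`, `w ^ (b + 2)`, `x ^ (c + 2)`,
`y ^ (d + 2)` of the equations of a cusp with the coefficients `P`, where those of the powers of `z`
and `w` are taken with the sign that they have in the first equation. The shift by two expresses
that the exponents of a cusp are at least two. -/
def monomialSum (a b c d : ℕ) (P : Fin 6 → ℂ) (v : Fin 4 → ℂ) : ℂ :=
  P 0 * (v 0 * v 1) + P 1 * (v 2 * v 3) - P 2 * v 2 ^ (a + 2) - P 3 * v 3 ^ (b + 2) +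
    P 4 * v 0 ^ (c + 2) + P 5 * v 1 ^ (d + 2)

/-- The substitution that multiplies the coordinates by `m` and adds to each of them a multiple `n`
of a power of its partner in the pairs `x, y` and `z, w`. The exponent is one less than that of the
partner in `monomialSum`, so that the product `x y` or `z w` contributes this power again. -/
def axisSubst (a b c d : ℕ) (m n v : Fin 4 → ℂ) : Fin 4 → ℂ :=
  ![m 0 * v 0 + n 0 * v 1 ^ (d + 1), m 1 * v 1 + n 1 * v 0 ^ (c + 1),
    m 2 * v 2 + n 2 * v 3 ^ (b + 1), m 3 * v 3 + n 3 * v 2 ^ (a + 1)]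

/-- The coefficients of the pullback of `monomialSum` under `axisSubst`. -/
def substCoeff (a b c d : ℕ) (P : Fin 6 → ℂ) (m n v : Fin 4 → ℂ) : Fin 6 → ℂ :=
  ![P 0 * (m 0 * m 1 + n 0 * n 1 * (v 0 ^ c * v 1 ^ d)) +
      P 4 * (m 0 * n 0 * v 1 ^ d * mixedPart c (m 0 * v 0) (n 0 * v 1 ^ (d + 1))) +
      P 5 * (m 1 * n 1 * v 0 ^ c * mixedPart d (m 1 * v 1) (n 1 * v 0 ^ (c + 1))),
    P 1 * (m 2 * m 3 + n 2 * n 3 * (v 2 ^ a * v 3 ^ b)) -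
      P 2 * (m 2 * n 2 * v 3 ^ b * mixedPart a (m 2 * v 2) (n 2 * v 3 ^ (b + 1))) -
      P 3 * (m 3 * n 3 * v 2 ^ a * mixedPart b (m 3 * v 3) (n 3 * v 2 ^ (a + 1))),
    P 2 * m 2 ^ (a + 2) + P 3 * (n 3 ^ (b + 2) * v 2 ^ (a * b + a + b)) - P 1 * (m 2 * n 3),
    P 3 * m 3 ^ (b + 2) + P 2 * (n 2 ^ (a + 2) * v 3 ^ (a * b + a + b)) - P 1 * (n 2 * m 3),
    P 4 * m 0 ^ (c + 2) + P 5 * (n 1 ^ (d + 2) * v 0 ^ (c * d + c + d)) + P 0 * (m 0 * n 1),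
    P 5 * m 1 ^ (d + 2) + P 4 * (n 0 ^ (c + 2) * v 1 ^ (c * d + c + d)) + P 0 * (n 0 * m 1)]

/-- The substitutions `axisSubst` preserve the sums of the six monomials. -/
theorem monomialSum_axisSubst (a b c d : ℕ) (P : Fin 6 → ℂ) (m n v : Fin 4 → ℂ) :
    monomialSum a b c d P (axisSubst a b c d m n v) =
      monomialSum a b c d (substCoeff a b c d P m n v) v := by
  simp only [monomialSum, axisSubst, substCoeff, Matrix.cons_val]
  simp only [add_pow_eq_mixedPart]
  ring

/-- The exchange of the pairs `x, y` and `z, w`, which exchanges the two equations of a cusp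
up to sign. -/
def swapPairs (v : Fin 4 → ℂ) : Fin 4 → ℂ := ![v 2, v 3, v 0, v 1]

theorem axisSubst_swapPairs (a b c d : ℕ) (m n v : Fin 4 → ℂ) :
    axisSubst c d a b (swapPairs m) (swapPairs n) (swapPairs v) =
      swapPairs (axisSubst a b c d m n v) := by
  simp [axisSubst, swapPairs]

/-- The linear conditions on the coefficients of `monomialSum` under which it is a combination of
the two equations of the cusp. -/
def cuspDefect (C : Fin 6 → ℂ) : Fin 4 → ℂ :=
  ![C 2 - C 0, C 3 - C 0, C 4 + C 1, C 5 + C 1]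

theorem monomialSum_of_cuspDefect_eq_zero {a b c d : ℕ} {C : Fin 6 → ℂ} (h : cuspDefect C = 0)
    (v : Fin 4 → ℂ) :
    monomialSum a b c d C v = C 0 * (v 0 * v 1 - v 2 ^ (a + 2) - v 3 ^ (b + 2)) -
      C 1 * (v 0 ^ (c + 2) + v 1 ^ (d + 2) - v 2 * v 3) := by
  have h0 := congrFun h 0
  have h1 := congrFun h 1
  have h2 := congrFun h 2
  have h3 := congrFun h 3
  simp only [cuspDefect, Matrix.cons_val, Pi.zero_apply] at h0 h1 h2 h3
  simp only [monomialSum]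
  linear_combination -v 2 ^ (a + 2) * h0 - v 3 ^ (b + 2) * h1 + v 0 ^ (c + 2) * h2 +
    v 1 ^ (d + 2) * h3

/-- The scaling factors that normalize all coefficients. In terms of logarithms this is a linear
system with the determinant `a b c d - (a + b) (c + d)`. -/
theorem exists_scales {α₁ α₃ α₄ β₁ β₃ β₄ : ℂ} (hα₁ : α₁ ≠ 0) (hα₃ : α₃ ≠ 0) (hα₄ : α₄ ≠ 0)
    (hβ₁ : β₁ ≠ 0) (hβ₃ : β₃ ≠ 0) (hβ₄ : β₄ ≠ 0) {a b c d : ℕ} (ha : a ≠ 0) (hb : b ≠ 0)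
    (hc : c ≠ 0) (hd : d ≠ 0) (habcd : (a + b) * (c + d) ≠ a * b * c * d) :
    ∃ m : Fin 4 → ℂ, (∀ i, m i ≠ 0) ∧ α₃ * m 2 ^ a = α₁ * (m 0 * m 1) ∧
      α₄ * m 3 ^ b = α₁ * (m 0 * m 1) ∧ β₃ * m 0 ^ c = β₁ * (m 2 * m 3) ∧
      β₄ * m 1 ^ d = β₁ * (m 2 * m 3) := by
  have e : ∀ {z : ℂ}, z ≠ 0 → ∃ l, z = Complex.exp l := fun {z} hz =>
    ⟨Complex.log z, (Complex.exp_log hz).symm⟩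
  obtain ⟨A₁, rfl⟩ := e hα₁
  obtain ⟨A₃, rfl⟩ := e hα₃
  obtain ⟨A₄, rfl⟩ := e hα₄
  obtain ⟨B₁, rfl⟩ := e hβ₁
  obtain ⟨B₃, rfl⟩ := e hβ₃
  obtain ⟨B₄, rfl⟩ := e hβ₄
  have ha' : (a : ℂ) ≠ 0 := Nat.cast_ne_zero.2 ha
  have hb' : (b : ℂ) ≠ 0 := Nat.cast_ne_zero.2 hb
  have hc' : (c : ℂ) ≠ 0 := Nat.cast_ne_zero.2 hc
  have hd' : (d : ℂ) ≠ 0 := Nat.cast_ne_zero.2 hd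
  have hD : (a * b * c * d - (a + b) * (c + d) : ℂ) ≠ 0 := by
    rw [sub_ne_zero]
    exact_mod_cast habcd.symm
  -- `s` and `r` are the logarithms of the common values of the two chains of equations.
  obtain ⟨s, r, hs, hr⟩ : ∃ s r : ℂ, s = A₁ + (r - B₃) / c + (r - B₄) / d ∧
      r = B₁ + (s - A₃) / a + (s - A₄) / b := by
    set K := A₁ - B₃ / c - B₄ / d with hK
    set M := B₁ - A₃ / a - A₄ / b with hM
    set D := (a * b * c * d - (a + b) * (c + d) : ℂ) with hDd
    refine ⟨(K + (1 / c + 1 / d) * M) * (a * b * c * d) / D,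
      (M + (1 / a + 1 / b) * K) * (a * b * c * d) / D, ?_, ?_⟩
    · rw [hK, hM]
      field_simp
      rw [hDd]
      ring
    · rw [hK, hM]
      field_simp
      rw [hDd]
      ring
  refine ⟨![Complex.exp ((r - B₃) / c), Complex.exp ((r - B₄) / d), Complex.exp ((s - A₃) / a),
    Complex.exp ((s - A₄) / b)], ?_, ?_, ?_, ?_, ?_⟩
  · intro i
    fin_cases i <;> exact Complex.exp_ne_zero _
  all_goals
    simp only [Matrix.cons_val]
    rw [← Complex.exp_nat_mul]
    simp only [← Complex.exp_add]
    congr 1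
    field_simp
  · rw [hs]; field_simp; ring
  · rw [hs]; field_simp; ring
  · rw [hr]; field_simp; ring
  · rw [hr]; field_simp; ring

theorem analyticAt_axisSubst {E : Type*} [NormedAddCommGroup E] [NormedSpace ℂ E] (a b c d : ℕ)
    {m n v : E → Fin 4 → ℂ} {e : E} (hm : AnalyticAt ℂ m e) (hn : AnalyticAt ℂ n e)
    (hv : AnalyticAt ℂ v e) :
    AnalyticAt ℂ (fun t => axisSubst a b c d (m t) (n t) (v t)) e := by
  rw [analyticAt_pi_iff] at hm hn hv ⊢
  intro i
  fin_cases i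
  · exact ((hm 0).mul (hv 0)).add ((hn 0).mul ((hv 1).pow _))
  · exact ((hm 1).mul (hv 1)).add ((hn 1).mul ((hv 0).pow _))
  · exact ((hm 2).mul (hv 2)).add ((hn 2).mul ((hv 3).pow _))
  · exact ((hm 3).mul (hv 3)).add ((hn 3).mul ((hv 2).pow _))

theorem analyticAt_swapPairs {E : Type*} [NormedAddCommGroup E] [NormedSpace ℂ E]
    {v : E → Fin 4 → ℂ} {e : E} (hv : AnalyticAt ℂ v e) :
    AnalyticAt ℂ (fun t => swapPairs (v t)) e := by
  rw [analyticAt_pi_iff] at hv ⊢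
  intro i
  fin_cases i
  exacts [hv 2, hv 3, hv 0, hv 1]

theorem analyticAt_substCoeff {E : Type*} [NormedAddCommGroup E] [NormedSpace ℂ E] (a b c d : ℕ)
    {P : E → Fin 6 → ℂ} {m n v : E → Fin 4 → ℂ} {e : E} (hP : AnalyticAt ℂ P e)
    (hm : AnalyticAt ℂ m e) (hn : AnalyticAt ℂ n e) (hv : AnalyticAt ℂ v e) :
    AnalyticAt ℂ (fun t => substCoeff a b c d (P t) (m t) (n t) (v t)) e := by
  rw [analyticAt_pi_iff] at hP hm hn hv ⊢
  have hR : ∀ (k l : ℕ) (i j : Fin 4), AnalyticAt ℂ (fun t => mixedPart k (m t i * v t i)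
      (n t i * v t j ^ (l + 1))) e := fun k l i j =>
    analyticAt_mixedPart k ((hm i).mul (hv i)) ((hn i).mul ((hv j).pow _))
  intro i
  fin_cases i
  · exact (((hP 0).mul (((hm 0).mul (hm 1)).add (((hn 0).mul (hn 1)).mul
      (((hv 0).pow _).mul ((hv 1).pow _))))).add ((hP 4).mul ((((hm 0).mul (hn 0)).mul
      ((hv 1).pow _)).mul (hR _ _ _ _)))).add ((hP 5).mul ((((hm 1).mul (hn 1)).mul
      ((hv 0).pow _)).mul (hR _ _ _ _)))
  · exact (((hP 1).mul (((hm 2).mul (hm 3)).add (((hn 2).mul (hn 3)).mul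
      (((hv 2).pow _).mul ((hv 3).pow _))))).sub ((hP 2).mul ((((hm 2).mul (hn 2)).mul
      ((hv 3).pow _)).mul (hR _ _ _ _)))).sub ((hP 3).mul ((((hm 3).mul (hn 3)).mul
      ((hv 2).pow _)).mul (hR _ _ _ _)))
  · exact (((hP 2).mul ((hm 2).pow _)).add ((hP 3).mul (((hn 3).pow _).mul ((hv 2).pow _)))).sub
      ((hP 1).mul ((hm 2).mul (hn 3)))
  · exact (((hP 3).mul ((hm 3).pow _)).add ((hP 2).mul (((hn 2).pow _).mul ((hv 3).pow _)))).sub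
      ((hP 1).mul ((hn 2).mul (hm 3)))
  · exact (((hP 4).mul ((hm 0).pow _)).add ((hP 5).mul (((hn 1).pow _).mul ((hv 0).pow _)))).add
      ((hP 0).mul ((hm 0).mul (hn 1)))
  · exact (((hP 5).mul ((hm 1).pow _)).add ((hP 4).mul (((hn 0).pow _).mul ((hv 1).pow _)))).add
      ((hP 0).mul ((hn 0).mul (hm 1)))

theorem analyticAt_cuspDefect {E : Type*} [NormedAddCommGroup E] [NormedSpace ℂ E]
    {C : E → Fin 6 → ℂ} {e : E} (hC : AnalyticAt ℂ C e) :
    AnalyticAt ℂ (fun t => cuspDefect (C t)) e := by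
  rw [analyticAt_pi_iff] at hC ⊢
  intro i
  fin_cases i
  exacts [(hC 2).sub (hC 0), (hC 3).sub (hC 0), (hC 4).add (hC 1), (hC 5).add (hC 1)]

/-- The derivative of the defect with respect to the parameters of `axisSubst`, at the origin. The
terms with the factor `0 ^ (a + b)` occur only for `a = b = 0`. -/
theorem defect_deriv {a b c d : ℕ} {P : Fin 6 → ℂ} (h1 : P 1 = 0) (h4 : P 4 = 0) (h5 : P 5 = 0)
    {m dm dn : Fin 4 → ℂ}
    (h : HasDerivAt (fun s : ℂ =>
      cuspDefect (substCoeff a b c d P (m + s • dm) (s • dn) 0)) 0 0) :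
    P 2 * ((a + 2) * m 2 ^ (a + 1) * dm 2) = P 0 * (m 0 * dm 1 + m 1 * dm 0) ∧
    P 3 * ((b + 2) * m 3 ^ (b + 1) * dm 3) = P 0 * (m 0 * dm 1 + m 1 * dm 0) ∧
    P 0 * (m 0 * dn 1) = 0 ^ (a + b) * (2 * (P 2 * m 2 * dn 2 + P 3 * m 3 * dn 3)) ∧
    P 0 * (m 1 * dn 0) = 0 ^ (a + b) * (2 * (P 2 * m 2 * dn 2 + P 3 * m 3 * dn 3)) := by
  rw [hasDerivAt_pi] at h
  have hm : ∀ i, HasDerivAt (fun s : ℂ => m i + s * dm i) (dm i) 0 := fun i => by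
    simpa using ((hasDerivAt_id (0 : ℂ)).mul_const (dm i)).const_add (m i)
  have hn : ∀ i, HasDerivAt (fun s : ℂ => s * dn i) (dn i) 0 := fun i => by
    simpa using (hasDerivAt_id (0 : ℂ)).mul_const (dn i)
  have g0 := h 0
  have g1 := h 1
  have g2 := h 2
  have g3 := h 3
  simp only [cuspDefect, substCoeff, Matrix.cons_val, h1, h4, h5, Pi.add_apply, Pi.smul_apply,
    smul_eq_mul, Pi.zero_apply, zero_mul, add_zero, mul_zero, sub_zero, zero_sub, zero_add,
    zero_pow (Nat.succ_ne_zero _), mixedPart_zero_zero] at g0 g1 g2 g3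
  have hXY := ((((hm 0).mul (hm 1)).add (((hn 0).mul (hn 1)).mul_const (0 ^ c * 0 ^ d))).const_mul
    (P 0))
  have hZW := ((((hm 2).mul (hn 2)).mul_const (0 ^ b)).mul_const (2 * 0 ^ a)).const_mul (P 2)
  have hZW' := ((((hm 3).mul (hn 3)).mul_const (0 ^ a)).mul_const (2 * 0 ^ b)).const_mul (P 3)
  have e0 := g0.unique (((((hm 2).pow (a + 2)).const_mul (P 2)).add
    ((((hn 3).pow (b + 2)).mul_const (0 ^ (a * b + a + b))).const_mul (P 3))).sub hXY)
  have e1 := g1.unique (((((hm 3).pow (b + 2)).const_mul (P 3)).add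
    ((((hn 2).pow (a + 2)).mul_const (0 ^ (a * b + a + b))).const_mul (P 2))).sub hXY)
  have e2 := g2.unique ((((hm 0).mul (hn 1)).const_mul (P 0)).add (hZW.neg.sub hZW'))
  have e3 := g3.unique ((((hn 0).mul (hm 1)).const_mul (P 0)).add (hZW.neg.sub hZW'))
  simp at e0 e1 e2 e3
  refine ⟨?_, ?_, ?_, ?_⟩
  · linear_combination -e0
  · linear_combination -e1
  · rw [pow_add]; linear_combination -e2
  · rw [pow_add]; linear_combination -e3

/-- The linearized equations of the scaling factors have only the trivial solution. -/
theorem scales_rigid {α₁ α₃ α₄ β₁ β₃ β₄ : ℂ} (hα₁ : α₁ ≠ 0) (hβ₁ : β₁ ≠ 0)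
    {a b c d : ℕ} (habcd : (a + 2 + (b + 2)) * (c + 2 + (d + 2)) ≠
      (a + 2) * (b + 2) * (c + 2) * (d + 2))
    {m dm : Fin 4 → ℂ} (hm : ∀ i, m i ≠ 0) (e₂ : α₃ * m 2 ^ (a + 2) = α₁ * (m 0 * m 1))
    (e₃ : α₄ * m 3 ^ (b + 2) = α₁ * (m 0 * m 1)) (e₀ : β₃ * m 0 ^ (c + 2) = β₁ * (m 2 * m 3))
    (e₁ : β₄ * m 1 ^ (d + 2) = β₁ * (m 2 * m 3))
    (f₂ : α₃ * ((a + 2) * m 2 ^ (a + 1) * dm 2) = α₁ * (m 0 * dm 1 + m 1 * dm 0))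
    (f₃ : α₄ * ((b + 2) * m 3 ^ (b + 1) * dm 3) = α₁ * (m 0 * dm 1 + m 1 * dm 0))
    (f₀ : β₃ * ((c + 2) * m 0 ^ (c + 1) * dm 0) = β₁ * (m 2 * dm 3 + m 3 * dm 2))
    (f₁ : β₄ * ((d + 2) * m 1 ^ (d + 1) * dm 1) = β₁ * (m 2 * dm 3 + m 3 * dm 2)) :
    dm = 0 := by
  -- The logarithmic derivatives `l i` satisfy a linear system with nonzero determinant.
  obtain ⟨l, hl⟩ : ∃ l : Fin 4 → ℂ, ∀ i, dm i = m i * l i :=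
    ⟨fun i => dm i / m i, fun i => by rw [mul_div_cancel₀ _ (hm i)]⟩
  rw [hl, hl 1, hl 0] at f₂
  rw [hl, hl 1, hl 0] at f₃
  rw [hl, hl 2, hl 3] at f₀
  rw [hl, hl 2, hl 3] at f₁
  have hA : α₁ * (m 0 * m 1) ≠ 0 := mul_ne_zero hα₁ (mul_ne_zero (hm 0) (hm 1))
  have hB : β₁ * (m 2 * m 3) ≠ 0 := mul_ne_zero hβ₁ (mul_ne_zero (hm 2) (hm 3))
  have g₂ : (a + 2) * l 2 = l 0 + l 1 := by
    apply mul_left_cancel₀ hA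
    linear_combination f₂ - (a + 2) * l 2 * e₂
  have g₃ : (b + 2) * l 3 = l 0 + l 1 := by
    apply mul_left_cancel₀ hA
    linear_combination f₃ - (b + 2) * l 3 * e₃
  have g₀ : (c + 2) * l 0 = l 2 + l 3 := by
    apply mul_left_cancel₀ hB
    linear_combination f₀ - (c + 2) * l 0 * e₀
  have g₁ : (d + 2) * l 1 = l 2 + l 3 := by
    apply mul_left_cancel₀ hB
    linear_combination f₁ - (d + 2) * l 1 * e₁
  have hne : ∀ k : ℕ, (k + 2 : ℂ) ≠ 0 := fun k => by exact_mod_cast (Nat.succ_ne_zero (k + 1))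
  have hD : (((a + 2) + (b + 2)) * ((c + 2) + (d + 2)) -
      (a + 2) * (b + 2) * (c + 2) * (d + 2) : ℂ) ≠ 0 := by
    rw [sub_ne_zero]
    exact_mod_cast habcd
  have hs : l 0 + l 1 = 0 := by
    refine (mul_eq_zero.1 ?_).resolve_left hD
    linear_combination (-(c + d + 4) * (b + 2)) * g₂ - (c + d + 4) * (a + 2) * g₃ -
      (a + 2) * (b + 2) * (d + 2) * g₀ - (a + 2) * (b + 2) * (c + 2) * g₁
  rw [hs] at g₂ g₃
  have l2 := (mul_eq_zero.1 g₂).resolve_left (hne a)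
  have l3 := (mul_eq_zero.1 g₃).resolve_left (hne b)
  rw [l2, l3, add_zero] at g₀ g₁
  have l0 := (mul_eq_zero.1 g₀).resolve_left (hne c)
  have l1 := (mul_eq_zero.1 g₁).resolve_left (hne d)
  funext i
  rw [hl]
  fin_cases i <;> simp [l0, l1, l2, l3]

theorem axisSubst_zero (a b c d : ℕ) (m n : Fin 4 → ℂ) : axisSubst a b c d m n 0 = 0 := by
  funext i
  fin_cases i <;> simp [axisSubst]

theorem swapPairs_zero : swapPairs 0 = 0 := by
  funext i
  fin_cases i <;> rfl

theorem swapPairs_add_smul (s : ℂ) (p q : Fin 4 → ℂ) :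
    swapPairs (p + s • q) = swapPairs p + s • swapPairs q := by
  funext i
  fin_cases i <;> simp [swapPairs]

theorem swapPairs_smul (s : ℂ) (p : Fin 4 → ℂ) : swapPairs (s • p) = s • swapPairs p := by
  funext i
  fin_cases i <;> simp [swapPairs]

/-- The derivative of the two defects with respect to the parameters is injective: the equations for
`dm` are those of the scaling factors, and the equations for `dn` decouple as `a = b = c = d = 0` is
excluded. -/
theorem defect_injective {a b c d : ℕ} (hab : a + b ≠ 0 ∨ c + d ≠ 0)
    (habcd : (a + 2 + (b + 2)) * (c + 2 + (d + 2)) ≠ (a + 2) * (b + 2) * (c + 2) * (d + 2))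
    {P Q : Fin 6 → ℂ} (hP0 : P 0 ≠ 0) (hP1 : P 1 = 0) (hP4 : P 4 = 0) (hP5 : P 5 = 0)
    (hQ0 : Q 0 ≠ 0) (hQ1 : Q 1 = 0) (hQ4 : Q 4 = 0) (hQ5 : Q 5 = 0)
    {m dm dn : Fin 4 → ℂ} (hm : ∀ i, m i ≠ 0)
    (e₂ : P 2 * m 2 ^ (a + 2) = P 0 * (m 0 * m 1)) (e₃ : P 3 * m 3 ^ (b + 2) = P 0 * (m 0 * m 1))
    (e₀ : Q 2 * m 0 ^ (c + 2) = Q 0 * (m 2 * m 3)) (e₁ : Q 3 * m 1 ^ (d + 2) = Q 0 * (m 2 * m 3))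
    (h1 : HasDerivAt (fun s : ℂ =>
      cuspDefect (substCoeff a b c d P (m + s • dm) (s • dn) 0)) 0 0)
    (h2 : HasDerivAt (fun s : ℂ => cuspDefect (substCoeff c d a b Q
      (swapPairs m + s • swapPairs dm) (s • swapPairs dn) 0)) 0 0) :
    dm = 0 ∧ dn = 0 := by
  obtain ⟨f₂, f₃, k₁, k₀⟩ := defect_deriv hP1 hP4 hP5 h1
  obtain ⟨f₀, f₁, k₃, k₂⟩ := defect_deriv hQ1 hQ4 hQ5 h2
  simp only [swapPairs, Matrix.cons_val] at f₀ f₁ k₂ k₃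
  refine ⟨scales_rigid hP0 hQ0 habcd hm e₂ e₃ e₀ e₁ f₂ f₃ f₀ f₁, ?_⟩
  have cancel : ∀ {p q r : ℂ}, p ≠ 0 → q ≠ 0 → p * (q * r) = 0 → r = 0 := by
    intro p q r hp hq h
    simpa [hp, hq] using h
  rcases hab with hab | hab
  · rw [zero_pow hab, zero_mul] at k₀ k₁
    have n0 := cancel hP0 (hm 1) k₀
    have n1 := cancel hP0 (hm 0) k₁
    rw [n0, n1] at k₂ k₃
    simp only [mul_zero, add_zero] at k₂ k₃
    have n2 := cancel hQ0 (hm 3) k₂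
    have n3 := cancel hQ0 (hm 2) k₃
    funext i
    fin_cases i
    exacts [n0, n1, n2, n3]
  · rw [zero_pow hab, zero_mul] at k₂ k₃
    have n2 := cancel hQ0 (hm 3) k₂
    have n3 := cancel hQ0 (hm 2) k₃
    rw [n2, n3] at k₀ k₁
    simp only [mul_zero, add_zero] at k₀ k₁
    have n0 := cancel hP0 (hm 1) k₀
    have n1 := cancel hP0 (hm 0) k₁
    funext i
    fin_cases i
    exacts [n0, n1, n2, n3]

theorem analyticAt_pulledCoeff (a b c d : ℕ) {E : Type*} [NormedAddCommGroup E] [NormedSpace ℂ E]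
    {P : (Fin 4 → ℂ) → Fin 6 → ℂ} (hP : AnalyticAt ℂ P 0) {m n v : E → Fin 4 → ℂ} {e : E}
    (hm : AnalyticAt ℂ m e) (hn : AnalyticAt ℂ n e) (hv : AnalyticAt ℂ v e) (hv0 : v e = 0) :
    AnalyticAt ℂ (fun t => P (axisSubst a b c d (m t) (n t) (v t))) e := by
  have h := analyticAt_axisSubst a b c d hm hn hv
  refine AnalyticAt.comp (g := P) ?_ h
  rw [hv0, axisSubst_zero]
  exact hP

/-- Analytic parameters of `axisSubst` for which the pullbacks of two sums of monomials are
combinations of the two equations of the cusp. -/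
theorem exists_subst_parameters {a b c d : ℕ} (hab : a + b ≠ 0 ∨ c + d ≠ 0)
    (habcd : (a + 2 + (b + 2)) * (c + 2 + (d + 2)) ≠ (a + 2) * (b + 2) * (c + 2) * (d + 2))
    {P Q : (Fin 4 → ℂ) → Fin 6 → ℂ} (hP : AnalyticAt ℂ P 0) (hQ : AnalyticAt ℂ Q 0)
    (hP0 : P 0 0 ≠ 0) (hP1 : P 0 1 = 0) (hP2 : P 0 2 ≠ 0) (hP3 : P 0 3 ≠ 0) (hP4 : P 0 4 = 0)
    (hP5 : P 0 5 = 0) (hQ0 : Q 0 0 ≠ 0) (hQ1 : Q 0 1 = 0) (hQ2 : Q 0 2 ≠ 0) (hQ3 : Q 0 3 ≠ 0)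
    (hQ4 : Q 0 4 = 0) (hQ5 : Q 0 5 = 0) :
    ∃ (m n : (Fin 4 → ℂ) → Fin 4 → ℂ), AnalyticAt ℂ m 0 ∧ AnalyticAt ℂ n 0 ∧
      (∀ i, m 0 i ≠ 0) ∧ n 0 = 0 ∧ ∀ᶠ v in 𝓝 0,
        cuspDefect (substCoeff a b c d (P (axisSubst a b c d (m v) (n v) v)) (m v) (n v) v) = 0 ∧
        cuspDefect (substCoeff c d a b (Q (axisSubst a b c d (m v) (n v) v)) (swapPairs (m v))
          (swapPairs (n v)) (swapPairs v)) = 0 := by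
  obtain ⟨m₀, hm₀, e₂, e₃, e₀, e₁⟩ := exists_scales hP0 hP2 hP3 hQ0 hQ2 hQ3
    (Nat.succ_ne_zero (a + 1)) (Nat.succ_ne_zero (b + 1)) (Nat.succ_ne_zero (c + 1))
    (Nat.succ_ne_zero (d + 1)) habcd
  have hv : AnalyticAt ℂ (fun t : (Fin 4 → ℂ) × (Fin 4 → ℂ) × (Fin 4 → ℂ) => t.1) (0, m₀, 0) :=
    analyticAt_fst
  have hm : AnalyticAt ℂ (fun t : (Fin 4 → ℂ) × (Fin 4 → ℂ) × (Fin 4 → ℂ) => t.2.1) (0, m₀, 0) :=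
    analyticAt_fst.comp analyticAt_snd
  have hn : AnalyticAt ℂ (fun t : (Fin 4 → ℂ) × (Fin 4 → ℂ) × (Fin 4 → ℂ) => t.2.2) (0, m₀, 0) :=
    analyticAt_snd.comp analyticAt_snd
  have hPS := analyticAt_pulledCoeff a b c d hP hm hn hv rfl
  have hQS := analyticAt_pulledCoeff a b c d hQ hm hn hv rfl
  have hC := analyticAt_cuspDefect (analyticAt_substCoeff a b c d hPS hm hn hv)
  have hD := analyticAt_cuspDefect (analyticAt_substCoeff c d a b hQS (analyticAt_swapPairs hm)
    (analyticAt_swapPairs hn) (analyticAt_swapPairs hv))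
  obtain ⟨u, hu, hu0, hu'⟩ := exists_analyticAt_implicit rfl (hC.prod hD)
    (by
      simp only [axisSubst_zero, swapPairs_zero, Prod.mk_eq_zero]
      constructor
      · funext i
        fin_cases i <;>
          simp [cuspDefect, substCoeff, hP1, hP4, hP5, e₂, e₃]
      · funext i
        fin_cases i <;>
          simp [cuspDefect, substCoeff, hQ1, hQ4, hQ5, swapPairs, e₀, e₁])
    (by
      rintro ⟨dm, dn⟩ h
      have h1 := (hasFDerivAt_fst.comp_hasDerivAt (0 : ℂ) h)
      have h2 := (hasFDerivAt_snd.comp_hasDerivAt (0 : ℂ) h)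
      simp only [Function.comp_def, Prod.smul_mk, Prod.mk_add_mk, axisSubst_zero,
        swapPairs_add_smul, swapPairs_smul, zero_add, swapPairs_zero] at h1 h2
      obtain ⟨hdm, hdn⟩ := defect_injective hab habcd hP0 hP1 hP4 hP5 hQ0 hQ1 hQ4 hQ5 hm₀ e₂ e₃
        e₀ e₁ h1 h2
      rw [hdm, hdn, Prod.mk_zero_zero])
  refine ⟨fun v => (u v).1, fun v => (u v).2, analyticAt_fst.comp hu, analyticAt_snd.comp hu, ?_,
    ?_, ?_⟩
  · simpa [hu0] using hm₀
  · simp [hu0]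
  · filter_upwards [hu'] with v hv
    exact Prod.mk.inj hv

theorem hasFDerivAt_axisSubst (a b c d : ℕ) {m n : (Fin 4 → ℂ) → Fin 4 → ℂ}
    (hm : DifferentiableAt ℂ m 0) (hn : DifferentiableAt ℂ n 0) (hn0 : n 0 = 0) :
    HasFDerivAt (fun v => axisSubst a b c d (m v) (n v) v) (ContinuousLinearMap.pi fun i =>
      m 0 i • (ContinuousLinearMap.proj i : (Fin 4 → ℂ) →L[ℂ] ℂ)) 0 := by
  rw [hasFDerivAt_pi]
  have hprod : ∀ {f g : (Fin 4 → ℂ) → ℂ} {g' : (Fin 4 → ℂ) →L[ℂ] ℂ}, DifferentiableAt ℂ f 0 →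
      HasFDerivAt g g' 0 → g 0 = 0 → HasFDerivAt (fun v => f v * g v) (f 0 • g') 0 := by
    intro f g g' hf hg h0
    refine (hf.hasFDerivAt.mul hg).congr_fderiv ?_
    ext v
    simp [h0]
  have hp : ∀ i, HasFDerivAt (fun v : Fin 4 → ℂ => v i) (ContinuousLinearMap.proj i) 0 :=
    fun i => (ContinuousLinearMap.proj (R := ℂ) (φ := fun _ : Fin 4 => ℂ) i).hasFDerivAt
  have key : ∀ (i j : Fin 4) (k : ℕ), HasFDerivAt
      (fun v : Fin 4 → ℂ => m v i * v i + n v i * v j ^ (k + 1))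
      (m 0 i • (ContinuousLinearMap.proj i : (Fin 4 → ℂ) →L[ℂ] ℂ)) 0 := by
    intro i j k
    have h1 := hprod (differentiableAt_pi.1 hm i) (hp i) rfl
    have h2 := hprod (differentiableAt_pi.1 hn i) ((hp j).pow (k + 1)) (by simp)
    refine (h1.add h2).congr_fderiv ?_
    ext v
    simp [hn0]
  intro i
  fin_cases i
  · exact key 0 1 d
  · exact key 1 0 c
  · exact key 2 3 b
  · exact key 3 2 a

/-- Two sums of monomials with analytic coefficients `P` and `Q` whose values at the origin are
those of the cusp, up to nonzero factors, are transformed into the equations of the cusp by an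
analytic change of coordinates and an invertible matrix of analytic functions. -/
theorem exists_cusp_coordinates {a b c d : ℕ} (hab : a + b ≠ 0 ∨ c + d ≠ 0)
    (habcd : (a + 2 + (b + 2)) * (c + 2 + (d + 2)) ≠ (a + 2) * (b + 2) * (c + 2) * (d + 2))
    {P Q : (Fin 4 → ℂ) → Fin 6 → ℂ} (hP : AnalyticAt ℂ P 0) (hQ : AnalyticAt ℂ Q 0)
    (hP0 : P 0 0 ≠ 0) (hP1 : P 0 1 = 0) (hP2 : P 0 2 ≠ 0) (hP3 : P 0 3 ≠ 0) (hP4 : P 0 4 = 0)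
    (hP5 : P 0 5 = 0) (hQ0 : Q 0 0 ≠ 0) (hQ1 : Q 0 1 = 0) (hQ2 : Q 0 2 ≠ 0) (hQ3 : Q 0 3 ≠ 0)
    (hQ4 : Q 0 4 = 0) (hQ5 : Q 0 5 = 0) :
    ∃ (φ : (Fin 4 → ℂ) → Fin 4 → ℂ) (N : (Fin 4 → ℂ) → Matrix (Fin 2) (Fin 2) ℂ),
      AnalyticAt ℂ φ 0 ∧ φ 0 = 0 ∧
      (∃ m : Fin 4 → ℂ, (∀ i, m i ≠ 0) ∧
        HasFDerivAt φ (ContinuousLinearMap.pi fun i =>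
          m i • (ContinuousLinearMap.proj i : (Fin 4 → ℂ) →L[ℂ] ℂ)) 0) ∧
      (∀ i j, AnalyticAt ℂ (fun v => N v i j) 0) ∧ (N 0).det ≠ 0 ∧
      ∀ᶠ v in 𝓝 0, ![monomialSum a b c d (P (φ v)) (φ v),
        monomialSum c d a b (Q (φ v)) (swapPairs (φ v))] =
          (N v).mulVec fun k => eval v (cusp (a + 2) (b + 2) (c + 2) (d + 2) k) := by
  obtain ⟨m, n, hm, hn, hm0, hn0, hmn⟩ := exists_subst_parameters hab habcd hP hQ hP0 hP1 hP2 hP3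
    hP4 hP5 hQ0 hQ1 hQ2 hQ3 hQ4 hQ5
  have hPS := analyticAt_pulledCoeff a b c d hP hm hn analyticAt_id rfl
  have hQS := analyticAt_pulledCoeff a b c d hQ hm hn analyticAt_id rfl
  have hC := analyticAt_substCoeff a b c d hPS hm hn analyticAt_id
  have hD := analyticAt_substCoeff c d a b hQS (analyticAt_swapPairs hm)
    (analyticAt_swapPairs hn) (analyticAt_swapPairs analyticAt_id)
  obtain ⟨C, hCdef⟩ : ∃ C : (Fin 4 → ℂ) → Fin 6 → ℂ, ∀ v, C v =
    substCoeff a b c d (P (axisSubst a b c d (m v) (n v) v)) (m v) (n v) v := ⟨_, fun _ => rfl⟩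
  obtain ⟨D, hDdef⟩ : ∃ D : (Fin 4 → ℂ) → Fin 6 → ℂ, ∀ v, D v =
    substCoeff c d a b (Q (axisSubst a b c d (m v) (n v) v)) (swapPairs (m v)) (swapPairs (n v))
      (swapPairs v) := ⟨_, fun _ => rfl⟩
  simp only [id_eq, ← hCdef, ← hDdef] at hC hD hmn
  rw [analyticAt_pi_iff] at hC hD
  refine ⟨fun v => axisSubst a b c d (m v) (n v) v,
    fun v => !![C v 0, -C v 1; D v 1, -D v 0], analyticAt_axisSubst a b c d hm hn analyticAt_id,
    axisSubst_zero _ _ _ _ _ _, ⟨m 0, hm0, hasFDerivAt_axisSubst a b c d hm.differentiableAt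
      hn.differentiableAt hn0⟩, ?_, ?_, ?_⟩
  · intro i j
    fin_cases i <;> fin_cases j
    exacts [hC 0, (hC 1).neg, hD 1, (hD 0).neg]
  · rw [Matrix.det_fin_two_of, hCdef, hDdef, axisSubst_zero, hn0]
    simp [substCoeff, hP1, hP4, hP5, hQ1, hQ4, hQ5, hP0, hQ0, hm0, swapPairs]
  · filter_upwards [hmn] with v hv
    have k1 := monomialSum_of_cuspDefect_eq_zero (a := a) (b := b) (c := c) (d := d) hv.1 v
    have k2 := monomialSum_of_cuspDefect_eq_zero (a := c) (b := d) (c := a) (d := b) hv.2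
      (swapPairs v)
    rw [hCdef, ← monomialSum_axisSubst, ← hCdef] at k1
    rw [hDdef, ← monomialSum_axisSubst, axisSubst_swapPairs, ← hDdef] at k2
    rw [k1, k2]
    funext i
    fin_cases i
    · simp [Matrix.mulVec, dotProduct, Fin.sum_univ_two, cusp]
      ring
    · simp [Matrix.mulVec, dotProduct, Fin.sum_univ_two, cusp, swapPairs]
      ring

/-! ### Germs given by polynomials -/

theorem hasFDerivAt_eval (p : Poly4) (v : Fin 4 → ℂ) :
    HasFDerivAt (fun u : Fin 4 → ℂ => eval u p)
      (∑ i, eval v (pderiv i p) • (ContinuousLinearMap.proj i : (Fin 4 → ℂ) →L[ℂ] ℂ)) v := by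
  induction p using MvPolynomial.induction_on with
  | C a =>
    simp only [eval_C]
    refine (hasFDerivAt_const a v).congr_fderiv ?_
    ext u
    simp
  | add p q hp hq =>
    simp only [map_add]
    refine (hp.add hq).congr_fderiv ?_
    ext u
    simp [add_mul, Finset.sum_add_distrib]
  | mul_X p i hp =>
    have hi : HasFDerivAt (fun u : Fin 4 → ℂ => u i)
        (ContinuousLinearMap.proj i : (Fin 4 → ℂ) →L[ℂ] ℂ) v :=
      (ContinuousLinearMap.proj (R := ℂ) (φ := fun _ : Fin 4 => ℂ) i).hasFDerivAt
    simp only [map_mul, eval_X]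
    refine (hp.mul hi).congr_fderiv ?_
    ext u
    simp only [add_apply, smul_apply,
      sum_apply, ContinuousLinearMap.proj_apply, smul_eq_mul, pderiv_mul,
      map_add, map_mul, eval_X, pderiv_X, add_mul, Finset.sum_add_distrib, Finset.mul_sum]
    rw [add_comm]
    congr 1
    · exact Finset.sum_congr rfl fun k _ => by ring
    · rw [Finset.sum_eq_single i]
      · simp
      · intro k _ hk
        simp [hk]
      · simp

theorem analyticAt_eval (p : Poly4) (v : Fin 4 → ℂ) :
    AnalyticAt ℂ (fun u : Fin 4 → ℂ => eval u p) v := by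
  have h : ∀ i, AnalyticAt ℂ (fun u : Fin 4 → ℂ => u i) v := fun i =>
    (ContinuousLinearMap.proj (R := ℂ) (φ := fun _ : Fin 4 => ℂ) i).analyticAt v
  induction p using MvPolynomial.induction_on with
  | C a => simpa only [eval_C] using analyticAt_const
  | add p q hp hq =>
    simp only [map_add]
    exact hp.add hq
  | mul_X p i hp =>
    simp only [map_mul, eval_X]
    exact hp.mul (h i)

theorem eval_bind₁ (ψ : Fin 4 → Poly4) (p : Poly4) (v : Fin 4 → ℂ) :
    eval v (bind₁ ψ p) = eval (fun i => eval v (ψ i)) p := by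
  induction p using MvPolynomial.induction_on with
  | C a => simp
  | add p q hp hq => simp [hp, hq]
  | mul_X p i hp => simp [hp]

/-- The analogue of `monomialSum` for polynomials. -/
def polySum (a b c d : ℕ) (P : Fin 6 → Poly4) (x : Fin 4 → Poly4) : Poly4 :=
  P 0 * (x 0 * x 1) + P 1 * (x 2 * x 3) - P 2 * x 2 ^ (a + 2) - P 3 * x 3 ^ (b + 2) +
    P 4 * x 0 ^ (c + 2) + P 5 * x 1 ^ (d + 2)

theorem eval_polySum (a b c d : ℕ) (P : Fin 6 → Poly4) (x : Fin 4 → Poly4) (v : Fin 4 → ℂ) :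
    eval v (polySum a b c d P x) =
      monomialSum a b c d (fun j => eval v (P j)) (fun i => eval v (x i)) := by
  simp [polySum, monomialSum]

/-- `𝒦`-equivalence to a cusp for a pair `F` that a polynomial change of coordinates `ψ` transforms
into constant combinations of two sums of monomials. -/
theorem kEquivalent_cusp_of_subst {F : Fin 2 → Poly4} {a b c d : ℕ} (hab : a + b ≠ 0 ∨ c + d ≠ 0)
    (habcd : (a + 2 + (b + 2)) * (c + 2 + (d + 2)) ≠ (a + 2) * (b + 2) * (c + 2) * (d + 2))
    (ψ : Fin 4 → Poly4) (N₀ : Matrix (Fin 2) (Fin 2) ℂ) (P Q : Fin 6 → Poly4)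
    (hF : ∀ k, bind₁ ψ (F k) = C (N₀ k 0) * polySum a b c d P ![X 0, X 1, X 2, X 3] +
      C (N₀ k 1) * polySum c d a b Q ![X 2, X 3, X 0, X 1])
    (hψ : ∀ k, constantCoeff (ψ k) = 0)
    (hψ' : ∀ u : Fin 4 → ℂ, (∀ k, ∑ i, constantCoeff (pderiv i (ψ k)) * u i = 0) → u = 0)
    (hN₀ : N₀.det ≠ 0) (hP0 : constantCoeff (P 0) ≠ 0) (hP1 : constantCoeff (P 1) = 0)
    (hP2 : constantCoeff (P 2) ≠ 0) (hP3 : constantCoeff (P 3) ≠ 0) (hP4 : constantCoeff (P 4) = 0)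
    (hP5 : constantCoeff (P 5) = 0)
    (hQ0 : constantCoeff (Q 0) ≠ 0) (hQ1 : constantCoeff (Q 1) = 0)
    (hQ2 : constantCoeff (Q 2) ≠ 0)
    (hQ3 : constantCoeff (Q 3) ≠ 0) (hQ4 : constantCoeff (Q 4) = 0)
    (hQ5 : constantCoeff (Q 5) = 0) :
    KEquivalent F (cusp (a + 2) (b + 2) (c + 2) (d + 2)) := by
  obtain ⟨φ, N, hφ, hφ0, ⟨m, hm, hφ'⟩, hN, hN0, hv⟩ := exists_cusp_coordinates hab habcd
    (P := fun v j => eval v (P j)) (Q := fun v j => eval v (Q j))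
    (analyticAt_pi_iff.2 fun j => analyticAt_eval _ _)
    (analyticAt_pi_iff.2 fun j => analyticAt_eval _ _)
    (by simpa using hP0) (by simpa using hP1) (by simpa using hP2) (by simpa using hP3)
    (by simpa using hP4) (by simpa using hP5) (by simpa using hQ0) (by simpa using hQ1)
    (by simpa using hQ2) (by simpa using hQ3) (by simpa using hQ4) (by simpa using hQ5)
  set Ψ : (Fin 4 → ℂ) → Fin 4 → ℂ := fun v k => eval v (ψ k) with hΨ
  have hΨ0 : Ψ 0 = 0 := funext fun k => by simpa [hΨ] using hψ k
  have hΨA : AnalyticAt ℂ Ψ 0 := analyticAt_pi_iff.2 fun j => analyticAt_eval _ _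
  have hΨ' : HasFDerivAt Ψ (ContinuousLinearMap.pi fun k => ∑ i, eval 0 (pderiv i (ψ k)) •
      (ContinuousLinearMap.proj i : (Fin 4 → ℂ) →L[ℂ] ℂ)) (φ 0) := by
    rw [hφ0, hasFDerivAt_pi]
    exact fun k => hasFDerivAt_eval _ _
  refine ⟨fun v => Ψ (φ v), fun v => N₀ * N v, ?_, ?_, ?_, ?_, ?_, ?_⟩
  · exact AnalyticAt.comp (by rw [hφ0]; exact hΨA) hφ
  · simp only [hφ0, hΨ0]
  · have hinj : Function.Injective (fderiv ℂ (fun v => Ψ (φ v)) 0) := by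
      rw [injective_iff_map_eq_zero]
      intro u hu
      have h1 := (hΨ'.comp (0 : Fin 4 → ℂ) hφ').fderiv
      simp only [Function.comp_def] at h1
      rw [h1] at hu
      have h2 : (fun i => m i * u i) = 0 := by
        apply hψ'
        intro k
        have := congrFun hu k
        simpa using this
      funext i
      simpa [hm i] using congrFun h2 i
    exact ⟨hinj, LinearMap.surjective_of_injective
      (f := (fderiv ℂ (fun v => Ψ (φ v)) 0 : (Fin 4 → ℂ) →ₗ[ℂ] (Fin 4 → ℂ))) hinj⟩
  · intro i j
    simp only [Matrix.mul_apply, Fin.sum_univ_two]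
    exact (analyticAt_const.mul (hN 0 j)).add (analyticAt_const.mul (hN 1 j))
  · simpa [Matrix.det_mul] using ⟨hN₀, hN0⟩
  · filter_upwards [hv] with v hv
    rw [← Matrix.mulVec_mulVec, ← hv]
    funext k
    have h := congrArg (eval (φ v)) (hF k)
    rw [eval_bind₁] at h
    refine h.trans ?_
    simp only [map_add, map_mul, eval_C, eval_polySum, Matrix.mulVec, dotProduct,
      Fin.sum_univ_two, Matrix.cons_val]
    congr! 3
    · funext i
      fin_cases i <;> simp
    · funext i
      fin_cases i <;> simp [swapPairs]

/-- The six monomials of the equations of a cusp. -/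
def cuspMonomial (a b c d : ℕ) : Fin 6 → Poly4 :=
  ![X 0 * X 1, X 2 * X 3, X 2 ^ (a + 2), X 3 ^ (b + 2), X 0 ^ (c + 2), X 1 ^ (d + 2)]

/-- The product of the maximal ideal of the origin and the ideal generated by the six monomials of a
cusp. -/
def cuspIdeal (a b c d : ℕ) : Ideal Poly4 where
  carrier := {p | ∃ R : Fin 6 → Poly4, (∀ j, constantCoeff (R j) = 0) ∧
    p = ∑ j, R j * cuspMonomial a b c d j}
  zero_mem' := ⟨0, by simp, by simp⟩
  add_mem' := by
    rintro p q ⟨R, hR, rfl⟩ ⟨S, hS, rfl⟩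
    exact ⟨R + S, fun j => by simp [hR, hS], by simp [add_mul, Finset.sum_add_distrib]⟩
  smul_mem' := by
    rintro r p ⟨R, hR, rfl⟩
    exact ⟨fun j => r * R j, fun j => by simp [hR], by simp [Finset.mul_sum, mul_assoc]⟩

/-- A pair that a polynomial change of coordinates `ψ` transforms into combinations of the equations
of a cusp, up to nonzero coefficients and modulo `cuspIdeal`, is `𝒦`-equivalent to the cusp. -/
theorem kEquivalent_cusp_of_congr {F : Fin 2 → Poly4} {a b c d : ℕ}
    (hab : a + b ≠ 0 ∨ c + d ≠ 0)
    (habcd : (a + 2 + (b + 2)) * (c + 2 + (d + 2)) ≠ (a + 2) * (b + 2) * (c + 2) * (d + 2))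
    (ψ : Fin 4 → Poly4) (N₀ : Matrix (Fin 2) (Fin 2) ℂ) {α β : Fin 2 → ℂ}
    (hF : ∀ k, bind₁ ψ (F k) -
      (C (N₀ k 0) * (X 0 * X 1 - C (α 0) * X 2 ^ (a + 2) - C (α 1) * X 3 ^ (b + 2)) +
        C (N₀ k 1) * (X 2 * X 3 - C (β 0) * X 0 ^ (c + 2) - C (β 1) * X 1 ^ (d + 2))) ∈
      cuspIdeal a b c d)
    (hψ : ∀ k, constantCoeff (ψ k) = 0)
    (hψ' : ∀ u : Fin 4 → ℂ, (∀ k, ∑ i, constantCoeff (pderiv i (ψ k)) * u i = 0) → u = 0)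
    (hN₀ : N₀.det ≠ 0) (hα : ∀ k, α k ≠ 0) (hβ : ∀ k, β k ≠ 0) :
    KEquivalent F (cusp (a + 2) (b + 2) (c + 2) (d + 2)) := by
  choose R hR0 hR using hF
  -- The rows of `N₀⁻¹` distribute the error terms over the two equations.
  set S : Fin 2 → Fin 6 → Poly4 := fun k j => ∑ l, C (N₀⁻¹ k l) * R l j with hS
  have hS0 : ∀ k j, constantCoeff (S k j) = 0 := fun k j => by simp [hS, hR0]
  have hNS : ∀ k j, R k j = C (N₀ k 0) * S 0 j + C (N₀ k 1) * S 1 j := by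
    intro k j
    have h := Matrix.mul_nonsing_inv N₀ (isUnit_iff_ne_zero.2 hN₀)
    have h' : ∀ l, C (σ := Fin 4) (N₀ k 0) * C (N₀⁻¹ 0 l) + C (N₀ k 1) * C (N₀⁻¹ 1 l) =
        C ((1 : Matrix (Fin 2) (Fin 2) ℂ) k l) := by
      intro l
      rw [← h, Matrix.mul_apply, Fin.sum_univ_two]
      simp only [map_add, map_mul]
    have h0 := h' 0
    have h1 := h' 1
    simp only [hS, Fin.sum_univ_two]
    obtain rfl | rfl : k = 0 ∨ k = 1 := by fin_cases k <;> simp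
    · rw [Matrix.one_apply_eq, C_1] at h0
      rw [Matrix.one_apply_ne (by simp), C_0] at h1
      linear_combination -R 0 j * h0 - R 1 j * h1
    · rw [Matrix.one_apply_eq, C_1] at h1
      rw [Matrix.one_apply_ne (by simp), C_0] at h0
      linear_combination -R 0 j * h0 - R 1 j * h1
  refine kEquivalent_cusp_of_subst hab habcd ψ N₀
    ![1 + S 0 0, S 0 1, C (α 0) - S 0 2, C (α 1) - S 0 3, S 0 4, S 0 5]
    ![1 + S 1 1, S 1 0, C (β 0) - S 1 4, C (β 1) - S 1 5, S 1 2, S 1 3] ?_ hψ hψ' hN₀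
    (by simp [hS0]) (by simp [hS0]) (by simp [hS0, hα]) (by simp [hS0, hα]) (by simp [hS0])
    (by simp [hS0]) (by simp [hS0]) (by simp [hS0]) (by simp [hS0, hβ]) (by simp [hS0, hβ])
    (by simp [hS0]) (by simp [hS0])
  intro k
  rw [sub_eq_iff_eq_add.1 (hR k)]
  simp only [hNS, Fin.sum_univ_six, cuspMonomial, polySum, Matrix.cons_val]
  ring

/-! ### Truncated polynomials -/

/-- A term of a polynomial in four variables with an integral coefficient, given by its exponents
and its coefficient. Lists of terms, not necessarily with distinct exponents, represent polynomials.
-/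
abbrev Term := (ℕ × ℕ × ℕ × ℕ) × ℤ

namespace Term

/-- The monomial with the exponents `e`. -/
def monomialPoly (e : ℕ × ℕ × ℕ × ℕ) : Poly4 :=
  X 0 ^ e.1 * X 1 ^ e.2.1 * X 2 ^ e.2.2.1 * X 3 ^ e.2.2.2

/-- The polynomial of a term. -/
def termPoly (t : Term) : Poly4 := (t.2 : Poly4) * monomialPoly t.1

/-- The polynomial of a list of terms. -/
def toPoly (L : List Term) : Poly4 := (L.map termPoly).sum

/-- Addition of a term. -/
def insertTerm (t : Term) : List Term → List Term
  | [] => [t]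
  | s :: L => if s.1 = t.1 then (s.1, s.2 + t.2) :: L else s :: insertTerm t L

/-- Addition. -/
def addTerms (p q : List Term) : List Term := p.foldr insertTerm q

/-- Addition of the product of two terms, unless its exponent is among those to `drop`. -/
def mulStep (drop : ℕ × ℕ × ℕ × ℕ → Bool) (s t : Term) (L : List Term) : List Term :=
  if drop (s.1 + t.1) then L else insertTerm (s.1 + t.1, s.2 * t.2) L

/-- Multiplication, with omission of the terms to `drop`. -/
def mulTerms (drop : ℕ × ℕ × ℕ × ℕ → Bool) (p q : List Term) : List Term :=
  p.foldr (fun s L => q.foldr (mulStep drop s) L) []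

/-- Powers, with omission of the terms to `drop`. -/
def powTerms (drop : ℕ × ℕ × ℕ × ℕ → Bool) (p : List Term) : ℕ → List Term
  | 0 => [((0, 0, 0, 0), 1)]
  | n + 1 => mulTerms drop (powTerms drop p n) p

/-- Substitution of `ψ` in `F`, with omission of the terms to `drop`. -/
def substTerms (drop : ℕ × ℕ × ℕ × ℕ → Bool) (ψ : Fin 4 → List Term) (F : List Term) :
    List Term :=
  F.foldr (fun t L => addTerms (mulTerms drop [((0, 0, 0, 0), t.2)]
    (mulTerms drop (mulTerms drop (mulTerms drop (powTerms drop (ψ 0) t.1.1)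
      (powTerms drop (ψ 1) t.1.2.1)) (powTerms drop (ψ 2) t.1.2.2.1))
      (powTerms drop (ψ 3) t.1.2.2.2))) L) []

/-- All coefficients vanish. -/
def isZero (L : List Term) : Bool := L.all fun t => t.2 == 0

/-- The coefficient of the monomial with the exponents `e`. -/
def coeffOf (e : ℕ × ℕ × ℕ × ℕ) (L : List Term) : ℤ :=
  (L.map fun t => if t.1 = e then t.2 else 0).sum

/-- The exponents of the monomials of `cuspIdeal`: proper multiples of one of the six monomials of
the cusp. -/
def negligible (a b c d : ℕ) (e : ℕ × ℕ × ℕ × ℕ) : Bool :=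
  decide (3 ≤ e.1 + e.2.1 + e.2.2.1 + e.2.2.2 ∧ (1 ≤ e.1 ∧ 1 ≤ e.2.1 ∨ 1 ≤ e.2.2.1 ∧ 1 ≤ e.2.2.2) ∨
    a + 2 ≤ e.2.2.1 ∧ a + 3 ≤ e.1 + e.2.1 + e.2.2.1 + e.2.2.2 ∨
    b + 2 ≤ e.2.2.2 ∧ b + 3 ≤ e.1 + e.2.1 + e.2.2.1 + e.2.2.2 ∨
    c + 2 ≤ e.1 ∧ c + 3 ≤ e.1 + e.2.1 + e.2.2.1 + e.2.2.2 ∨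
    d + 2 ≤ e.2.1 ∧ d + 3 ≤ e.1 + e.2.1 + e.2.2.1 + e.2.2.2)

theorem monomialPoly_add (e f : ℕ × ℕ × ℕ × ℕ) :
    monomialPoly (e + f) = monomialPoly e * monomialPoly f := by
  simp only [monomialPoly, Prod.fst_add, Prod.snd_add, pow_add]
  ring

theorem toPoly_cons (t : Term) (L : List Term) : toPoly (t :: L) = termPoly t + toPoly L := by
  simp [toPoly]

theorem toPoly_insertTerm (t : Term) (L : List Term) :
    toPoly (insertTerm t L) = termPoly t + toPoly L := by
  induction L with
  | nil => simp [insertTerm, toPoly]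
  | cons s L ih =>
    rw [insertTerm]
    split_ifs with h
    · simp only [toPoly_cons, termPoly, h, Int.cast_add]
      ring
    · simp only [toPoly_cons, ih]
      ring

theorem toPoly_addTerms (p q : List Term) : toPoly (addTerms p q) = toPoly p + toPoly q := by
  induction p with
  | nil => simp [addTerms, toPoly]
  | cons t p ih =>
    have : addTerms (t :: p) q = insertTerm t (addTerms p q) := rfl
    rw [this, toPoly_insertTerm, ih, toPoly_cons, add_assoc]

theorem toPoly_of_isZero {L : List Term} (h : isZero L = true) : toPoly L = 0 := by
  induction L with
  | nil => simp [toPoly]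
  | cons t L ih =>
    simp only [isZero, List.all_cons, Bool.and_eq_true, beq_iff_eq] at h
    rw [toPoly_cons, ih h.2, termPoly, h.1]
    simp

section Truncation

variable {I : Ideal Poly4} {drop : ℕ × ℕ × ℕ × ℕ → Bool}

theorem mk_mulStep (hI : ∀ e, drop e = true → monomialPoly e ∈ I) (s t : Term) (L : List Term) :
    Ideal.Quotient.mk I (toPoly (mulStep drop s t L)) =
      Ideal.Quotient.mk I (termPoly s * termPoly t + toPoly L) := by
  have h : termPoly (s.1 + t.1, s.2 * t.2) = termPoly s * termPoly t := by
    simp only [termPoly, monomialPoly_add, Int.cast_mul]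
    ring
  rw [mulStep]
  split_ifs with hd
  · rw [map_add, ← h, termPoly, map_mul, Ideal.Quotient.eq_zero_iff_mem.2 (hI _ hd), mul_zero,
      zero_add]
  · rw [toPoly_insertTerm, h]

theorem mk_foldr_mulStep (hI : ∀ e, drop e = true → monomialPoly e ∈ I) (s : Term)
    (q L : List Term) : Ideal.Quotient.mk I (toPoly (q.foldr (mulStep drop s) L)) =
      Ideal.Quotient.mk I (termPoly s * toPoly q + toPoly L) := by
  induction q with
  | nil => simp [toPoly]
  | cons t q ih =>
    rw [List.foldr_cons, mk_mulStep hI, map_add, ih, toPoly_cons, ← map_add]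
    congr 1
    ring

theorem mk_mulTerms (hI : ∀ e, drop e = true → monomialPoly e ∈ I) (p q : List Term) :
    Ideal.Quotient.mk I (toPoly (mulTerms drop p q)) =
      Ideal.Quotient.mk I (toPoly p) * Ideal.Quotient.mk I (toPoly q) := by
  induction p with
  | nil => simp [mulTerms, toPoly]
  | cons s p ih =>
    have : mulTerms drop (s :: p) q = q.foldr (mulStep drop s) (mulTerms drop p q) := rfl
    rw [this, mk_foldr_mulStep hI, map_add, ih, toPoly_cons, map_mul, map_add, add_mul]

theorem mk_powTerms (hI : ∀ e, drop e = true → monomialPoly e ∈ I) (p : List Term) (n : ℕ) :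
    Ideal.Quotient.mk I (toPoly (powTerms drop p n)) = Ideal.Quotient.mk I (toPoly p) ^ n := by
  induction n with
  | zero => simp [powTerms, toPoly, termPoly, monomialPoly]
  | succ n ih => rw [powTerms, mk_mulTerms hI, ih, pow_succ]

/-- If the monomials to `drop` belong to the ideal `I`, then the truncated substitution is correct
modulo `I`. -/
theorem mk_substTerms (hI : ∀ e, drop e = true → monomialPoly e ∈ I) (ψ : Fin 4 → List Term)
    (F : List Term) : Ideal.Quotient.mk I (toPoly (substTerms drop ψ F)) =
      Ideal.Quotient.mk I (bind₁ (fun i => toPoly (ψ i)) (toPoly F)) := by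
  induction F with
  | nil => simp [substTerms, toPoly]
  | cons t F ih =>
    have : ∀ G, substTerms drop ψ (t :: G) = addTerms (mulTerms drop [((0, 0, 0, 0), t.2)]
      (mulTerms drop (mulTerms drop (mulTerms drop (powTerms drop (ψ 0) t.1.1)
      (powTerms drop (ψ 1) t.1.2.1)) (powTerms drop (ψ 2) t.1.2.2.1))
      (powTerms drop (ψ 3) t.1.2.2.2))) (substTerms drop ψ G) := fun _ => rfl
    rw [this, toPoly_addTerms, map_add, ih]
    simp only [mk_mulTerms hI, mk_powTerms hI, toPoly_cons, map_add]
    congr 1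
    simp [toPoly, termPoly, monomialPoly]

end Truncation

theorem constantCoeff_monomialPoly_of_ne_zero {e : ℕ × ℕ × ℕ × ℕ} (he : e ≠ 0) :
    constantCoeff (monomialPoly e) = 0 := by
  obtain ⟨i, j, k, l⟩ := e
  simp only [monomialPoly, map_mul, map_pow, constantCoeff_X, mul_eq_zero]
  by_contra! h
  obtain ⟨⟨⟨h0, h1⟩, h2⟩, h3⟩ := h
  have key : ∀ n : ℕ, (0 : ℂ) ^ n ≠ 0 → n = 0 := fun n hn => by
    by_contra h0
    exact hn (zero_pow h0)
  obtain rfl := key _ h0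
  obtain rfl := key _ h1
  obtain rfl := key _ h2
  obtain rfl := key _ h3
  exact he rfl

theorem monomialPoly_mem_cuspIdeal {a b c d : ℕ} (e : ℕ × ℕ × ℕ × ℕ)
    (he : negligible a b c d e = true) : monomialPoly e ∈ cuspIdeal a b c d := by
  have key : ∀ (j : Fin 6) (f g : ℕ × ℕ × ℕ × ℕ), f ≠ 0 →
      cuspMonomial a b c d j = monomialPoly g → e = f + g →
      monomialPoly e ∈ cuspIdeal a b c d := by
    intro j f g hf hg he
    refine ⟨Pi.single j (monomialPoly f), fun i => ?_, ?_⟩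
    · by_cases h : i = j
      · subst h
        simpa using constantCoeff_monomialPoly_of_ne_zero hf
      · simp [h]
    · rw [Finset.sum_eq_single j (fun i _ hi => by simp [hi]) (by simp), he, monomialPoly_add, hg,
        Pi.single_eq_same]
  obtain ⟨i, j, k, l⟩ := e
  simp only [negligible, decide_eq_true_eq] at he
  have hsub : ∀ p q r s : ℕ, p ≤ i → q ≤ j → r ≤ k → s ≤ l → p + q + r + s < i + j + k + l →
      ∃ f ≠ 0, (i, j, k, l) = f + (p, q, r, s) := by
    intro p q r s h1 h2 h3 h4 h5
    refine ⟨(i - p, j - q, k - r, l - s), ?_, ?_⟩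
    · simp only [ne_eq, Prod.mk_eq_zero]
      omega
    · simp only [Prod.mk_add_mk, Prod.mk.injEq]
      omega
  rcases he with ⟨h, h' | h'⟩ | h | h | h | h
  · obtain ⟨f, hf, hfg⟩ := hsub 1 1 0 0 (by omega) (by omega) (by omega) (by omega) (by omega)
    exact key 0 f _ hf (by simp [cuspMonomial, monomialPoly]) hfg
  · obtain ⟨f, hf, hfg⟩ := hsub 0 0 1 1 (by omega) (by omega) (by omega) (by omega) (by omega)
    exact key 1 f _ hf (by simp [cuspMonomial, monomialPoly]) hfg
  · obtain ⟨f, hf, hfg⟩ := hsub 0 0 (a + 2) 0 (by omega) (by omega) (by omega) (by omega) (by omega)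
    exact key 2 f _ hf (by simp [cuspMonomial, monomialPoly]) hfg
  · obtain ⟨f, hf, hfg⟩ := hsub 0 0 0 (b + 2) (by omega) (by omega) (by omega) (by omega) (by omega)
    exact key 3 f _ hf (by simp [cuspMonomial, monomialPoly]) hfg
  · obtain ⟨f, hf, hfg⟩ := hsub (c + 2) 0 0 0 (by omega) (by omega) (by omega) (by omega) (by omega)
    exact key 4 f _ hf (by simp [cuspMonomial, monomialPoly]) hfg
  · obtain ⟨f, hf, hfg⟩ := hsub 0 (d + 2) 0 0 (by omega) (by omega) (by omega) (by omega) (by omega)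
    exact key 5 f _ hf (by simp [cuspMonomial, monomialPoly]) hfg

/-- The exponents of the four coordinates. -/
def linearExponent : Fin 4 → ℕ × ℕ × ℕ × ℕ :=
  ![(1, 0, 0, 0), (0, 1, 0, 0), (0, 0, 1, 0), (0, 0, 0, 1)]

theorem constantCoeff_toPoly (L : List Term) : constantCoeff (toPoly L) = coeffOf 0 L := by
  induction L with
  | nil => simp [toPoly, coeffOf]
  | cons t L ih =>
    have h : coeffOf 0 (t :: L) = (if t.1 = 0 then t.2 else 0) + coeffOf 0 L := by simp [coeffOf]
    rw [toPoly_cons, map_add, ih, h, Int.cast_add, termPoly, map_mul]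
    congr 1
    split_ifs with h0
    · rw [h0]
      simp [monomialPoly]
    · rw [constantCoeff_monomialPoly_of_ne_zero h0]
      simp

theorem constantCoeff_pderiv_toPoly (i : Fin 4) (L : List Term) :
    constantCoeff (pderiv i (toPoly L)) = coeffOf (linearExponent i) L := by
  induction L with
  | nil => simp [toPoly, coeffOf]
  | cons t L ih =>
    have h : coeffOf (linearExponent i) (t :: L) =
      (if t.1 = linearExponent i then t.2 else 0) + coeffOf (linearExponent i) L := by
      simp [coeffOf]
    rw [toPoly_cons, map_add, map_add, ih, h, Int.cast_add]
    congr 1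
    obtain ⟨⟨p, q, r, s⟩, n⟩ := t
    have zq : ∀ m : ℕ, (0 : ℂ) ^ m = if m = 0 then 1 else 0 := fun m => by
      rcases m with _ | m <;> simp
    fin_cases i <;>
    · simp [termPoly, monomialPoly, linearExponent, zq]
      split_ifs <;> simp_all
      omega

/-- The form of `kEquivalent_cusp_of_congr` in which all hypotheses are decidable: `n` is the matrix
of the constant combinations of the two equations, and `α`, `β` are the coefficients of the powers
in the first and in the second one. -/
theorem kEquivalent_cusp_of_terms {a b c d : ℕ} (ψ : Fin 4 → List Term) (F : Fin 2 → List Term)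
    (n : Matrix (Fin 2) (Fin 2) ℤ) (α β : Fin 2 → ℤ) (hab : a + b ≠ 0 ∨ c + d ≠ 0)
    (habcd : (a + 2 + (b + 2)) * (c + 2 + (d + 2)) ≠ (a + 2) * (b + 2) * (c + 2) * (d + 2))
    (hF : ∀ k, isZero (addTerms (substTerms (negligible a b c d) ψ (F k))
      [((1, 1, 0, 0), -n k 0), ((0, 0, a + 2, 0), n k 0 * α 0), ((0, 0, 0, b + 2), n k 0 * α 1),
        ((0, 0, 1, 1), -n k 1), ((c + 2, 0, 0, 0), n k 1 * β 0),
        ((0, d + 2, 0, 0), n k 1 * β 1)]) = true)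
    (hψ : ∀ k, coeffOf 0 (ψ k) = 0)
    (hψ' : (Matrix.of fun k i => coeffOf (linearExponent i) (ψ k)).det ≠ 0)
    (hn : n 0 0 * n 1 1 - n 0 1 * n 1 0 ≠ 0) (hα : ∀ k, α k ≠ 0) (hβ : ∀ k, β k ≠ 0) :
    KEquivalent (fun k => toPoly (F k)) (cusp (a + 2) (b + 2) (c + 2) (d + 2)) := by
  refine kEquivalent_cusp_of_congr hab habcd (fun k => toPoly (ψ k)) (n.map (Int.cast : ℤ → ℂ))
    (α := fun k => α k) (β := fun k => β k) ?_ ?_ ?_ ?_ ?_ ?_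
  · intro k
    have h := toPoly_of_isZero (hF k)
    rw [toPoly_addTerms] at h
    rw [← Ideal.Quotient.eq_zero_iff_mem, map_sub, ← mk_substTerms monomialPoly_mem_cuspIdeal,
      eq_neg_of_add_eq_zero_left h, ← map_sub, Ideal.Quotient.eq_zero_iff_mem]
    convert! (cuspIdeal a b c d).zero_mem
    simp [toPoly, termPoly, monomialPoly]
    ring
  · intro k
    rw [constantCoeff_toPoly, hψ, Int.cast_zero]
  · intro u hu
    have hdet : ((Matrix.of fun k i => coeffOf (linearExponent i) (ψ k)).map
        (Int.cast : ℤ → ℂ)).det ≠ 0 := by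
      have := RingHom.map_det (Int.castRingHom ℂ)
        (Matrix.of fun k i => coeffOf (linearExponent i) (ψ k))
      simp only [RingHom.mapMatrix_apply, Int.coe_castRingHom] at this
      rw [← this]
      exact_mod_cast hψ'
    refine Matrix.eq_zero_of_mulVec_eq_zero hdet ?_
    funext k
    simpa [Matrix.mulVec, dotProduct, constantCoeff_pderiv_toPoly] using hu k
  · rw [Matrix.det_fin_two]
    simp only [Matrix.map_apply]
    exact_mod_cast hn
  · exact fun k => Int.cast_ne_zero.2 (hα k)
  · exact fun k => Int.cast_ne_zero.2 (hβ k)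

end Term

/-! ### The normal forms of the eight virtual singularities

The lists are the four components of the change of coordinates and the two given equations. The
linear part of the change of coordinates brings the quadratic parts to their normal form, and its
higher terms successively remove the terms that are neither negligible nor in the normal form. -/

namespace Term

theorem kEquivalent_cusp_J :
    KEquivalent ![gabrielovEq1 .J, h₂ .J - X 2 * X 3] (cusp 2 2 2 6) := by
  have h := kEquivalent_cusp_of_terms (a := 0) (b := 0) (c := 0) (d := 4)
    ![
      [((1, 0, 0, 0), 7), ((0, 1, 0, 0), 1), ((0, 0, 1, 0), 4), ((0, 0, 0, 1), 6),
       ((0, 2, 0, 0), -4), ((0, 1, 1, 0), -14), ((0, 1, 0, 1), -14), ((0, 3, 0, 0), 39),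
       ((0, 2, 1, 0), 112), ((0, 2, 0, 1), 112), ((0, 4, 0, 0), -536)],
      [((1, 0, 0, 0), 1), ((0, 1, 1, 0), -2), ((0, 1, 0, 1), -2), ((0, 3, 0, 0), 1),
       ((0, 2, 1, 0), 16), ((0, 2, 0, 1), 16), ((0, 4, 0, 0), -16), ((0, 3, 1, 0), -200),
       ((0, 3, 0, 1), -208), ((0, 5, 0, 0), 272), ((0, 4, 1, 0), 3232), ((0, 4, 0, 1), 3496)],
      [((1, 0, 0, 0), 1), ((0, 0, 0, 1), 1), ((0, 1, 1, 0), -2), ((0, 1, 0, 1), -2),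
       ((0, 3, 0, 0), 1), ((0, 2, 1, 0), 16), ((0, 2, 0, 1), 16), ((0, 4, 0, 0), -20),
       ((0, 5, 0, 0), 404)],
      [((1, 0, 0, 0), 2), ((0, 0, 1, 0), 1), ((0, 0, 0, 1), 1), ((0, 2, 0, 0), -1),
       ((0, 1, 1, 0), -4), ((0, 1, 0, 1), -4), ((0, 3, 0, 0), 10), ((0, 2, 1, 0), 32),
       ((0, 2, 0, 1), 32), ((0, 4, 0, 0), -136), ((0, 3, 1, 0), -400), ((0, 3, 0, 1), -416),
       ((0, 5, 0, 0), 2256)]]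
    ![
      [((1, 1, 0, 0), 1), ((0, 0, 2, 0), -1), ((0, 0, 0, 2), -1)],
      [((0, 1, 0, 1), 1), ((0, 0, 2, 0), 1), ((0, 0, 1, 1), -1), ((2, 0, 1, 0), -1),
       ((1, 0, 0, 2), 1)]]
    !![1, -2; 0, -1] ![1, 2] ![1, 1] (by decide) (by decide)
    (by decide +kernel) (by decide +kernel) (by decide +kernel) (by decide) (by decide) (by decide)
  convert! h using 1
  funext k
  fin_cases k <;>
  · simp [gabrielovEq1, h₁, h₂, factorA, factorB, factorC, toPoly, termPoly, monomialPoly]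
    try ring

theorem kEquivalent_cusp_K :
    KEquivalent ![gabrielovEq1 .K, h₂ .K - X 2 * X 3] (cusp 2 2 4 4) := by
  have h := kEquivalent_cusp_of_terms (a := 0) (b := 0) (c := 2) (d := 2)
    ![
      [((1, 0, 0, 0), 1), ((0, 1, 0, 0), 1), ((0, 0, 1, 0), 2), ((0, 0, 0, 1), 2),
       ((2, 0, 0, 0), -4), ((0, 2, 0, 0), -4), ((0, 1, 1, 0), -6), ((0, 1, 0, 1), -4),
       ((0, 3, 0, 0), 75), ((0, 2, 1, 0), 100), ((0, 2, 0, 1), 68)],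
      [((0, 1, 0, 0), 1), ((1, 0, 1, 0), -6), ((1, 0, 0, 1), -4), ((3, 0, 0, 0), 7),
       ((2, 0, 1, 0), 100), ((2, 0, 0, 1), 68)],
      [((0, 0, 1, 0), 1), ((2, 0, 0, 0), -1), ((0, 2, 0, 0), -1), ((3, 0, 0, 0), 16),
       ((0, 3, 0, 0), 16)],
      [((0, 1, 0, 0), 1), ((0, 0, 1, 0), 1), ((0, 0, 0, 1), 1), ((2, 0, 0, 0), -2),
       ((1, 0, 1, 0), -6), ((1, 0, 0, 1), -4), ((0, 2, 0, 0), -2), ((3, 0, 0, 0), 41),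
       ((0, 3, 0, 0), 34)]]
    ![
      [((1, 1, 0, 0), 1), ((0, 0, 2, 0), -1), ((0, 0, 0, 2), -1)],
      [((0, 1, 1, 0), 1), ((0, 0, 2, 0), 1), ((0, 0, 1, 1), -1), ((2, 0, 0, 1), -1),
       ((1, 0, 0, 2), 1)]]
    !![1, -2; 0, -1] ![2, 1] ![1, 1] (by decide) (by decide)
    (by decide +kernel) (by decide +kernel) (by decide +kernel) (by decide) (by decide) (by decide)
  convert! h using 1
  funext k
  fin_cases k <;>
  · simp [gabrielovEq1, h₁, h₂, factorA, factorB, factorC, toPoly, termPoly, monomialPoly]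
    try ring

theorem kEquivalent_cusp_Kflat :
    KEquivalent ![gabrielovEq1 .Kflat, h₂ .Kflat - X 2 * X 3] (cusp 2 2 5 3) := by
  have h := kEquivalent_cusp_of_terms (a := 0) (b := 0) (c := 3) (d := 1)
    ![
      [((1, 0, 0, 0), 1), ((0, 1, 0, 0), 1), ((0, 0, 1, 0), 2), ((0, 0, 0, 1), 2),
       ((2, 0, 0, 0), -2), ((1, 0, 1, 0), -4), ((1, 0, 0, 1), -2), ((0, 2, 0, 0), -20),
       ((0, 1, 1, 0), -28), ((0, 1, 0, 1), -18), ((3, 0, 0, 0), 22)],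
      [((0, 1, 0, 0), 1), ((1, 0, 1, 0), -4), ((1, 0, 0, 1), -2), ((3, 0, 0, 0), 2),
       ((2, 0, 1, 0), 32), ((2, 0, 0, 1), 20), ((4, 0, 0, 0), -36), ((3, 0, 1, 0), -544),
       ((3, 0, 0, 1), -344)],
      [((0, 0, 1, 0), 1), ((2, 0, 0, 0), -1), ((0, 2, 0, 0), -5), ((3, 0, 0, 0), 6),
       ((4, 0, 0, 0), -100)],
      [((0, 1, 0, 0), 1), ((0, 0, 1, 0), 1), ((0, 0, 0, 1), 1), ((2, 0, 0, 0), -1),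
       ((1, 0, 1, 0), -4), ((1, 0, 0, 1), -2), ((0, 2, 0, 0), -9), ((3, 0, 0, 0), 12),
       ((2, 0, 1, 0), 32), ((2, 0, 0, 1), 20), ((4, 0, 0, 0), -208)]]
    ![
      [((1, 1, 0, 0), 1), ((0, 0, 2, 0), -1), ((0, 0, 0, 2), -1)],
      [((0, 1, 1, 0), 1), ((0, 0, 2, 0), 1), ((0, 0, 1, 1), -1), ((2, 0, 1, 0), 1),
       ((2, 0, 0, 1), -1)]]
    !![1, -2; 0, -1] ![2, 1] ![-2, -1] (by decide) (by decide)
    (by decide +kernel) (by decide +kernel) (by decide +kernel) (by decide) (by decide) (by decide)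
  convert! h using 1
  funext k
  fin_cases k <;>
  · simp [gabrielovEq1, h₁, h₂, factorA, factorB, factorC, toPoly, termPoly, monomialPoly]
    try ring

theorem kEquivalent_cusp_L :
    KEquivalent ![gabrielovEq1 .L, h₂ .L - X 2 * X 3] (cusp 2 4 2 4) := by
  have h := kEquivalent_cusp_of_terms (a := 0) (b := 2) (c := 0) (d := 2)
    ![
      [((1, 0, 0, 0), 3), ((0, 1, 0, 0), 1), ((0, 0, 1, 0), -3), ((0, 0, 0, 1), -1),
       ((1, 0, 0, 1), 9), ((0, 2, 0, 0), -4), ((0, 1, 0, 1), 6), ((0, 0, 0, 2), -4),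
       ((0, 3, 0, 0), 61), ((0, 2, 0, 1), -90), ((0, 1, 0, 2), 90), ((0, 0, 0, 3), -61),
       ((0, 3, 0, 1), 1397), ((0, 2, 0, 2), -2364)],
      [((1, 0, 0, 0), 1), ((0, 1, 1, 0), 3), ((0, 1, 0, 1), 1), ((0, 0, 0, 2), -1),
       ((0, 3, 0, 0), 3), ((0, 2, 1, 0), -42), ((0, 2, 0, 1), -13), ((0, 1, 0, 2), 17),
       ((0, 0, 0, 3), -10), ((0, 3, 0, 1), 95), ((0, 2, 0, 2), -394), ((0, 1, 0, 3), 356),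
       ((0, 3, 0, 2), 1065), ((0, 2, 0, 3), -11283)],
      [((1, 0, 0, 0), 1), ((0, 0, 1, 0), -1), ((1, 0, 0, 1), 3), ((0, 2, 0, 0), -1),
       ((0, 1, 1, 0), 3), ((0, 1, 0, 1), 2), ((0, 0, 0, 2), -1), ((1, 0, 0, 2), 42),
       ((0, 3, 0, 0), 13), ((0, 2, 0, 1), -30), ((0, 1, 0, 2), 30), ((0, 0, 0, 3), -13),
       ((0, 3, 0, 1), 451), ((0, 2, 0, 2), -788), ((0, 1, 0, 3), 451), ((0, 3, 0, 2), 12348)],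
      [((1, 0, 0, 0), 2), ((0, 0, 1, 0), -1), ((0, 0, 0, 1), -1), ((1, 0, 0, 1), 3),
       ((0, 2, 0, 0), -2), ((0, 1, 1, 0), 6), ((0, 1, 0, 1), 3), ((0, 0, 0, 2), -2),
       ((0, 3, 0, 0), 38), ((0, 2, 0, 1), -43), ((0, 1, 0, 2), 47), ((0, 0, 0, 3), -23),
       ((0, 3, 0, 1), 546), ((0, 2, 0, 2), -1182), ((0, 1, 0, 3), 851)]]
    ![
      [((1, 1, 0, 0), 1), ((0, 0, 1, 1), -1)],
      [((0, 1, 0, 1), 1), ((0, 0, 2, 0), 1), ((0, 0, 1, 1), -1), ((2, 0, 0, 1), -1),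
       ((1, 0, 0, 2), 1)]]
    !![1, -1; 0, -1] ![1, 1] ![1, 1] (by decide) (by decide)
    (by decide +kernel) (by decide +kernel) (by decide +kernel) (by decide) (by decide) (by decide)
  convert! h using 1
  funext k
  fin_cases k <;>
  · simp [gabrielovEq1, h₁, h₂, factorA, factorB, factorC, toPoly, termPoly, monomialPoly]
    try ring

theorem kEquivalent_cusp_Lsharp :
    KEquivalent ![gabrielovEq1 .Lsharp, h₂ .Lsharp - X 2 * X 3] (cusp 2 3 2 5) := by
  have h := kEquivalent_cusp_of_terms (a := 0) (b := 1) (c := 0) (d := 3)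
    ![
      [((1, 0, 0, 0), 3), ((0, 1, 0, 0), 1), ((0, 0, 1, 0), -3), ((0, 0, 0, 1), -1),
       ((0, 2, 0, 0), -3), ((0, 1, 1, 0), 6), ((0, 1, 0, 1), 9), ((0, 0, 0, 2), -16),
       ((0, 3, 0, 0), 26), ((0, 2, 0, 1), -120), ((0, 1, 0, 2), 102), ((0, 4, 0, 0), -347),
       ((0, 3, 0, 1), 1933)],
      [((1, 0, 0, 0), 1), ((0, 1, 1, 0), 2), ((0, 1, 0, 1), 1), ((0, 0, 0, 2), -2),
       ((0, 3, 0, 0), 1), ((0, 2, 1, 0), -16), ((0, 2, 0, 1), -11), ((0, 1, 0, 2), 34),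
       ((0, 4, 0, 0), -17), ((0, 3, 1, 0), 210), ((0, 3, 0, 1), 170), ((0, 2, 0, 2), -564),
       ((0, 4, 0, 1), -1100), ((0, 3, 0, 2), 10765)],
      [((1, 0, 0, 0), 1), ((0, 0, 1, 0), -1), ((1, 0, 0, 1), 11), ((0, 2, 0, 0), -1),
       ((0, 1, 1, 0), 2), ((0, 1, 0, 1), 3), ((0, 0, 0, 2), -3), ((0, 3, 0, 0), 8),
       ((0, 2, 1, 0), -16), ((0, 2, 0, 1), -40), ((0, 1, 0, 2), 34), ((0, 4, 0, 0), -99),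
       ((0, 3, 0, 1), 635), ((0, 2, 0, 2), -685), ((0, 4, 0, 1), -9452)],
      [((1, 0, 0, 0), 2), ((0, 0, 1, 0), -1), ((0, 0, 0, 1), -1), ((0, 2, 0, 0), -1),
       ((0, 1, 1, 0), 4), ((0, 1, 0, 1), 4), ((0, 0, 0, 2), -5), ((0, 3, 0, 0), 11),
       ((0, 2, 1, 0), -32), ((0, 2, 0, 1), -51), ((0, 1, 0, 2), 68), ((0, 4, 0, 0), -166),
       ((0, 3, 0, 1), 805), ((0, 2, 0, 2), -1249)]]
    ![
      [((1, 1, 0, 0), 1), ((0, 0, 1, 1), -1)],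
      [((0, 1, 0, 1), 1), ((0, 0, 2, 0), 1), ((0, 0, 1, 1), -1), ((2, 0, 1, 0), 1),
       ((2, 0, 0, 1), -1)]]
    !![1, -1; 0, -1] ![1, 1] ![1, -1] (by decide) (by decide)
    (by decide +kernel) (by decide +kernel) (by decide +kernel) (by decide) (by decide) (by decide)
  convert! h using 1
  funext k
  fin_cases k <;>
  · simp [gabrielovEq1, h₁, h₂, factorA, factorB, factorC, toPoly, termPoly, monomialPoly]
    try ring

theorem kEquivalent_cusp_M :
    KEquivalent ![gabrielovEq1 .M, h₂ .M - X 2 * X 3] (cusp 2 4 3 3) := by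
  have h := kEquivalent_cusp_of_terms (a := 0) (b := 2) (c := 1) (d := 1)
    ![
      [((1, 0, 0, 0), 1), ((0, 1, 0, 0), 1), ((0, 0, 1, 0), -2), ((2, 0, 0, 0), -6),
       ((1, 0, 1, 0), 6), ((1, 0, 0, 1), 6), ((0, 2, 0, 0), -6), ((0, 1, 0, 1), 6),
       ((0, 0, 0, 2), -2), ((2, 0, 0, 1), -144), ((1, 0, 0, 2), 75), ((0, 2, 0, 1), -144),
       ((0, 1, 0, 2), 75), ((0, 0, 0, 3), -24), ((1, 0, 0, 3), 522)],
      [((1, 0, 0, 0), 1), ((0, 1, 1, 0), 6), ((0, 1, 0, 2), 15), ((0, 0, 0, 3), -6),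
       ((0, 2, 0, 2), -180), ((0, 1, 0, 3), 360)],
      [((1, 0, 0, 0), 1), ((0, 1, 0, 0), 1), ((0, 0, 1, 0), -2), ((0, 0, 0, 1), -1),
       ((2, 0, 0, 0), -12), ((1, 0, 0, 1), 6), ((0, 2, 0, 0), -12), ((0, 1, 0, 1), 6),
       ((0, 0, 0, 2), -2), ((2, 0, 0, 1), -144), ((1, 0, 0, 2), 75), ((0, 2, 0, 1), -144),
       ((0, 1, 0, 2), 75)],
      [((1, 0, 0, 0), -1), ((0, 0, 1, 0), 1), ((2, 0, 0, 0), 3), ((1, 0, 0, 1), -3),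
       ((0, 2, 0, 0), 3), ((0, 1, 0, 1), -3), ((0, 0, 0, 2), 1), ((2, 0, 0, 1), 72),
       ((1, 0, 0, 2), -30), ((0, 2, 0, 1), 72), ((0, 1, 0, 2), -45), ((0, 0, 0, 3), 12),
       ((2, 0, 0, 2), 1242), ((1, 0, 0, 3), -81), ((0, 2, 0, 2), 1422)]]
    ![
      [((1, 1, 0, 0), 1), ((0, 0, 0, 2), -1)],
      [((1, 0, 0, 1), 1), ((0, 1, 1, 0), -1), ((0, 0, 1, 1), -1), ((0, 0, 0, 2), 1),
       ((0, 0, 3, 0), 1)]]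
    !![1, 0; -1, 1] ![1, 1] ![-1, -1] (by decide) (by decide)
    (by decide +kernel) (by decide +kernel) (by decide +kernel) (by decide) (by decide) (by decide)
  convert! h using 1
  funext k
  fin_cases k <;>
  · simp [gabrielovEq1, h₁, h₂, factorA, factorB, factorC, toPoly, termPoly, monomialPoly]
    try ring

theorem kEquivalent_cusp_Msharp :
    KEquivalent ![gabrielovEq1 .Msharp, h₂ .Msharp - X 2 * X 3] (cusp 2 3 3 4) := by
  have h := kEquivalent_cusp_of_terms (a := 0) (b := 1) (c := 1) (d := 2)
    ![
      [((1, 0, 0, 0), -1), ((0, 1, 0, 0), 1), ((0, 0, 1, 0), 2), ((0, 0, 0, 1), 1),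
       ((2, 0, 0, 0), -12), ((1, 0, 1, 0), 11), ((1, 0, 0, 1), 9), ((0, 2, 0, 0), -3),
       ((0, 1, 0, 1), -5), ((0, 0, 0, 2), -7), ((1, 0, 0, 2), -104), ((0, 3, 0, 0), 42),
       ((0, 2, 0, 1), 69)],
      [((1, 0, 0, 0), 1), ((0, 1, 1, 0), 3), ((0, 1, 0, 1), 1), ((0, 0, 0, 2), 2),
       ((0, 3, 0, 0), -3), ((0, 2, 1, 0), -39), ((0, 2, 0, 1), -17), ((0, 1, 0, 2), -33),
       ((0, 3, 0, 1), 146), ((0, 2, 0, 2), 633)],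
      [((1, 0, 0, 0), 1), ((0, 0, 1, 0), -1), ((2, 0, 0, 0), 3), ((1, 0, 0, 1), -3),
       ((0, 2, 0, 0), 1), ((0, 1, 1, 0), 3), ((0, 1, 0, 1), 3), ((0, 0, 0, 2), 3),
       ((2, 0, 0, 1), -86), ((0, 3, 0, 0), -14), ((0, 2, 0, 1), -43), ((0, 1, 0, 2), -33),
       ((0, 3, 0, 1), 645)],
      [((1, 0, 0, 0), -1), ((0, 0, 1, 0), 1), ((0, 0, 0, 1), 1), ((2, 0, 0, 0), -8),
       ((1, 0, 0, 1), 3), ((0, 2, 0, 0), -2), ((0, 1, 1, 0), -3), ((0, 1, 0, 1), -3),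
       ((0, 0, 0, 2), -3), ((0, 3, 0, 0), 31), ((0, 2, 0, 1), 43), ((0, 1, 0, 2), 33)]]
    ![
      [((1, 1, 0, 0), 1), ((0, 0, 1, 1), -1)],
      [((0, 1, 1, 0), 1), ((0, 1, 0, 1), 1), ((0, 0, 2, 0), -1), ((0, 0, 1, 1), -1),
       ((2, 0, 0, 1), 1)]]
    !![1, 1; 0, 1] ![-1, 1] ![1, 1] (by decide) (by decide)
    (by decide +kernel) (by decide +kernel) (by decide +kernel) (by decide) (by decide) (by decide)
  convert! h using 1
  funext k
  fin_cases k <;>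
  · simp [gabrielovEq1, h₁, h₂, factorA, factorB, factorC, toPoly, termPoly, monomialPoly]
    try ring

theorem kEquivalent_cusp_I :
    KEquivalent ![gabrielovEq1 .I, h₂ .I - X 2 * X 3] (cusp 3 3 3 3) := by
  have h := kEquivalent_cusp_of_terms (a := 1) (b := 1) (c := 1) (d := 1)
    ![
      [((1, 0, 0, 0), 1), ((0, 2, 0, 0), 1), ((0, 1, 1, 0), 3), ((0, 1, 0, 1), -3),
       ((0, 0, 2, 0), 3), ((0, 0, 0, 2), 3), ((0, 1, 2, 0), -75), ((0, 1, 0, 2), -75)],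
      [((0, 1, 0, 0), 1), ((2, 0, 0, 0), -1), ((1, 0, 1, 0), 3), ((1, 0, 0, 1), -3),
       ((0, 0, 2, 0), -3), ((0, 0, 0, 2), -3), ((1, 0, 2, 0), -75), ((1, 0, 0, 2), -75)],
      [((1, 0, 0, 0), -1), ((0, 0, 1, 0), 1), ((2, 0, 0, 0), -3), ((1, 0, 0, 1), -3),
       ((0, 2, 0, 0), -4), ((0, 1, 1, 0), -3), ((0, 1, 0, 1), 6), ((0, 0, 2, 0), -3),
       ((0, 0, 0, 2), -4), ((2, 0, 0, 1), -75), ((0, 2, 0, 1), -75)],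
      [((1, 0, 0, 0), -1), ((0, 1, 0, 0), 1), ((0, 0, 1, 0), 1), ((0, 0, 0, 1), -1),
       ((2, 0, 0, 0), -7), ((1, 0, 1, 0), 6), ((1, 0, 0, 1), -6), ((0, 2, 0, 0), -7),
       ((0, 1, 1, 0), -6), ((0, 1, 0, 1), 6), ((0, 0, 2, 0), -7), ((0, 0, 0, 2), -7),
       ((2, 0, 1, 0), 75), ((0, 2, 1, 0), 75)]]
    ![
      [((1, 1, 0, 0), 1), ((0, 0, 0, 3), -1)],
      [((1, 0, 1, 0), 1), ((1, 0, 0, 1), -1), ((0, 1, 1, 0), 1), ((0, 0, 2, 0), 1),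
       ((0, 0, 1, 1), -1)]]
    !![1, 0; -1, 1] ![1, -1] ![-1, 1] (by decide) (by decide)
    (by decide +kernel) (by decide +kernel) (by decide +kernel) (by decide) (by decide) (by decide)
  convert! h using 1
  funext k
  fin_cases k <;>
  · simp [gabrielovEq1, h₁, h₂, factorA, factorB, factorC, toPoly, termPoly, monomialPoly]
    try ring

end Term

/-! ### Duality -/

/-- The multiset of the rows of a matrix of exponents. -/
def rows (E : Matrix (Fin 4) (Fin 4) ℕ) : Multiset (Fin 4 → ℕ) :=
  Finset.univ.val.map fun i j => E i j

theorem ofExponents_eq_sum_monomial (E : Matrix (Fin 4) (Fin 4) ℕ) :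
    ofExponents E = ∑ i, monomial (Finsupp.equivFunOnFinite.symm fun j => E i j) 1 := by
  refine Finset.sum_congr rfl fun i _ => ?_
  rw [monomial_eq, C_1, one_mul, Finsupp.prod_fintype _ _ (by simp)]
  rfl

theorem coeff_ofExponents (E : Matrix (Fin 4) (Fin 4) ℕ) (v : Fin 4 → ℕ) :
    coeff (Finsupp.equivFunOnFinite.symm v) (ofExponents E) = ((rows E).count v : ℂ) := by
  classical
  rw [ofExponents_eq_sum_monomial, coeff_sum, rows, Multiset.count_map,
    ← Finset.filter_val, Finset.card_val, Finset.card_filter]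
  push_cast
  refine Finset.sum_congr rfl fun i _ => ?_
  rw [coeff_monomial]
  simp only [EmbeddingLike.apply_eq_iff_eq, eq_comm]

/-- A sum of monomials determines its exponents up to their order. -/
theorem rows_eq_of_ofExponents_eq {E F : Matrix (Fin 4) (Fin 4) ℕ}
    (h : ofExponents E = ofExponents F) : rows E = rows F := by
  classical
  refine Multiset.ext.2 fun v => ?_
  have := coeff_ofExponents E v
  rw [h, coeff_ofExponents] at this
  exact_mod_cast this.symm

/-- The multiset of the row sums, which does not depend on the order of the rows. -/
def rowSums (E : Matrix (Fin 4) (Fin 4) ℕ) : Multiset ℕ :=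
  Finset.univ.val.map fun i => ∑ j, E i j

/-- The sum of the squares of the entries. -/
def sumSquares (E : Matrix (Fin 4) (Fin 4) ℕ) : ℕ := ∑ i, ∑ j, E i j ^ 2

theorem rowSums_eq_of_rows_eq {E F : Matrix (Fin 4) (Fin 4) ℕ} (h : rows E = rows F) :
    rowSums E = rowSums F := by
  have key : ∀ G, rowSums G = (rows G).map fun v => ∑ j, v j := fun G => by
    rw [rowSums, rows, Multiset.map_map]
    rfl
  rw [key, key, h]

theorem rowSums_transpose_eq_of_rows_eq {E F : Matrix (Fin 4) (Fin 4) ℕ} (h : rows E = rows F) :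
    rowSums E.transpose = rowSums F.transpose := by
  have key : ∀ G, rowSums G.transpose = Finset.univ.val.map (rows G).sum := fun G => by
    refine Multiset.map_congr rfl fun j _ => ?_
    change _ = (∑ i, fun j => G i j) j
    rw [Finset.sum_apply]
    rfl
  rw [key, key, h]

theorem sumSquares_eq_of_rows_eq {E F : Matrix (Fin 4) (Fin 4) ℕ} (h : rows E = rows F) :
    sumSquares E = sumSquares F := by
  have key : ∀ G, sumSquares G = ((rows G).map fun v => ∑ j, v j ^ 2).sum := fun G => by
    rw [sumSquares, rows, Multiset.map_map]
    rfl
  rw [key, key, h]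

/-- The exponents of the polynomial `transformed s`, with the rows in an order for which
transposition of this matrix describes the duality. -/
def exponentMatrix : Series → Matrix (Fin 4) (Fin 4) ℕ
  | .J => !![7, 1, 0, 4; 1, 3, 0, 2; 0, 0, 2, 0; 4, 2, 0, 3]
  | .K => !![8, 0, 0, 4; 0, 0, 2, 0; 0, 2, 1, 1; 4, 0, 1, 2]
  | .Kflat => !![4, 2, 0, 3; 0, 0, 2, 0; 0, 2, 1, 1; 4, 0, 1, 2]
  | .L => !![4, 0, 0, 4; 2, 0, 2, 0; 0, 2, 1, 1; 3, 0, 1, 2]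
  | .Lsharp => !![1, 2, 0, 3; 2, 0, 2, 0; 0, 2, 1, 1; 3, 0, 1, 2]
  | .M => !![3, 0, 3, 0; 0, 4, 0, 4; 3, 0, 1, 2; 0, 4, 2, 2]
  | .Msharp => !![3, 0, 1, 2; 0, 2, 1, 1; 1, 1, 2, 0; 2, 1, 0, 3]
  | .I => !![0, 12, 0, 6; 12, 0, 0, 6; 0, 0, 2, 0; 6, 6, 0, 6]

theorem transformed_eq_ofExponents (s : Series) :
    transformed s = ofExponents (exponentMatrix s) := by
  cases s <;>
    simp [transformed, quadrangleEq2, substitution, ofExponents, exponentMatrix,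
      Fin.sum_univ_four, Fin.prod_univ_four] <;> ring

theorem isDual_iff (s t : Series) : IsDual s t ↔ t = dualSeries s := by
  constructor
  · rintro ⟨E, hs, ht⟩
    rw [transformed_eq_ofExponents] at hs ht
    have hs := rows_eq_of_ofExponents_eq hs
    have ht := rows_eq_of_ofExponents_eq ht
    have h₁ := (rowSums_transpose_eq_of_rows_eq hs).trans (rowSums_eq_of_rows_eq ht).symm
    have h₂ := (rowSums_transpose_eq_of_rows_eq ht).trans (rowSums_eq_of_rows_eq hs).symm
    have h₃ : sumSquares (exponentMatrix s) = sumSquares (exponentMatrix t) := by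
      rw [sumSquares_eq_of_rows_eq hs, sumSquares_eq_of_rows_eq ht]
      exact Finset.sum_comm
    clear hs ht
    cases s <;> cases t <;> first
      | rfl
      | exact absurd (And.intro h₁ (And.intro h₂ h₃)) (by decide +kernel)
  · rintro rfl
    refine ⟨exponentMatrix s, transformed_eq_ofExponents s, ?_⟩
    rw [transformed_eq_ofExponents]
    congr 1
    cases s <;> decide

/-! ### Faces of the Newton polytope -/

section Polytope

variable {V : Type*} [AddCommGroup V] [Module ℝ V] [TopologicalSpace V]

/-- If the facet `ℓ = 1` contains all `v i` except `v k`, then an exposed face that contains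
neither `0` nor `v k` is contained in that facet. -/
theorem exposed_subset_facet {v : Fin 4 → V} {ℓ : StrongDual ℝ V} {k : Fin 4}
    (h : ∀ i, i ≠ k → ℓ (v i) = 1) {S : Set V}
    (hS : IsExposed ℝ (convexHull ℝ (insert 0 (Set.range v))) S) (hne : S.Nonempty)
    (h0 : (0 : V) ∉ S) (hk : v k ∉ S) :
    S ⊆ {x ∈ convexHull ℝ (insert 0 (Set.range v)) | 1 ≤ ℓ x} := by
  obtain ⟨m, rfl⟩ := hS hne
  obtain ⟨x₀, hx₀, hmax⟩ := hne
  have hA : insert 0 (Set.range v) ⊆ convexHull ℝ (insert 0 (Set.range v)) := subset_convexHull _ _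
  have hzero : (0 : V) ∈ convexHull ℝ (insert 0 (Set.range v)) := hA (Set.mem_insert _ _)
  have hv : ∀ i, v i ∈ convexHull ℝ (insert 0 (Set.range v)) := fun i =>
    hA (Set.mem_insert_of_mem _ ⟨i, rfl⟩)
  have hM : 0 < m x₀ := by
    by_contra! hle
    exact h0 ⟨hzero, fun y hy => by simpa using (hmax y hy).trans hle⟩
  have hMk : m (v k) < m x₀ := by
    by_contra! hle
    exact hk ⟨hv k, fun y hy => (hmax y hy).trans hle⟩
  -- `1 - ℓ ≤ K (m x₀ - m)` at the vertices, hence everywhere on the polytope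
  obtain ⟨K, hK0, hK1, hK2⟩ : ∃ K : ℝ, 0 ≤ K ∧ 1 ≤ K * m x₀ ∧
      1 - ℓ (v k) ≤ K * (m x₀ - m (v k)) := by
    have hd := sub_pos.2 hMk
    refine ⟨1 / m x₀ + |1 - ℓ (v k)| / (m x₀ - m (v k)), by positivity, ?_, ?_⟩
    · rw [add_mul, one_div_mul_cancel hM.ne']
      exact le_add_of_nonneg_right (by positivity)
    · rw [add_mul, div_mul_cancel₀ _ hd.ne']
      exact (le_abs_self _).trans (le_add_of_nonneg_left (by positivity))
  have hsub : convexHull ℝ (insert 0 (Set.range v)) ⊆ {x | (K • m - ℓ) x ≤ K * m x₀ - 1} := by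
    refine convexHull_min ?_ (convex_halfSpace_le (K • m - ℓ).isLinear _)
    rintro x (rfl | ⟨i, rfl⟩)
    · simpa using hK1
    · simp only [Set.mem_ofPred_eq, sub_apply, smul_apply,
        smul_eq_mul]
      rcases eq_or_ne i k with rfl | hi
      · linarith
      · have := mul_le_mul_of_nonneg_left (hmax _ (hv i)) hK0
        rw [h i hi]
        linarith
  rintro x ⟨hx, hx'⟩
  refine ⟨hx, ?_⟩
  have h1 := hsub hx
  simp only [Set.mem_ofPred_eq, sub_apply, smul_apply,
    smul_eq_mul] at h1
  have := mul_le_mul_of_nonneg_left (hx' _ hx₀) hK0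
  linarith

theorem le_one_of_mem_convexHull {v : Fin 4 → V} {ℓ : StrongDual ℝ V} (h : ∀ i, ℓ (v i) ≤ 1)
    {x : V} (hx : x ∈ convexHull ℝ (insert 0 (Set.range v))) : ℓ x ≤ 1 := by
  refine convexHull_min (t := {x | ℓ x ≤ 1}) ?_ (convex_halfSpace_le ℓ.isLinear _) hx
  rintro x (rfl | ⟨i, rfl⟩)
  · simp
  · exact h i

/-- The polytope spanned by `0` and four points `v i`, where `ℓ₁ = 1` is the plane through
`v 0, v 2, v 3` and `ℓ₂ = 1` the plane through `v 1, v 2, v 3`: the segment from `v 0` to `v 1`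
meets the cone over the segment from `v 2` to `v 3`, so it lies on no face away from `0`, and the
two planes cut out the two maximal faces. -/
theorem maximal_exposed_faces {v : Fin 4 → V} {ℓ₁ ℓ₂ : StrongDual ℝ V}
    (h₁ : ∀ i, i ≠ 1 → ℓ₁ (v i) = 1) (h₁' : ℓ₁ (v 1) < 1)
    (h₂ : ∀ i, i ≠ 0 → ℓ₂ (v i) = 1) (h₂' : ℓ₂ (v 0) < 1) {α β γ δ : ℝ} (hβ : 0 < β)
    (hγ : 0 ≤ γ) (hδ : 0 ≤ δ) (hrel : α • v 0 + β • v 1 = γ • v 2 + δ • v 3) :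
    {S | Maximal (fun S' => S'.Nonempty ∧
        IsExposed ℝ (convexHull ℝ (insert 0 (Set.range v))) S' ∧ 0 ∉ S') S} =
      {{x ∈ convexHull ℝ (insert 0 (Set.range v)) | 1 ≤ ℓ₁ x},
        {x ∈ convexHull ℝ (insert 0 (Set.range v)) | 1 ≤ ℓ₂ x}} := by
  set A := convexHull ℝ (insert 0 (Set.range v)) with hAdef
  have hv : ∀ i, v i ∈ A := fun i =>
    subset_convexHull _ _ (Set.mem_insert_of_mem _ ⟨i, rfl⟩)
  have facet : ∀ (ℓ : StrongDual ℝ V) (k : Fin 4), k ≠ 2 → (∀ i, i ≠ k → ℓ (v i) = 1) →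
      ℓ (v k) < 1 → ({x ∈ A | 1 ≤ ℓ x}.Nonempty ∧ IsExposed ℝ A {x ∈ A | 1 ≤ ℓ x} ∧
        (0 : V) ∉ {x ∈ A | 1 ≤ ℓ x}) := by
    intro ℓ k hk2 hk hk'
    have hle : ∀ y ∈ A, ℓ y ≤ 1 := fun y hy => le_one_of_mem_convexHull (fun i => by
      rcases eq_or_ne i k with rfl | hi
      · exact hk'.le
      · exact (hk i hi).le) hy
    refine ⟨⟨v 2, hv 2, (hk 2 hk2.symm).ge⟩, fun _ => ⟨ℓ, ?_⟩, fun h => ?_⟩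
    · ext x
      refine and_congr_right fun hx => ⟨fun h y hy => (hle y hy).trans h, fun h => ?_⟩
      rw [← hk 2 hk2.symm]
      exact h _ (hv 2)
    · have := h.2
      rw [map_zero] at this
      linarith
  have f₁ := facet ℓ₁ 1 (by decide) h₁ h₁'
  have f₂ := facet ℓ₂ 0 (by decide) h₂ h₂'
  have n₁₂ : ¬ {x ∈ A | 1 ≤ ℓ₁ x} ⊆ {x ∈ A | 1 ≤ ℓ₂ x} := fun h =>
    h₂'.not_ge (h ⟨hv 0, (h₁ 0 (by decide)).ge⟩).2
  have n₂₁ : ¬ {x ∈ A | 1 ≤ ℓ₂ x} ⊆ {x ∈ A | 1 ≤ ℓ₁ x} := fun h =>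
    h₁'.not_ge (h ⟨hv 1, (h₂ 1 (by decide)).ge⟩).2
  have main : ∀ S : Set V, S.Nonempty → IsExposed ℝ A S → (0 : V) ∉ S →
      S ⊆ {x ∈ A | 1 ≤ ℓ₁ x} ∨ S ⊆ {x ∈ A | 1 ≤ ℓ₂ x} := by
    intro S hne hS h0
    by_cases hv1 : v 1 ∈ S
    · by_cases hv0 : v 0 ∈ S
      · exfalso
        obtain ⟨m, rfl⟩ := hS hne
        have hlt : γ + δ < α + β := by
          have := congrArg ℓ₁ hrel
          simp only [map_add, map_smul, smul_eq_mul, h₁ 0 (by decide), h₁ 2 (by decide),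
            h₁ 3 (by decide), mul_one] at this
          nlinarith
        have hM : 0 < m (v 0) := by
          by_contra! hle
          exact h0 ⟨subset_convexHull _ _ (Set.mem_insert _ _), fun y hy => by
            simpa using (hv0.2 y hy).trans hle⟩
        have h2 := hv0.2 _ (hv 2)
        have h3 := hv0.2 _ (hv 3)
        have h1 := hv1.2 _ (hv 0)
        have := congrArg m hrel
        simp only [map_add, map_smul, smul_eq_mul] at this
        nlinarith
      · exact Or.inr (exposed_subset_facet h₂ hS hne h0 hv0)
    · exact Or.inl (exposed_subset_facet h₁ hS hne h0 hv1)
  ext S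
  simp only [Set.mem_ofPred_eq, Set.mem_insert_iff, Set.mem_singleton_iff]
  constructor
  · rintro ⟨⟨hne, hS, h0⟩, hmax⟩
    rcases main S hne hS h0 with h | h
    · exact Or.inl (h.antisymm (hmax f₁ h))
    · exact Or.inr (h.antisymm (hmax f₂ h))
  · rintro (rfl | rfl)
    · refine ⟨f₁, fun T hT hle => ?_⟩
      rcases main T hT.1 hT.2.1 hT.2.2 with h | h
      · exact h
      · exact (n₁₂ (hle.trans h)).elim
    · refine ⟨f₂, fun T hT hle => ?_⟩
      rcases main T hT.1 hT.2.1 hT.2.2 with h | h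
      · exact (n₂₁ (hle.trans h)).elim
      · exact h

end Polytope

/-- The monomial with exponents `m`. -/
def mon (m : Fin 4 → ℕ) : Poly4 := monomial (Finsupp.equivFunOnFinite.symm m) 1

theorem mon_eq_prod (m : Fin 4 → ℕ) : mon m = X 0 ^ m 0 * X 1 ^ m 1 * X 2 ^ m 2 * X 3 ^ m 3 := by
  rw [mon, monomial_eq, C_1, one_mul, Finsupp.prod_fintype _ _ (by simp), Fin.prod_univ_four]
  rfl

theorem support_mon_sub_mon {a b : Fin 4 → ℕ} (hab : a ≠ b) :
    (mon a - mon b).support =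
      {Finsupp.equivFunOnFinite.symm a, Finsupp.equivFunOnFinite.symm b} := by
  classical
  have hne : (Finsupp.equivFunOnFinite.symm a : Fin 4 →₀ ℕ) ≠ Finsupp.equivFunOnFinite.symm b :=
    fun h => hab (Finsupp.equivFunOnFinite.symm.injective h)
  ext m
  simp only [mon, mem_support_iff, coeff_sub, coeff_monomial, Finset.mem_insert,
    Finset.mem_singleton]
  by_cases h1 : Finsupp.equivFunOnFinite.symm a = m
  · subst h1
    simp [hne.symm]
  · by_cases h2 : Finsupp.equivFunOnFinite.symm b = m
    · subst h2
      simp [hne]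
    · simp [h1, h2, Ne.symm h1, Ne.symm h2]

theorem support_sum_smul_mon {ι : Type*} [Fintype ι] {e : ι → Fin 4 → ℕ}
    (he : Function.Injective e) {c : ι → ℂ} (hc : ∀ i, c i ≠ 0) :
    ((∑ i, c i • mon (e i)).support : Set (Fin 4 →₀ ℕ)) =
      Set.range fun i => Finsupp.equivFunOnFinite.symm (e i) := by
  classical
  ext m
  simp only [Finset.mem_coe, mem_support_iff, coeff_sum, coeff_smul, mon, coeff_monomial,
    smul_eq_mul, mul_ite, mul_one, mul_zero, Set.mem_range]
  constructor
  · intro h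
    obtain ⟨i, -, hi⟩ := Finset.exists_ne_zero_of_sum_ne_zero h
    exact ⟨i, by by_contra hne; simp [hne] at hi⟩
  · rintro ⟨i, rfl⟩
    simp only [EmbeddingLike.apply_eq_iff_eq, he.eq_iff]
    simpa using hc i

/-- The functional `(∑ i, w i * x i) / D` on the exponents modulo the relation `p = 0`, for a system
of weights `w` for which `p` is homogeneous. -/
theorem exists_weight_functional {p : Poly4} {w : Fin 4 → ℕ}
    (hp : ∀ a ∈ p.support, ∀ b ∈ p.support, ∑ i, w i * a i = ∑ i, w i * b i) (D : ℕ) :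
    ∃ ℓ : StrongDual ℝ ((Fin 4 → ℝ) ⧸ relationSpace p),
      ∀ m : Fin 4 →₀ ℕ, ℓ (expClass p m) = (∑ i, w i * m i : ℕ) / (D : ℝ) := by
  let f : (Fin 4 → ℝ) →L[ℝ] ℝ :=
    (D : ℝ)⁻¹ • ∑ i, (w i : ℝ) • (ContinuousLinearMap.proj i : (Fin 4 → ℝ) →L[ℝ] ℝ)
  have hf : ∀ m : Fin 4 →₀ ℕ, f (expVec m) = (∑ i, w i * m i : ℕ) / (D : ℝ) := fun m => by
    simp [f, expVec, div_eq_inv_mul]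
  have hker : relationSpace p ≤ f.ker := by
    refine Submodule.span_le.2 ?_
    rintro _ ⟨a, ha, b, hb, rfl⟩
    change f (expVec a - expVec b) = 0
    rw [map_sub, hf, hf, hp a ha b hb, sub_self]
  exact ⟨(relationSpace p).liftQL f hker, hf⟩

/-- The two maximal outer faces for a binomial `p` and a quadrinomial `q`, and the corresponding
parts of `q`. -/
theorem outerFaces_eq_pair {p q : Poly4} {a b : Fin 4 → ℕ} (hp : p = mon a - mon b)
    {e : Fin 4 → Fin 4 → ℕ} {c : Fin 4 → ℤ}
    (hq : q = ∑ i, (c i : ℂ) • mon (e i)) {w₁ w₂ : Fin 4 → ℕ} {D₁ D₂ : ℕ} {α β γ δ : ℕ} {κ : ℤ}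
    (hcomb : (∀ i, c i ≠ 0) ∧ a ≠ b ∧ Function.Injective e ∧
      ∑ j, w₁ j * a j = ∑ j, w₁ j * b j ∧ ∑ j, w₂ j * a j = ∑ j, w₂ j * b j ∧
      (∀ i, i ≠ 1 → ∑ j, w₁ j * e i j = D₁) ∧ ∑ j, w₁ j * e 1 j < D₁ ∧
      (∀ i, i ≠ 0 → ∑ j, w₂ j * e i j = D₂) ∧ ∑ j, w₂ j * e 0 j < D₂ ∧ 0 < β ∧
      ∀ j, (α * e 0 j + β * e 1 j : ℤ) = γ * e 2 j + δ * e 3 j + κ * (a j - b j)) :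
    ∃ S T, S ≠ T ∧ outerFaces p q = {S, T} ∧
      facePart p q S = ∑ i, (c (Fin.succAbove 1 i) : ℂ) • mon (e (Fin.succAbove 1 i)) ∧
      facePart p q T = ∑ i, (c (Fin.succAbove 0 i) : ℂ) • mon (e (Fin.succAbove 0 i)) := by
  classical
  obtain ⟨hc, hab, he, hw₁, hw₂, he₁, he₁', he₂, he₂', hβ, hrel⟩ := hcomb
  have hps := support_mon_sub_mon hab
  rw [← hp] at hps
  have hqs := support_sum_smul_mon he (c := fun i => (c i : ℂ)) fun i =>
    Int.cast_ne_zero.2 (hc i)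
  rw [← hq] at hqs
  have hom : ∀ w : Fin 4 → ℕ, ∑ j, w j * a j = ∑ j, w j * b j →
      ∀ m ∈ p.support, ∀ n ∈ p.support, ∑ i, w i * m i = ∑ i, w i * n i := by
    intro w hw m hm n hn
    rw [hps, Finset.mem_insert, Finset.mem_singleton] at hm hn
    rcases hm with rfl | rfl <;> rcases hn with rfl | rfl <;> simp [hw]
  obtain ⟨ℓ₁, hℓ₁⟩ := exists_weight_functional (hom w₁ hw₁) D₁
  obtain ⟨ℓ₂, hℓ₂⟩ := exists_weight_functional (hom w₂ hw₂) D₂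
  set v : Fin 4 → (Fin 4 → ℝ) ⧸ relationSpace p :=
    fun i => expClass p (Finsupp.equivFunOnFinite.symm (e i)) with hv
  have hD₁ : (0 : ℝ) < D₁ := by exact_mod_cast (Nat.zero_le _).trans_lt he₁'
  have hD₂ : (0 : ℝ) < D₂ := by exact_mod_cast (Nat.zero_le _).trans_lt he₂'
  have v₁ : ∀ i, i ≠ 1 → ℓ₁ (v i) = 1 := fun i hi => by
    rw [hv, hℓ₁]
    simp only [Finsupp.equivFunOnFinite_symm_apply_apply, he₁ i hi]
    exact div_self hD₁.ne'
  have v₁' : ℓ₁ (v 1) < 1 := by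
    rw [hv, hℓ₁, div_lt_one hD₁]
    exact_mod_cast he₁'
  have v₂ : ∀ i, i ≠ 0 → ℓ₂ (v i) = 1 := fun i hi => by
    rw [hv, hℓ₂]
    simp only [Finsupp.equivFunOnFinite_symm_apply_apply, he₂ i hi]
    exact div_self hD₂.ne'
  have v₂' : ℓ₂ (v 0) < 1 := by
    rw [hv, hℓ₂, div_lt_one hD₂]
    exact_mod_cast he₂'
  have vrel : (α : ℝ) • v 0 + (β : ℝ) • v 1 = (γ : ℝ) • v 2 + (δ : ℝ) • v 3 := by
    simp only [hv, expClass, ← map_smul, ← map_add]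
    refine (Submodule.Quotient.eq _).2 ?_
    have hmem : expVec (Finsupp.equivFunOnFinite.symm a) - expVec (Finsupp.equivFunOnFinite.symm b)
        ∈ relationSpace p :=
      Submodule.subset_span ⟨_, by simp [hps], _, by simp [hps], rfl⟩
    convert (relationSpace p).smul_mem (κ : ℝ) hmem using 1
    ext j
    have := congrArg (Int.cast : ℤ → ℝ) (hrel j)
    push_cast at this
    simp only [expVec, Pi.sub_apply, Pi.add_apply, Pi.smul_apply, smul_eq_mul,
      Finsupp.equivFunOnFinite_symm_apply_apply]
    linarith
  have hpoly : newtonPolytope p q = convexHull ℝ (insert 0 (Set.range v)) := by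
    rw [newtonPolytope, hqs, ← Set.range_comp]
    rfl
  have hmem : ∀ i, v i ∈ newtonPolytope p q := fun i => by
    rw [hpoly]
    exact subset_convexHull _ _ (Set.mem_insert_of_mem _ ⟨i, rfl⟩)
  have hinj : Function.Injective fun i => (Finsupp.equivFunOnFinite.symm (e i) : Fin 4 →₀ ℕ) :=
    fun i j h => he (Finsupp.equivFunOnFinite.symm.injective h)
  have hqsf : q.support = Finset.univ.image fun i => Finsupp.equivFunOnFinite.symm (e i) := by
    apply Finset.coe_injective
    rw [hqs]
    simp
  have hcoeff : ∀ i, coeff (Finsupp.equivFunOnFinite.symm (e i)) q = (c i : ℂ) := fun i => by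
    simp [hq, coeff_sum, mon, coeff_monomial, he.eq_iff]
  have hpart : ∀ S, facePart p q S =
      ∑ i, if v i ∈ S then (c i : ℂ) • mon (e i) else 0 := fun S => by
    rw [facePart, Finset.sum_filter, hqsf, Finset.sum_image hinj.injOn]
    refine Finset.sum_congr rfl fun i _ => ?_
    simp only [hcoeff, mon, smul_monomial, smul_eq_mul, mul_one, hv]
  refine ⟨{x ∈ newtonPolytope p q | 1 ≤ ℓ₁ x}, {x ∈ newtonPolytope p q | 1 ≤ ℓ₂ x}, ?_, ?_, ?_, ?_⟩
  · intro h
    have : v 0 ∈ {x ∈ newtonPolytope p q | 1 ≤ ℓ₂ x} := by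
      rw [← h]
      exact ⟨hmem 0, (v₁ 0 (by decide)).ge⟩
    exact v₂'.not_ge this.2
  · rw [outerFaces, hpoly]
    exact maximal_exposed_faces v₁ v₁' v₂ v₂' (Nat.cast_pos.2 hβ) (Nat.cast_nonneg _)
      (Nat.cast_nonneg _) vrel
  · rw [hpart, Fin.sum_univ_succAbove _ 1, if_neg fun h => v₁'.not_ge h.2, zero_add]
    exact Finset.sum_congr rfl fun i _ => if_pos ⟨hmem _, (v₁ _ (Fin.succAbove_ne 1 i)).ge⟩
  · rw [hpart, Fin.sum_univ_succAbove _ 0, if_neg fun h => v₂'.not_ge h.2, zero_add]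
    exact Finset.sum_congr rfl fun i _ => if_pos ⟨hmem _, (v₂ _ (Fin.succAbove_ne 0 i)).ge⟩

/-! ### The equations and their faces -/

/-- The exponents of the second monomial of `h₁`; the first one is `x y`. -/
def relationExponent : Series → Fin 4 → ℕ
  | .J | .K | .Kflat | .M => ![0, 0, 0, 2]
  | .L | .Lsharp | .Msharp => ![0, 0, 1, 1]
  | .I => ![0, 0, 0, 3]

/-- The exponents of the four terms of `h₂`. The first face contains all of them but number `1`, and
the second face all of them but number `0`. -/
def termExponent : Series → Fin 4 → Fin 4 → ℕ
  | .J => ![![2, 0, 1, 0], ![0, 1, 0, 1], ![0, 0, 2, 0], ![1, 0, 0, 2]]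
  | .K => ![![2, 0, 0, 1], ![0, 1, 1, 0], ![0, 0, 2, 0], ![1, 0, 0, 2]]
  | .Kflat => ![![2, 0, 0, 1], ![0, 0, 2, 0], ![0, 1, 1, 0], ![2, 0, 1, 0]]
  | .L => ![![2, 0, 0, 1], ![0, 1, 0, 1], ![0, 0, 2, 0], ![1, 0, 0, 2]]
  | .Lsharp => ![![2, 0, 0, 1], ![0, 0, 2, 0], ![0, 1, 0, 1], ![2, 0, 1, 0]]
  | .M => ![![0, 1, 1, 0], ![1, 0, 0, 1], ![0, 0, 3, 0], ![0, 0, 0, 2]]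
  | .Msharp => ![![0, 0, 2, 0], ![0, 1, 0, 1], ![2, 0, 0, 1], ![0, 1, 1, 0]]
  | .I => ![![1, 0, 0, 1], ![0, 0, 2, 0], ![0, 1, 1, 0], ![1, 0, 1, 0]]

/-- The coefficients of the four terms of `h₂`. -/
def termCoeff : Series → Fin 4 → ℤ
  | .J => ![-1, 1, 1, 1]
  | .K => ![-1, 1, 1, 1]
  | .Kflat => ![-1, 1, 1, 1]
  | .L => ![-1, 1, 1, 1]
  | .Lsharp => ![-1, 1, 1, 1]
  | .M => ![-1, 1, 1, 1]
  | .Msharp => ![-1, 1, 1, 1]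
  | .I => ![-1, 1, 1, 1]

/-- The weights of the `ℂ*`-action for the face that misses the term `k`, for `k = 0, 1`. -/
def faceWeight : Series → Fin 2 → Fin 4 → ℕ
  | .J => ![![2, 6, 5, 4], ![2, 4, 4, 3]]
  | .K => ![![2, 4, 4, 3], ![2, 2, 3, 2]]
  | .Kflat => ![![2, 4, 4, 3], ![2, 4, 3, 3]]
  | .L => ![![2, 5, 4, 3], ![2, 3, 3, 2]]
  | .Lsharp => ![![2, 5, 4, 3], ![2, 4, 3, 3]]
  | .M => ![![3, 3, 2, 3], ![2, 4, 2, 3]]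
  | .Msharp => ![![2, 4, 3, 3], ![2, 3, 3, 2]]
  | .I => ![![3, 3, 3, 2], ![3, 3, 2, 2]]

/-- The exponents of the terms of `h₂` other than the term `k`. -/
def faceExponent (s : Series) (k : Fin 2) (i : Fin 3) : Fin 4 → ℕ :=
  termExponent s ((k.castLE (by decide) : Fin 4).succAbove i)

/-- The coefficients of the terms of `h₂` other than the term `k`. -/
def faceCoeff (s : Series) (k : Fin 2) (i : Fin 3) : ℤ :=
  termCoeff s ((k.castLE (by decide) : Fin 4).succAbove i)

/-- The sum of the terms of `h₂` other than the term `k`. -/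
def facePoly (s : Series) (k : Fin 2) : Poly4 :=
  ∑ i, (faceCoeff s k i : ℂ) • mon (faceExponent s k i)

theorem h₁_eq (s : Series) : h₁ s = mon ![1, 1, 0, 0] - mon (relationExponent s) := by
  cases s <;> simp [h₁, factorA, relationExponent, mon_eq_prod]

theorem h₂_eq (s : Series) : h₂ s = ∑ i, (termCoeff s i : ℂ) • mon (termExponent s i) := by
  cases s <;>
    simp [h₂, factorB, factorC, termCoeff, termExponent, mon_eq_prod, Fin.sum_univ_four] <;> ring

theorem outerFaces_eq (s : Series) :
    ∃ S T, S ≠ T ∧ outerFaces (h₁ s) (h₂ s) = {S, T} ∧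
      facePart (h₁ s) (h₂ s) S = facePoly s 1 ∧ facePart (h₁ s) (h₂ s) T = facePoly s 0 := by
  have key := fun D₁ D₂ α β γ δ κ => outerFaces_eq_pair (h₁_eq s) (h₂_eq s) (w₁ := faceWeight s 1)
    (w₂ := faceWeight s 0) (D₁ := D₁) (D₂ := D₂) (α := α) (β := β) (γ := γ) (δ := δ) (κ := κ)
  cases s
  · exact key 8 10 10 8 5 12 8 (by decide +kernel)
  · exact key 6 8 8 6 3 10 6 (by decide +kernel)
  · exact key 7 8 8 7 4 10 (-4) (by decide +kernel)
  · exact key 6 8 8 6 3 10 6 (by decide +kernel)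
  · exact key 7 8 8 7 4 10 (-4) (by decide +kernel)
  · exact key 6 6 6 6 2 9 6 (by decide +kernel)
  · exact key 6 7 7 6 2 10 (-4) (by decide +kernel)
  · exact key 5 6 6 5 2 8 (-2) (by decide +kernel)

/-! ### Weights, isotropy groups and orbits -/

theorem isWeightedHomogeneous_iff_support {w : Fin 4 → ℕ} {φ : Poly4} {d : ℕ} :
    IsWeightedHomogeneous w φ d ↔ ∀ m ∈ φ.support, ∑ i, w i * m i = d := by
  refine forall_congr' fun m => ?_
  rw [mem_support_iff, Finsupp.weight_apply, Finsupp.sum_fintype _ _ (by simp)]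
  simp only [smul_eq_mul, mul_comm]

theorem exists_isWeightedHomogeneous_mon_sub_mon {w a b : Fin 4 → ℕ} (hab : a ≠ b) :
    (∃ d, IsWeightedHomogeneous w (mon a - mon b) d) ↔ ∑ i, w i * a i = ∑ i, w i * b i := by
  simp [isWeightedHomogeneous_iff_support, support_mon_sub_mon hab, eq_comm]

theorem exists_isWeightedHomogeneous_sum {w : Fin 4 → ℕ} {n : ℕ} {e : Fin (n + 1) → Fin 4 → ℕ}
    (he : Function.Injective e) {c : Fin (n + 1) → ℂ} (hc : ∀ i, c i ≠ 0) :
    (∃ d, IsWeightedHomogeneous w (∑ i, c i • mon (e i)) d) ↔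
      ∀ i, ∑ j, w j * e i j = ∑ j, w j * e 0 j := by
  simp only [isWeightedHomogeneous_iff_support, ← Finset.mem_coe, support_sum_smul_mon he hc,
    Set.forall_mem_range, Finsupp.equivFunOnFinite_symm_apply_apply]
  exact ⟨fun ⟨d, hd⟩ i => (hd i).trans (hd 0).symm, fun h => ⟨_, h⟩⟩

theorem relationExponent_ne (s : Series) : ![1, 1, 0, 0] ≠ relationExponent s := by
  cases s <;> decide

theorem faceExponent_injective (s : Series) (k : Fin 2) :
    Function.Injective (faceExponent s k) := by
  cases s <;> fin_cases k <;> decide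

theorem faceCoeff_ne_zero (s : Series) (k : Fin 2) (i : Fin 3) : faceCoeff s k i ≠ 0 := by
  revert i
  cases s <;> fin_cases k <;> decide

theorem faceWeight_pos (s : Series) (k : Fin 2) (i : Fin 4) : 0 < faceWeight s k i := by
  revert i
  cases s <;> fin_cases k <;> decide

theorem isReducedWeightSystem_iff (s : Series) (k : Fin 2) (w : Fin 4 → ℕ) :
    IsReducedWeightSystem (h₁ s) (facePoly s k) w ↔ w = faceWeight s k := by
  rw [IsReducedWeightSystem, h₁_eq, facePoly,
    exists_isWeightedHomogeneous_mon_sub_mon (relationExponent_ne s),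
    exists_isWeightedHomogeneous_sum (faceExponent_injective s k)
      fun i => Int.cast_ne_zero.2 (faceCoeff_ne_zero s k i)]
  constructor
  · rintro ⟨-, hgcd, h1, h2⟩
    -- the linear equations determine the weights up to a factor, which is one as they are reduced
    have hprop : ∀ i, w i * faceWeight s k 0 = w 0 * faceWeight s k i := by
      have h2₁ := h2 1
      have h2₂ := h2 2
      clear h2 hgcd
      revert h1 h2₁ h2₂
      cases s <;> fin_cases k <;>
      · simp only [Fin.sum_univ_four]
        intro h1 h2 h3 i
        fin_cases i <;>
        simp [relationExponent, faceExponent, termExponent, faceWeight, Fin.succAbove]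
          at h1 h2 h3 ⊢ <;>
        omega
    have hgcd' : Finset.univ.gcd (faceWeight s k) = 1 := by
      cases s <;> fin_cases k <;> decide
    have hl : Finset.univ.gcd (fun i => w i * faceWeight s k 0) = faceWeight s k 0 := by
      rw [Finset.gcd_mul_right, hgcd, one_mul, normalize_eq]
    have hr : Finset.univ.gcd (fun i => w 0 * faceWeight s k i) = w 0 := by
      rw [Finset.gcd_mul_left, hgcd', mul_one, normalize_eq]
    have h0 : faceWeight s k 0 = w 0 := by
      rw [← hl, ← hr]
      exact Finset.gcd_congr rfl fun i _ => hprop i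
    funext i
    have := hprop i
    rw [← h0, mul_comm] at this
    exact Nat.eq_of_mul_eq_mul_left (faceWeight_pos s k 0) this
  · rintro rfl
    refine ⟨faceWeight_pos s k, ?_⟩
    cases s <;> fin_cases k <;> decide

theorem mem_isotropy {w : Fin 4 → ℕ} {v : Fin 4 → ℂ} {t : ℂˣ} :
    t ∈ isotropy w v ↔ ∀ i, v i ≠ 0 → t ^ w i = 1 := by
  change act w t v = v ↔ _
  rw [funext_iff]
  refine forall_congr' fun i => ?_
  rw [act, Units.ext_iff, Units.val_pow_eq_pow_val, Units.val_one]
  constructor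
  · intro h hv
    exact mul_right_cancel₀ hv (by rw [h, one_mul])
  · intro h
    by_cases hv : v i = 0
    · rw [hv, mul_zero]
    · rw [h hv, one_mul]

open Classical in
theorem isotropy_eq_rootsOfUnity (w : Fin 4 → ℕ) (v : Fin 4 → ℂ) :
    isotropy w v = rootsOfUnity ((Finset.univ.filter fun i => v i ≠ 0).gcd w) ℂ := by
  ext t
  rw [mem_isotropy, mem_rootsOfUnity, ← orderOf_dvd_iff_pow_eq_one, Finset.dvd_gcd_iff]
  simp [orderOf_dvd_iff_pow_eq_one]

theorem natCard_isotropy {w : Fin 4 → ℕ} (hw : ∀ i, 0 < w i) {v : Fin 4 → ℤ} (hv : v ≠ 0) :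
    Nat.card (isotropy w fun i => (v i : ℂ)) = (Finset.univ.filter fun i => v i ≠ 0).gcd w := by
  classical
  rw [isotropy_eq_rootsOfUnity]
  simp only [ne_eq, Int.cast_eq_zero]
  obtain ⟨i, hi⟩ := Function.ne_iff.1 hv
  have : NeZero ((Finset.univ.filter fun i => ¬ v i = 0).gcd w) := ⟨fun h =>
    (hw i).ne' (Finset.gcd_eq_zero_iff.1 h i (by simpa using hi))⟩
  exact Complex.card_rootsOfUnity _

theorem eq_zero_or_eq_zero_of_coprime {w : Fin 4 → ℕ} {v : Fin 4 → ℂ} (h : isotropy w v ≠ ⊥)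
    (i j : Fin 4) (hij : (w i).Coprime (w j)) : v i = 0 ∨ v j = 0 := by
  by_contra! hne
  refine h ((Subgroup.eq_bot_iff_forall _).2 fun t ht => ?_)
  have := pow_gcd_eq_one.2 ⟨mem_isotropy.1 ht i hne.1, mem_isotropy.1 ht j hne.2⟩
  rwa [hij, pow_one] at this

theorem act_act (w : Fin 4 → ℕ) (s t : ℂˣ) (v : Fin 4 → ℂ) :
    act w s (act w t v) = act w (s * t) v := by
  funext i
  simp only [act, Units.val_mul]
  ring

theorem self_mem_orbit (w : Fin 4 → ℕ) (v : Fin 4 → ℂ) : v ∈ orbit w v :=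
  ⟨1, by funext i; simp [act]⟩

theorem orbit_eq_of_mem {w : Fin 4 → ℕ} {u v : Fin 4 → ℂ} (h : v ∈ orbit w u) :
    orbit w v = orbit w u := by
  obtain ⟨t, rfl⟩ := h
  ext x
  constructor
  · rintro ⟨r, rfl⟩
    exact ⟨r * t, (act_act w r t u).symm⟩
  · rintro ⟨r, rfl⟩
    exact ⟨r * t⁻¹, by simp [act_act]⟩

theorem isotropy_eq_of_orbit_eq {w : Fin 4 → ℕ} {u v : Fin 4 → ℂ} (h : orbit w u = orbit w v) :
    isotropy w u = isotropy w v := by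
  obtain ⟨t, rfl⟩ : u ∈ orbit w v := h ▸ self_mem_orbit w u
  ext r
  simp [mem_isotropy, act]

/-- Two points lie on the same orbit if every parameter that adjusts the coordinate `k` moves one to
the other. -/
theorem orbit_eq_of_forall_pow {w : Fin 4 → ℕ} (hw : ∀ i, 0 < w i) {u v : Fin 4 → ℂ} (k : Fin 4)
    (hk : v k ≠ 0) (h : ∀ t : ℂ, t ^ w k = v k → ∀ i, t ^ w i * u i = v i) :
    orbit w v = orbit w u := by
  obtain ⟨t, ht⟩ := IsAlgClosed.exists_pow_nat_eq (v k) (hw k)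
  have ht0 : t ≠ 0 := by
    rintro rfl
    rw [zero_pow (hw k).ne'] at ht
    exact hk ht.symm
  exact orbit_eq_of_mem ⟨Units.mk0 t ht0, funext (h t ht)⟩

theorem orbit_subset_iff {w : Fin 4 → ℕ} {v : Fin 4 → ℂ} {S : Set (Fin 4 → ℂ)}
    (h : ∀ t : ℂˣ, ∀ v ∈ S, act w t v ∈ S) : orbit w v ⊆ S ↔ v ∈ S := by
  refine ⟨fun hs => hs (self_mem_orbit w v), ?_⟩
  rintro hv _ ⟨t, rfl⟩
  exact h t v hv

theorem orbit_subset_coordPlane_iff {w : Fin 4 → ℕ} {v : Fin 4 → ℂ} {i j : Fin 4} :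
    orbit w v ⊆ coordPlane i j ↔ v ∈ coordPlane i j :=
  orbit_subset_iff fun t v hv => ⟨by simp [act, hv.1], by simp [act, hv.2]⟩

/-- The orbit of a point of a coordinate axis is the axis without the origin. -/
theorem orbit_eq_axis {w : Fin 4 → ℕ} (hw : ∀ i, 0 < w i) {v : Fin 4 → ℂ} {k : Fin 4}
    (hv : ∀ i, i ≠ k → v i = 0) (hv0 : v ≠ 0) :
    orbit w v = {x | ∀ i, i ≠ k → x i = 0} \ {0} := by
  have hk : ∀ x : Fin 4 → ℂ, (∀ i, i ≠ k → x i = 0) → x ≠ 0 → x k ≠ 0 := fun x hx hx0 h0 =>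
    hx0 (funext fun i => by
      rcases eq_or_ne i k with rfl | hi
      · exact h0
      · exact hx i hi)
  have hvk := hk v hv hv0
  ext x
  constructor
  · rintro ⟨t, rfl⟩
    refine ⟨fun i hi => by simp [act, hv i hi], fun h => ?_⟩
    have := congrFun (Set.mem_singleton_iff.1 h) k
    simp [act, hvk] at this
  · rintro ⟨hx, hx0⟩
    obtain ⟨t, ht⟩ := IsAlgClosed.exists_pow_nat_eq (x k / v k) (hw k)
    have hne : x k / v k ≠ 0 := div_ne_zero (hk x hx hx0) hvk
    have ht0 : t ≠ 0 := by
      rintro rfl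
      rw [zero_pow (hw k).ne'] at ht
      exact hne ht.symm
    refine ⟨Units.mk0 t ht0, funext fun i => ?_⟩
    rcases eq_or_ne i k with rfl | hi
    · simp only [act, Units.val_mk0, ht]
      exact div_mul_cancel₀ _ hvk
    · simp [act, hx i hi, hv i hi]

/-! ### Coordinate planes, the component `U` and the singular locus -/

section Values

variable {R : Type*} [CommRing R]

/-- The value of the first equation at a point of any commutative ring. -/
def relationValue (s : Series) (v : Fin 4 → R) : R :=
  v 0 * v 1 - ∏ j, v j ^ relationExponent s j

/-- The value of the second equation of a face at a point of any commutative ring. -/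
def faceValue (s : Series) (k : Fin 2) (v : Fin 4 → R) : R :=
  ∑ i, (faceCoeff s k i : R) * ∏ j, v j ^ faceExponent s k i j

end Values

theorem eval_mon (m : Fin 4 → ℕ) (v : Fin 4 → ℂ) : eval v (mon m) = ∏ j, v j ^ m j := by
  rw [mon, eval_monomial, one_mul, Finsupp.prod_fintype _ _ (by simp)]
  rfl

theorem mem_variety {s : Series} {k : Fin 2} {v : Fin 4 → ℂ} :
    v ∈ variety (h₁ s) (facePoly s k) ↔ relationValue s v = 0 ∧ faceValue s k v = 0 := by
  simp [variety, h₁_eq, facePoly, eval_mon, relationValue, faceValue, Fin.prod_univ_four,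
    map_sum, smul_eval]

theorem mem_variety_intCast {s : Series} {k : Fin 2} {v : Fin 4 → ℤ} :
    (fun i => (v i : ℂ)) ∈ variety (h₁ s) (facePoly s k) ↔
      relationValue s v = 0 ∧ faceValue s k v = 0 := by
  rw [mem_variety, ← Int.cast_eq_zero (α := ℂ), ← Int.cast_eq_zero (α := ℂ)]
  simp [relationValue, faceValue]

/-- The coordinate planes contained in the variety of a face. -/
def containedPlanes : Series → Fin 2 → List (Fin 4 × Fin 4)
  | .L => ![[], [(0, 2), (2, 0)]]
  | .Lsharp => ![[(1, 2), (2, 1)], [(0, 3), (3, 0)]]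
  | .Msharp => ![[(1, 3), (3, 1)], [(0, 2), (2, 0)]]
  | _ => ![[], []]

theorem coordPlane_subset_variety_iff (s : Series) (k : Fin 2) (i j : Fin 4) (hij : i ≠ j) :
    coordPlane i j ⊆ variety (h₁ s) (facePoly s k) ↔ (i, j) ∈ containedPlanes s k := by
  constructor
  · intro h
    -- a point of the plane whose other coordinates are distinct primes
    have hmem : (fun l => ((if l = i ∨ l = j then 0 else ![2, 3, 5, 7] l : ℤ) : ℂ)) ∈
        coordPlane i j := by simp [coordPlane]
    have := mem_variety_intCast.1 (h hmem)
    clear h hmem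
    revert i j
    cases s <;> fin_cases k <;> decide +kernel
  · intro h v hv
    have key : ∀ (m : Fin 4 → ℕ), m i ≠ 0 ∨ m j ≠ 0 → ∏ l, v l ^ m l = 0 := by
      rintro m (hm | hm)
      · exact Finset.prod_eq_zero (Finset.mem_univ i) (by rw [hv.1, zero_pow hm])
      · exact Finset.prod_eq_zero (Finset.mem_univ j) (by rw [hv.2, zero_pow hm])
    have hcomb : ((![1, 1, 0, 0] i ≠ 0 ∨ ![1, 1, 0, 0] j ≠ 0) ∧
        (relationExponent s i ≠ 0 ∨ relationExponent s j ≠ 0)) ∧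
        ∀ l, faceExponent s k l i ≠ 0 ∨ faceExponent s k l j ≠ 0 := by
      clear key hv
      revert i j
      cases s <;> fin_cases k <;> decide +kernel
    rw [mem_variety]
    constructor
    · have := key ![1, 1, 0, 0] hcomb.1.1
      simp only [Fin.prod_univ_four] at this
      rw [relationValue, key _ hcomb.1.2]
      simpa using this
    · exact Finset.sum_eq_zero fun l _ => by rw [key _ (hcomb.2 l), mul_zero]

theorem not_caseB {s : Series} {k : Fin 2} (l : Fin 3) (hl : faceExponent s k l 2 = 0) :
    ¬ CaseB (h₁ s) (facePoly s k) := by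
  rintro ⟨-, g, -, hg⟩
  have hc : coeff (Finsupp.equivFunOnFinite.symm (faceExponent s k l)) (facePoly s k) =
      (faceCoeff s k l : ℂ) := by
    simp [facePoly, coeff_sum, mon, coeff_monomial, (faceExponent_injective s k).eq_iff]
  rw [hg, coeff_X_mul', if_neg (by simp [hl])] at hc
  exact faceCoeff_ne_zero s k l (by exact_mod_cast hc.symm)

theorem caseA_iff (s : Series) (k : Fin 2) :
    CaseA (h₁ s) (facePoly s k) ↔ containedPlanes s k ≠ [] := by
  constructor
  · rintro ⟨i, j, hij, h⟩
    rw [coordPlane_subset_variety_iff s k i j hij] at h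
    exact List.ne_nil_of_mem h
  · intro hne
    obtain ⟨⟨i, j⟩, L, h⟩ := List.ne_nil_iff_exists_cons.1 hne
    have hmem : (i, j) ∈ containedPlanes s k := by simp [h]
    have hij : i ≠ j := by
      clear h
      revert i j
      cases s <;> fin_cases k <;> decide +kernel
    exact ⟨i, j, hij, (coordPlane_subset_variety_iff s k i j hij).2 hmem⟩

section Principal

variable {s : Series} {k : Fin 2} {v : Fin 4 → ℂ}

theorem isPrincipalPoint_iff_of_caseA {i j : Fin 4} (hij : i ≠ j)
    (hP : containedPlanes s k = [(i, j), (j, i)]) (l : Fin 3) (hl : faceExponent s k l 2 = 0) :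
    IsPrincipalPoint (h₁ s) (facePoly s k) (faceWeight s k) v ↔
      v ∈ variety (h₁ s) (facePoly s k) ∧ v ≠ 0 ∧ isotropy (faceWeight s k) v ≠ ⊥ ∧
        ¬ (v i = 0 ∧ v j = 0) := by
  have hA : CaseA (h₁ s) (facePoly s k) := (caseA_iff s k).2 (by simp [hP])
  refine and_congr_right fun _ => and_congr_right fun _ => and_congr_right fun _ =>
    ⟨fun h => ?_, fun h => ⟨?_, fun hB => (not_caseB l hl hB).elim, fun h' => (h' hA).elim⟩⟩
  · have := h.1 i j hij ((coordPlane_subset_variety_iff s k i j hij).2 (by simp [hP]))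
    rwa [orbit_subset_coordPlane_iff] at this
  · intro i' j' hij' hsub
    rw [coordPlane_subset_variety_iff s k i' j' hij', hP] at hsub
    rw [orbit_subset_coordPlane_iff]
    simp only [List.mem_cons, Prod.mk.injEq, List.not_mem_nil, or_false] at hsub
    rcases hsub with ⟨rfl, rfl⟩ | ⟨rfl, rfl⟩
    · exact h
    · exact fun hv => h ⟨hv.2, hv.1⟩

theorem isPrincipalPoint_iff_of_caseB (hP : containedPlanes s k = [])
    (hB : CaseB (h₁ s) (facePoly s k)) :
    IsPrincipalPoint (h₁ s) (facePoly s k) (faceWeight s k) v ↔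
      v ∈ variety (h₁ s) (facePoly s k) ∧ v ≠ 0 ∧ isotropy (faceWeight s k) v ≠ ⊥ ∧
        ¬ v 2 = 0 := by
  refine and_congr_right fun hv => and_congr_right fun _ => and_congr_right fun _ =>
    ⟨fun h h2 => ?_, fun h => ⟨?_, fun _ h' => ?_, fun _ h' => (h' hB).elim⟩⟩
  · refine h.2.1 hB ?_
    rintro _ ⟨t, rfl⟩
    have hmem : v ∈ variety (h₁ s) (facePoly s k) := hv
    have hw := (isReducedWeightSystem_iff s k (faceWeight s k)).2 rfl
    obtain ⟨d, hd⟩ := hw.2.2.1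
    refine ⟨?_, by simp [act, h2]⟩
    have : eval (act (faceWeight s k) t v) (h₁ s) = (t : ℂ) ^ d * eval v (h₁ s) := by
      rw [eval_eq, eval_eq, Finset.mul_sum]
      refine Finset.sum_congr rfl fun m hm => ?_
      rw [← isWeightedHomogeneous_iff_support.1 hd m hm]
      have e1 : ∀ x : Fin 4 → ℂ, ∏ i ∈ m.support, x i ^ m i = ∏ i, x i ^ m i := fun x =>
        Finset.prod_subset (Finset.subset_univ _) fun i _ hi => by
          rw [Finsupp.notMem_support_iff.1 hi, pow_zero]
      rw [e1, e1, ← Finset.prod_pow_eq_pow_sum]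
      simp only [act, mul_pow, Finset.prod_mul_distrib, pow_mul]
      ring
    rw [this, hmem.1, mul_zero]
  · intro i j hij hsub
    rw [coordPlane_subset_variety_iff s k i j hij, hP] at hsub
    simp at hsub
  · exact h (h' (self_mem_orbit _ v)).2

theorem isPrincipalPoint_iff_of_caseC (hP : containedPlanes s k = []) (l : Fin 3)
    (hl : faceExponent s k l 2 = 0) {a : Fin 4}
    (hsing : ∀ x, x ∈ singularLocus (h₁ s) (facePoly s k) ↔ ∀ i, i ≠ a → x i = 0) :
    IsPrincipalPoint (h₁ s) (facePoly s k) (faceWeight s k) v ↔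
      v ∈ variety (h₁ s) (facePoly s k) ∧ v ≠ 0 ∧ isotropy (faceWeight s k) v ≠ ⊥ ∧
        ¬ ∀ i, i ≠ a → v i = 0 := by
  have hA : ¬ CaseA (h₁ s) (facePoly s k) := fun h => (caseA_iff s k).1 h hP
  have hs : singularLocus (h₁ s) (facePoly s k) = {x | ∀ i, i ≠ a → x i = 0} := by
    ext x
    exact hsing x
  refine and_congr_right fun _ => and_congr_right fun hv0 => and_congr_right fun _ =>
    ⟨fun h hv => ?_, fun h => ⟨?_, fun hB => (not_caseB l hl hB).elim, fun _ _ h' => ?_⟩⟩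
  · refine h.2.2 hA (not_caseB l hl) ?_
    rw [hs, orbit_eq_axis (faceWeight_pos s k) hv hv0]
  · intro i j hij hsub
    rw [coordPlane_subset_variety_iff s k i j hij, hP] at hsub
    simp at hsub
  · have := self_mem_orbit (faceWeight s k) v
    rw [h', hs] at this
    exact h this.1

end Principal

/-- The Dolgachev pair of a face is determined by two integral points that represent the principal
orbits; the points in the exceptional set `E` are those excluded by the definition. -/
theorem hasDolgachevPair_iff {s : Series} {k : Fin 2} {E : (Fin 4 → ℂ) → Prop}
    (hE : ∀ v, IsPrincipalPoint (h₁ s) (facePoly s k) (faceWeight s k) v ↔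
      v ∈ variety (h₁ s) (facePoly s k) ∧ v ≠ 0 ∧ isotropy (faceWeight s k) v ≠ ⊥ ∧ ¬ E v)
    (u : Fin 2 → Fin 4 → ℤ) {m : Fin 2 → ℕ}
    (hu : (∀ r, relationValue s (u r) = 0 ∧ faceValue s k (u r) = 0 ∧
      (Finset.univ.filter fun i => u r i ≠ 0).gcd (faceWeight s k) = m r ∧ m r ≠ 1 ∧ u r ≠ 0) ∧
      ∃ i, ¬ (u 0 i = 0 ↔ u 1 i = 0))
    (huE : ∀ r, ¬ E fun i => (u r i : ℂ))
    (hall : ∀ v, relationValue s v = 0 → faceValue s k v = 0 → v ≠ 0 →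
      (∀ i j, (faceWeight s k i).Coprime (faceWeight s k j) → v i = 0 ∨ v j = 0) → ¬ E v →
      orbit (faceWeight s k) v = orbit (faceWeight s k) (fun i => (u 0 i : ℂ)) ∨
      orbit (faceWeight s k) v = orbit (faceWeight s k) (fun i => (u 1 i : ℂ)))
    (n : Sym2 ℕ) :
    HasDolgachevPair (h₁ s) (facePoly s k) n ↔ n = s(m 0, m 1) := by
  set W := faceWeight s k with hW
  have hWpos : ∀ i, 0 < W i := faceWeight_pos s k
  obtain ⟨hu, i₀, hi₀⟩ := hu
  have hcard : ∀ r, Nat.card (isotropy W fun i => (u r i : ℂ)) = m r := fun r => by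
    rw [natCard_isotropy hWpos (hu r).2.2.2.2, (hu r).2.2.1]
  have hprin : ∀ r, IsPrincipalPoint (h₁ s) (facePoly s k) W fun i => (u r i : ℂ) := fun r => by
    refine (hE _).2 ⟨mem_variety_intCast.2 ⟨(hu r).1, (hu r).2.1⟩, fun h => (hu r).2.2.2.2 ?_,
      fun h => (hu r).2.2.2.1 ?_, huE r⟩
    · funext i
      simpa using congrFun h i
    · rw [← hcard, h, Subgroup.card_bot]
  have horb : ∀ v, IsPrincipalPoint (h₁ s) (facePoly s k) W v →
      orbit W v = orbit W (fun i => (u 0 i : ℂ)) ∨ orbit W v = orbit W (fun i => (u 1 i : ℂ)) := by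
    intro v hv
    obtain ⟨h1, h2, h3, h4⟩ := (hE v).1 hv
    obtain ⟨h5, h6⟩ := mem_variety.1 h1
    exact hall v h5 h6 h2 (eq_zero_or_eq_zero_of_coprime h3) h4
  have hset : {O | ∃ v, IsPrincipalPoint (h₁ s) (facePoly s k) W v ∧ O = orbit W v} =
      {orbit W (fun i => (u 0 i : ℂ)), orbit W (fun i => (u 1 i : ℂ))} := by
    ext O
    constructor
    · rintro ⟨v, hv, rfl⟩
      exact horb v hv
    · rintro (rfl | rfl)
      · exact ⟨_, hprin 0, rfl⟩
      · exact ⟨_, hprin 1, rfl⟩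
  constructor
  · rintro ⟨w, hw, x, y, hxy, hset', rfl⟩
    obtain rfl := (isReducedWeightSystem_iff s k w).1 hw
    rw [← hW] at *
    rw [hset] at hset'
    have key : ∀ z r, orbit W z = orbit W (fun i => (u r i : ℂ)) →
        Nat.card (isotropy W z) = m r := fun z r h => by
      rw [isotropy_eq_of_orbit_eq h, hcard]
    have hx : orbit W x ∈
        ({orbit W (fun i => (u 0 i : ℂ)), orbit W (fun i => (u 1 i : ℂ))} : Set _) :=
      hset' ▸ Or.inl rfl
    have hy : orbit W y ∈
        ({orbit W (fun i => (u 0 i : ℂ)), orbit W (fun i => (u 1 i : ℂ))} : Set _) :=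
      hset' ▸ Or.inr rfl
    rcases hx with hx | hx <;> rcases hy with hy | hy
    · exact (hxy (hx.trans hy.symm)).elim
    · rw [key _ _ hx, key _ _ hy]
    · rw [key _ _ hx, key _ _ hy, Sym2.eq_swap]
    · exact (hxy (hx.trans hy.symm)).elim
  · rintro rfl
    refine ⟨W, (isReducedWeightSystem_iff s k W).2 rfl, _, _, fun h => hi₀ ?_, hset, by
      rw [hcard, hcard]⟩
    obtain ⟨t, ht⟩ : (fun i => (u 0 i : ℂ)) ∈ orbit W (fun i => (u 1 i : ℂ)) :=
      h ▸ self_mem_orbit _ _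
    have := congrFun ht i₀
    simp only [act] at this
    rw [← Int.cast_eq_zero (α := ℂ), ← Int.cast_eq_zero (α := ℂ), ← this]
    simp

/-- The Dolgachev numbers from the Dolgachev pairs of the two faces. -/
theorem hasDolgachevNumbers_iff {s : Series} {a b : Sym2 ℕ}
    (ha : ∀ n, HasDolgachevPair (h₁ s) (facePoly s 1) n ↔ n = a)
    (hb : ∀ n, HasDolgachevPair (h₁ s) (facePoly s 0) n ↔ n = b) (n : Sym2 (Sym2 ℕ)) :
    HasDolgachevNumbers s n ↔ n = s(a, b) := by
  obtain ⟨S, T, hST, hF, hS, hT⟩ := outerFaces_eq s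
  constructor
  · rintro ⟨S', T', hST', hF', a', b', ha', hb', rfl⟩
    rw [hF, Set.pair_eq_pair_iff] at hF'
    rcases hF' with ⟨rfl, rfl⟩ | ⟨rfl, rfl⟩
    · rw [hS, ha] at ha'
      rw [hT, hb] at hb'
      rw [ha', hb']
    · rw [hT, hb] at ha'
      rw [hS, ha] at hb'
      rw [ha', hb', Sym2.eq_swap]
  · rintro rfl
    exact ⟨S, T, hST, hF, a, b, by rw [hS, ha], by rw [hT, hb], rfl⟩

/-! ### Principal orbits -/

/-- Two vectors are linearly dependent if and only if their `2 × 2` minors vanish. -/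
theorem not_linearIndependent_pair_iff (f g : Fin 4 → ℂ) :
    ¬ LinearIndependent ℂ ![f, g] ↔ ∀ i j, f i * g j = f j * g i := by
  rw [LinearIndependent.pair_iff, ← not_iff_not, not_not]
  push Not
  constructor
  · intro h
    by_contra! hm
    by_cases hf : f = 0
    · have := h 1 0 (by simp [hf])
      simp at this
    · obtain ⟨i, hi⟩ := Function.ne_iff.1 hf
      have := h (g i) (-f i) (by
        funext j
        simp only [Pi.add_apply, Pi.smul_apply, smul_eq_mul, Pi.zero_apply]
        linear_combination -hm i j)
      exact hi (neg_eq_zero.1 this.2)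
  · rintro ⟨i, j, hij⟩ r t h
    have hi := congrFun h i
    have hj := congrFun h j
    simp only [Pi.add_apply, Pi.smul_apply, smul_eq_mul, Pi.zero_apply] at hi hj
    have hne := sub_ne_zero.2 hij
    constructor
    · refine (mul_eq_zero.1 ?_).resolve_right hne
      linear_combination g j * hi - g i * hj
    · refine (mul_eq_zero.1 ?_).resolve_right hne
      linear_combination f i * hj - f j * hi

theorem mem_singularLocus_iff {s : Series} {k : Fin 2} {v : Fin 4 → ℂ} :
    v ∈ singularLocus (h₁ s) (facePoly s k) ↔ (relationValue s v = 0 ∧ faceValue s k v = 0) ∧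
      ∀ i j, eval v (pderiv i (h₁ s)) * eval v (pderiv j (facePoly s k)) =
        eval v (pderiv j (h₁ s)) * eval v (pderiv i (facePoly s k)) := by
  rw [← mem_variety, ← not_linearIndependent_pair_iff]
  rfl

/-- The coordinates that vanish on the excluded exceptional orbits: those of the plane in case (A),
`z` in case (B), and those off the axis that is the singular locus in case (C). -/
def excludedCoords : Series → Fin 2 → Finset (Fin 4)
  | .J | .K => ![{1, 2, 3}, {0, 2, 3}]
  | .Kflat | .I => ![{2}, {0, 1, 3}]
  | .L => ![{1, 2, 3}, {0, 2}]
  | .Lsharp => ![{1, 2}, {0, 3}]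
  | .M => ![{0, 2, 3}, {1, 2, 3}]
  | .Msharp => ![{1, 3}, {0, 2}]

/-- Points of the two principal orbits of each face. -/
def principalPoint : Series → Fin 2 → Fin 2 → Fin 4 → ℤ
  | .J => ![![![0, 1, 0, 0], ![1, 1, 0, -1]], ![![1, 0, 0, 0], ![1, 0, 1, 0]]]
  | .K => ![![![0, 1, 0, 0], ![0, 1, -1, 0]], ![![1, 0, 0, 0], ![1, 1, 0, 1]]]
  | .Kflat | .I => ![![![0, 1, -1, 0], ![1, 0, -1, 0]], ![![1, 0, 0, 0], ![0, 1, 0, 0]]]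
  | .L => ![![![0, 1, 0, 0], ![0, 0, 0, 1]], ![![1, 0, 0, 0], ![1, 0, 0, 1]]]
  | .Lsharp => ![![![1, 0, -1, 0], ![0, 1, 0, 0]], ![![1, 0, 0, 0], ![0, 0, 0, 1]]]
  | .M => ![![![1, 0, 0, 0], ![1, 1, 0, -1]], ![![0, 1, 0, 0], ![0, 1, 1, 0]]]
  | .Msharp => ![![![0, 1, 0, 0], ![0, 0, 0, 1]], ![![1, 0, 0, 0], ![0, 1, 1, 0]]]

/-- A coordinate of the principal points that is equal to `1` and whose weight divides the weights
of the other nonzero coordinates. -/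
def pivot : Series → Fin 2 → Fin 2 → Fin 4
  | .J => ![![1, 0], ![0, 0]]
  | .K => ![![1, 1], ![0, 0]]
  | .Kflat | .I => ![![1, 0], ![0, 1]]
  | .L => ![![1, 3], ![0, 0]]
  | .Lsharp => ![![0, 1], ![0, 3]]
  | .M => ![![0, 0], ![1, 2]]
  | .Msharp => ![![1, 3], ![0, 1]]

/-- The orders of the isotropy groups of the principal orbits. -/
def isotropyOrder : Series → Fin 2 → Fin 2 → ℕ
  | .J => ![![6, 2], ![2, 2]]
  | .K => ![![4, 4], ![2, 2]]
  | .Kflat => ![![4, 2], ![2, 4]]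
  | .L => ![![5, 3], ![2, 2]]
  | .Lsharp => ![![2, 5], ![2, 3]]
  | .M => ![![3, 3], ![4, 2]]
  | .Msharp => ![![4, 3], ![2, 3]]
  | .I => ![![3, 3], ![3, 3]]

set_option maxHeartbeats 2000000 in
/-- In case (C), the singular locus is a coordinate axis. -/
theorem mem_singularLocus_iff_of_caseC (s : Series) (k : Fin 2) (hA : containedPlanes s k = [])
    (hB : ∃ l, faceExponent s k l 2 = 0) (v : Fin 4 → ℂ) :
    v ∈ singularLocus (h₁ s) (facePoly s k) ↔ ∀ i ∈ excludedCoords s k, v i = 0 := by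
  rw [mem_singularLocus_iff]
  revert hA hB
  cases s <;> fin_cases k <;> intro hA hB <;>
    first
    | exact absurd hA (by decide)
    | exact absurd hB (by decide)
    | simp [Fin.forall_fin_succ, h₁, factorA, facePoly, faceCoeff, faceExponent, termCoeff,
        termExponent, Fin.succAbove, Fin.sum_univ_three, mon_eq_prod, pderiv_X, Pi.single_apply,
        relationValue, faceValue, relationExponent, Fin.prod_univ_four, excludedCoords]
      rcases eq_or_ne (v 0) 0 with hx | hx <;> rcases eq_or_ne (v 1) 0 with hy | hy <;>
        simp only [hx, hy] <;> constructor <;> grind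

theorem caseB_of_faceExponent_ne_zero {s : Series} {k : Fin 2}
    (h : relationExponent s 2 = 0 ∧ ∀ l, faceExponent s k l 2 ≠ 0 ∧ faceExponent s k l 3 = 0) :
    CaseB (h₁ s) (facePoly s k) := by
  classical
  refine ⟨fun hmem => ?_,
    ∑ l, (faceCoeff s k l : ℂ) • mon (Function.update (faceExponent s k l) 2
      (faceExponent s k l 2 - 1)), fun hmem => ?_, ?_⟩
  · obtain ⟨d, hd, hd2⟩ := (mem_vars_iff_mem_support _).1 hmem
    rw [h₁_eq, support_mon_sub_mon (relationExponent_ne s), Finset.mem_insert,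
      Finset.mem_singleton] at hd
    rcases hd with rfl | rfl <;> simp [h.1] at hd2
  · obtain ⟨d, hd, hd3⟩ := (mem_vars_iff_mem_support _).1 hmem
    rw [mem_support_iff, coeff_sum] at hd
    obtain ⟨l, -, hl⟩ := Finset.exists_ne_zero_of_sum_ne_zero hd
    rw [mon, coeff_smul, coeff_monomial] at hl
    split_ifs at hl with hd'
    · rw [← hd'] at hd3
      simp [(h.2 l).2] at hd3
    · simp at hl
  · rw [facePoly, Finset.mul_sum]
    refine Finset.sum_congr rfl fun l _ => ?_
    rw [mul_smul_comm, mon_eq_prod, mon_eq_prod]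
    obtain ⟨m, hm⟩ := Nat.exists_eq_succ_of_ne_zero (h.2 l).1
    simp [hm]
    congr 1
    ring

/-- A uniform description of the principal points in the cases (A), (B), (C). -/
theorem isPrincipalPoint_iff (s : Series) (k : Fin 2) (v : Fin 4 → ℂ) :
    IsPrincipalPoint (h₁ s) (facePoly s k) (faceWeight s k) v ↔
      v ∈ variety (h₁ s) (facePoly s k) ∧ v ≠ 0 ∧ isotropy (faceWeight s k) v ≠ ⊥ ∧
        ¬ ∀ i ∈ excludedCoords s k, v i = 0 := by
  by_cases hA : containedPlanes s k = []
  · by_cases hB : ∃ l, faceExponent s k l 2 = 0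
    · have hsing := mem_singularLocus_iff_of_caseC s k hA hB
      obtain ⟨a, ha⟩ : ∃ a : Fin 4, excludedCoords s k = {a}ᶜ := by
        clear hsing
        revert hA hB
        cases s <;> fin_cases k <;> decide +kernel
      obtain ⟨l, hl⟩ := hB
      simp only [ha, Finset.mem_compl, Finset.mem_singleton] at hsing ⊢
      exact isPrincipalPoint_iff_of_caseC hA l hl hsing
    · have hB' : (relationExponent s 2 = 0 ∧
          ∀ l, faceExponent s k l 2 ≠ 0 ∧ faceExponent s k l 3 = 0) ∧ excludedCoords s k = {2} := by
        revert hA hB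
        cases s <;> fin_cases k <;> decide +kernel
      rw [isPrincipalPoint_iff_of_caseB hA (caseB_of_faceExponent_ne_zero hB'.1), hB'.2]
      simp
  · obtain ⟨i, j, hij, hP, hE, l, hl⟩ : ∃ i j, i ≠ j ∧ containedPlanes s k = [(i, j), (j, i)] ∧
        excludedCoords s k = {i, j} ∧ ∃ l, faceExponent s k l 2 = 0 := by
      revert hA
      cases s <;> fin_cases k <;> decide +kernel
    rw [isPrincipalPoint_iff_of_caseA hij hP l hl, hE]
    simp

set_option maxHeartbeats 2000000 in
/-- A point of the variety of a face with non-trivial isotropy group that is not excluded lies on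
one of the two principal orbits; its coordinates are read off from the one at the pivot. -/
theorem exists_eq_mul_pow {s : Series} {k : Fin 2} {v : Fin 4 → ℂ} (h1 : relationValue s v = 0)
    (h2 : faceValue s k v = 0) (h0 : v ≠ 0)
    (h3 : ∀ i j, (faceWeight s k i).Coprime (faceWeight s k j) → v i = 0 ∨ v j = 0)
    (h4 : ¬ ∀ i ∈ excludedCoords s k, v i = 0) :
    ∃ r, v (pivot s k r) ≠ 0 ∧ ∀ i, v i = principalPoint s k r i *
      v (pivot s k r) ^ (faceWeight s k i / faceWeight s k (pivot s k r)) := by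
  revert h1 h2 h3 h4
  rw [Fin.exists_fin_two, ne_eq, funext_iff] at *
  cases s <;> fin_cases k <;>
  · simp [Fin.forall_fin_succ, faceCoeff, faceExponent, termCoeff,
        termExponent, Fin.succAbove, Fin.sum_univ_three, pivot, principalPoint, faceWeight,
        relationValue, faceValue, relationExponent, Fin.prod_univ_four, excludedCoords] at h0 ⊢
    rcases eq_or_ne (v 0) 0 with hx | hx <;> rcases eq_or_ne (v 1) 0 with hy | hy <;>
      simp [hx, hy] at h0 ⊢ <;> grind

theorem hasDolgachevPair_facePoly_iff (s : Series) (k : Fin 2) (n : Sym2 ℕ) :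
    HasDolgachevPair (h₁ s) (facePoly s k) n ↔
      n = s(isotropyOrder s k 0, isotropyOrder s k 1) := by
  have hpt : ((∀ r, relationValue s (principalPoint s k r) = 0 ∧
      faceValue s k (principalPoint s k r) = 0 ∧
      (Finset.univ.filter fun i => principalPoint s k r i ≠ 0).gcd (faceWeight s k) =
        isotropyOrder s k r ∧ isotropyOrder s k r ≠ 1 ∧ principalPoint s k r ≠ 0) ∧
      ∃ i, ¬ (principalPoint s k 0 i = 0 ↔ principalPoint s k 1 i = 0)) ∧
      (∀ r, ¬ ∀ i ∈ excludedCoords s k, principalPoint s k r i = 0) ∧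
      ∀ r i, principalPoint s k r i ≠ 0 → faceWeight s k (pivot s k r) ∣ faceWeight s k i := by
    cases s <;> fin_cases k <;> decide +kernel
  refine hasDolgachevPair_iff (isPrincipalPoint_iff s k) (principalPoint s k) hpt.1
    (fun r => by simpa using hpt.2.1 r) (fun v h1 h2 h0 h3 h4 => ?_) n
  rw [← Fin.exists_fin_two
    (p := fun r => orbit (faceWeight s k) v = orbit _ fun i => (principalPoint s k r i : ℂ))]
  obtain ⟨r, hne, hr⟩ := exists_eq_mul_pow h1 h2 h0 h3 h4
  refine ⟨r, orbit_eq_of_forall_pow (faceWeight_pos s k) (pivot s k r) hne fun t ht i => ?_⟩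
  rw [hr i, ← ht, ← pow_mul]
  by_cases h : principalPoint s k r i = 0
  · simp [h]
  · rw [Nat.mul_div_cancel' (hpt.2.2 r i h), mul_comm]

/-! ### Contact maps and approximate arcs -/

/-- `𝒦`-equivalence solved for the second pair of equations: `G = P · (F ∘ φ)`, where `A` is the
derivative of `φ` at the origin. -/
def IsContactMap (A : (Fin 4 → ℂ) ≃L[ℂ] (Fin 4 → ℂ)) (F G : Fin 2 → Poly4) : Prop :=
  ∃ (φ : (Fin 4 → ℂ) → Fin 4 → ℂ) (P : (Fin 4 → ℂ) → Matrix (Fin 2) (Fin 2) ℂ),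
    AnalyticAt ℂ φ 0 ∧ φ 0 = 0 ∧ HasFDerivAt φ (A : (Fin 4 → ℂ) →L[ℂ] (Fin 4 → ℂ)) 0 ∧
    (∀ i j, AnalyticAt ℂ (fun v => P v i j) 0) ∧ (P 0).det ≠ 0 ∧
    ∀ᶠ v in 𝓝 0, (fun k => eval v (G k)) = (P v).mulVec fun k => eval (φ v) (F k)

theorem analyticAt_det {E : Type*} [NormedAddCommGroup E] [NormedSpace ℂ E]
    {N : E → Matrix (Fin 2) (Fin 2) ℂ} {e : E} (hN : ∀ i j, AnalyticAt ℂ (fun v => N v i j) e) :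
    AnalyticAt ℂ (fun v => (N v).det) e := by
  simp only [Matrix.det_fin_two]
  exact ((hN 0 0).mul (hN 1 1)).sub ((hN 0 1).mul (hN 1 0))

theorem analyticAt_matrix_inv {E : Type*} [NormedAddCommGroup E] [NormedSpace ℂ E]
    {N : E → Matrix (Fin 2) (Fin 2) ℂ} {e : E} (hN : ∀ i j, AnalyticAt ℂ (fun v => N v i j) e)
    (hdet : (N e).det ≠ 0) (i j : Fin 2) : AnalyticAt ℂ (fun v => (N v)⁻¹ i j) e := by
  have hd := (analyticAt_det hN).inv hdet
  have hadj : AnalyticAt ℂ (fun v => (N v).adjugate i j) e := by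
    simp only [Matrix.adjugate_fin_two]
    fin_cases i <;> fin_cases j
    · exact hN 1 1
    · exact (hN 0 1).neg
    · exact (hN 1 0).neg
    · exact hN 0 0
  refine (hd.mul hadj).congr (Eventually.of_forall fun v => ?_)
  simp [Matrix.inv_def, Ring.inverse_eq_inv']

theorem eventually_mulVec_inv {E : Type*} [NormedAddCommGroup E] [NormedSpace ℂ E]
    {N : E → Matrix (Fin 2) (Fin 2) ℂ} {e : E} (hN : ∀ i j, AnalyticAt ℂ (fun v => N v i j) e)
    (hdet : (N e).det ≠ 0) :
    ∀ᶠ v in 𝓝 e, ∀ x y : Fin 2 → ℂ, x = (N v).mulVec y → y = (N v)⁻¹.mulVec x := by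
  filter_upwards [(analyticAt_det hN).continuousAt.eventually_ne hdet] with v hv x y h
  rw [h, Matrix.mulVec_mulVec, Matrix.nonsing_inv_mul _ (isUnit_iff_ne_zero.2 hv),
    Matrix.one_mulVec]

theorem det_inv_ne_zero {M : Matrix (Fin 2) (Fin 2) ℂ} (h : M.det ≠ 0) : M⁻¹.det ≠ 0 := by
  rw [Matrix.det_nonsing_inv, Ring.inverse_eq_inv']
  exact inv_ne_zero h

theorem KEquivalent.exists_isContactMap {F G : Fin 2 → Poly4} (h : KEquivalent F G) :
    ∃ A, IsContactMap A F G := by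
  obtain ⟨φ, N, hφ, hφ0, hbij, hN, hdet, heq⟩ := h
  refine ⟨ContinuousLinearEquiv.ofBijective (fderiv ℂ φ 0) (LinearMap.ker_eq_bot.2 hbij.1)
    (LinearMap.range_eq_top.2 hbij.2), φ, fun v => (N v)⁻¹, hφ, hφ0, ?_,
    analyticAt_matrix_inv hN hdet, det_inv_ne_zero hdet, ?_⟩
  · exact hφ.differentiableAt.hasFDerivAt
  · filter_upwards [heq, eventually_mulVec_inv hN hdet] with v h1 h2
    exact h2 _ _ h1

theorem exists_analyticAt_localInverse {φ : (Fin 4 → ℂ) → Fin 4 → ℂ} (hφ : AnalyticAt ℂ φ 0)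
    (hφ0 : φ 0 = 0) {A : (Fin 4 → ℂ) ≃L[ℂ] (Fin 4 → ℂ)}
    (hA : HasFDerivAt φ (A : (Fin 4 → ℂ) →L[ℂ] (Fin 4 → ℂ)) 0) :
    ∃ ψ : (Fin 4 → ℂ) → Fin 4 → ℂ, AnalyticAt ℂ ψ 0 ∧ ψ 0 = 0 ∧
      HasFDerivAt ψ (A.symm : (Fin 4 → ℂ) →L[ℂ] (Fin 4 → ℂ)) 0 ∧ ∀ᶠ v in 𝓝 0, φ (ψ v) = v := by
  obtain ⟨ψ, hψ, hψ0, heq⟩ := exists_analyticAt_implicit (E := Fin 4 → ℂ) (U := Fin 4 → ℂ)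
    (V := Fin 4 → ℂ) rfl (H := fun p => φ p.2 - p.1) (e₀ := 0) (u₀ := 0)
    ((AnalyticAt.comp_of_eq (f := fun p : (Fin 4 → ℂ) × (Fin 4 → ℂ) => p.2) (x := (0, 0)) hφ
      analyticAt_snd rfl).sub analyticAt_fst) (by simp [hφ0])
    fun du h => by
      have h1 : HasDerivAt (fun s : ℂ => (0 : Fin 4 → ℂ) + s • du) du 0 := by
        simpa using (hasDerivAt_id (0 : ℂ)).smul_const du
      have h2 : HasDerivAt (fun s : ℂ => φ (0 + s • du)) (A du) 0 := by
        refine HasFDerivAt.comp_hasDerivAt (0 : ℂ) (l := φ)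
          (l' := (A : (Fin 4 → ℂ) →L[ℂ] (Fin 4 → ℂ))) ?_ h1
        simpa using hA
      have h3 : HasDerivAt (fun s : ℂ => φ (0 + s • du)) 0 0 := by simpa using h
      exact (map_eq_zero_iff A A.injective).1 (h2.unique h3)
  have hinv : ∀ᶠ v in 𝓝 0, φ (ψ v) = v := heq.mono fun v hv => sub_eq_zero.1 hv
  refine ⟨ψ, hψ, hψ0, ?_, hinv⟩
  have hd := hψ.differentiableAt.hasFDerivAt
  have hcomp := HasFDerivAt.comp (0 : Fin 4 → ℂ) (f := ψ) (g := φ) (by rwa [hψ0]) hd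
  have huniq := hcomp.unique ((hasFDerivAt_id (0 : Fin 4 → ℂ)).congr_of_eventuallyEq hinv)
  have hsymm : (A.symm : (Fin 4 → ℂ) →L[ℂ] (Fin 4 → ℂ)) = fderiv ℂ ψ 0 :=
    ContinuousLinearMap.ext fun x => (A.symm_apply_eq).2
      (congrArg (fun D : (Fin 4 → ℂ) →L[ℂ] (Fin 4 → ℂ) => D x) huniq).symm
  rwa [hsymm]

theorem IsContactMap.symm {A : (Fin 4 → ℂ) ≃L[ℂ] (Fin 4 → ℂ)} {F G : Fin 2 → Poly4}
    (h : IsContactMap A F G) : IsContactMap A.symm G F := by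
  obtain ⟨φ, P, hφ, hφ0, hA, hP, hdet, heq⟩ := h
  obtain ⟨ψ, hψ, hψ0, hA', hinv⟩ := exists_analyticAt_localInverse hφ hφ0 hA
  have hPψ : ∀ i j, AnalyticAt ℂ (fun v => P (ψ v) i j) 0 := fun i j =>
    AnalyticAt.fun_comp (g := fun v => P v i j) (by rw [hψ0]; exact hP i j) hψ
  have hdet' : (P (ψ 0)).det ≠ 0 := by rwa [hψ0]
  have hlim : Tendsto ψ (𝓝 0) (𝓝 0) := by
    have := hψ.continuousAt.tendsto
    rwa [hψ0] at this
  refine ⟨ψ, fun v => (P (ψ v))⁻¹, hψ, hψ0, hA', analyticAt_matrix_inv hPψ hdet',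
    det_inv_ne_zero hdet', ?_⟩
  filter_upwards [hinv, hlim.eventually heq, eventually_mulVec_inv hPψ hdet'] with v h1 h2 h3
  rw [h1] at h2
  exact h3 _ _ h2

/-- `v t = t d + o(t)` as `t → 0`. -/
def IsArc (v : ℂ → Fin 4 → ℂ) (d : Fin 4 → ℂ) : Prop :=
  (fun t => v t - t • d) =o[𝓝[≠] 0] fun t : ℂ => t

theorem IsArc.isBigO {v : ℂ → Fin 4 → ℂ} {d : Fin 4 → ℂ} (h : IsArc v d) :
    v =O[𝓝[≠] 0] fun t : ℂ => t := by
  have : (fun t : ℂ => t • d) =O[𝓝[≠] 0] fun t : ℂ => t :=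
    Asymptotics.IsBigO.of_bound ‖d‖ (Eventually.of_forall fun t => by rw [norm_smul, mul_comm])
  exact (Asymptotics.IsLittleO.isBigO h |>.add this).congr_left fun t => sub_add_cancel _ _

theorem tendsto_id_punctured : Tendsto (fun t : ℂ => t) (𝓝[≠] 0) (𝓝 0) :=
  tendsto_id.mono_left nhdsWithin_le_nhds

theorem IsArc.tendsto {v : ℂ → Fin 4 → ℂ} {d : Fin 4 → ℂ} (h : IsArc v d) :
    Tendsto v (𝓝[≠] 0) (𝓝 0) :=
  h.isBigO.trans_tendsto tendsto_id_punctured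

theorem IsArc.comp {v : ℂ → Fin 4 → ℂ} {d : Fin 4 → ℂ} (h : IsArc v d)
    {ψ : (Fin 4 → ℂ) → Fin 4 → ℂ} (hψ0 : ψ 0 = 0) {A : (Fin 4 → ℂ) →L[ℂ] (Fin 4 → ℂ)}
    (hA : HasFDerivAt ψ A 0) : IsArc (fun t => ψ (v t)) (A d) := by
  have h1 := (hA.isLittleO.comp_tendsto h.tendsto).trans_isBigO
    (h.isBigO.congr_left fun t => (sub_zero (v t)).symm)
  have h2 := (A.isBigO_comp (fun t => v t - t • d) (𝓝[≠] (0 : ℂ))).trans_isLittleO h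
  refine (h1.add h2).congr_left fun t => ?_
  simp [hψ0]

/-- The `2 × 2` minors of the Jacobian matrix. -/
def jacobianMinor (F : Fin 2 → Poly4) (i j : Fin 4) : Poly4 :=
  pderiv i (F 0) * pderiv j (F 1) - pderiv j (F 0) * pderiv i (F 1)

/-- The directions of the arcs along which `F` vanishes to order `k`. -/
def zeroDirections (k : ℕ) (F : Fin 2 → Poly4) : Set (Fin 4 → ℂ) :=
  {d | ∃ v, IsArc v d ∧ ∀ l, (fun t => eval (v t) (F l)) =O[𝓝[≠] 0] fun t : ℂ => t ^ k}

/-- The directions of the arcs along which both `F` and the Jacobian minors vanish to order `k`. -/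
def singularDirections (k : ℕ) (F : Fin 2 → Poly4) : Set (Fin 4 → ℂ) :=
  {d | ∃ v, IsArc v d ∧ (∀ l, (fun t => eval (v t) (F l)) =O[𝓝[≠] 0] fun t : ℂ => t ^ k) ∧
    ∀ i j, (fun t => eval (v t) (jacobianMinor F i j)) =O[𝓝[≠] 0] fun t : ℂ => t ^ k}

theorem one_mul_isBigO {f g h : ℂ → ℂ} {l : Filter ℂ} (hf : f =O[l] fun _ => (1 : ℂ))
    (hg : g =O[l] h) : (fun t => f t * g t) =O[l] h :=
  (hf.mul hg).congr_right fun t => one_mul (h t)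

section Pull

variable {F G : Fin 2 → Poly4} {φ : (Fin 4 → ℂ) → Fin 4 → ℂ}
  {P : (Fin 4 → ℂ) → Matrix (Fin 2) (Fin 2) ℂ} {v : ℂ → Fin 4 → ℂ} {k : ℕ}

theorem isBigO_one_of_analyticAt {g : (Fin 4 → ℂ) → ℂ} (hg : AnalyticAt ℂ g 0)
    (hv : Tendsto v (𝓝[≠] 0) (𝓝 0)) : (fun t => g (v t)) =O[𝓝[≠] 0] fun _ : ℂ => (1 : ℂ) :=
  (hg.continuousAt.tendsto.comp hv).isBigO_one ℂ

theorem isBigO_pull (hP : ∀ i j, AnalyticAt ℂ (fun v => P v i j) 0)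
    (heq : ∀ᶠ v in 𝓝 0, (fun k => eval v (G k)) = (P v).mulVec fun k => eval (φ v) (F k))
    (hv : Tendsto v (𝓝[≠] 0) (𝓝 0))
    (hF : ∀ l, (fun t => eval (φ (v t)) (F l)) =O[𝓝[≠] 0] fun t : ℂ => t ^ k) (l : Fin 2) :
    (fun t => eval (v t) (G l)) =O[𝓝[≠] 0] fun t : ℂ => t ^ k := by
  have h : ∀ m, (fun t => P (v t) l m * eval (φ (v t)) (F m)) =O[𝓝[≠] 0] fun t : ℂ => t ^ k :=
    fun m => one_mul_isBigO (isBigO_one_of_analyticAt (hP l m) hv) (hF m)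
  refine ((h 0).add (h 1)).congr' ?_ EventuallyEq.rfl
  filter_upwards [hv.eventually heq] with t ht
  have := congrFun ht l
  simp only [Matrix.mulVec, dotProduct, Fin.sum_univ_two] at this
  exact this.symm

/-- The partial derivatives of `G = P · (F ∘ φ)`. -/
theorem eval_pderiv_pull (hφ : AnalyticAt ℂ φ 0) (hP : ∀ i j, AnalyticAt ℂ (fun v => P v i j) 0)
    (heq : ∀ᶠ v in 𝓝 0, (fun k => eval v (G k)) = (P v).mulVec fun k => eval (φ v) (F k)) :
    ∀ᶠ v in 𝓝 0, ∀ l i, eval v (pderiv i (G l)) =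
      ∑ m, P v l m * ∑ j, eval (φ v) (pderiv j (F m)) * fderiv ℂ φ v (Pi.single i 1) j +
      ∑ m, fderiv ℂ (fun v => P v l m) v (Pi.single i 1) * eval (φ v) (F m) := by
  have hP' : ∀ᶠ v in 𝓝 0, ∀ i j, AnalyticAt ℂ (fun v => P v i j) v :=
    eventually_all.2 fun i => eventually_all.2 fun j => (hP i j).eventually_analyticAt
  filter_upwards [heq.eventually_nhds, hφ.eventually_analyticAt, hP'] with v h1 h2 h3 l i
  have hF : ∀ m, HasFDerivAt (fun v => eval (φ v) (F m)) _ v := fun m =>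
    (hasFDerivAt_eval (F m) (φ v)).comp v h2.differentiableAt.hasFDerivAt
  have hR := HasFDerivAt.fun_sum (u := Finset.univ) fun m (_ : m ∈ Finset.univ) =>
    (h3 l m).differentiableAt.hasFDerivAt.mul (hF m)
  have hL := hasFDerivAt_eval (G l) v
  have hcongr : (fun v => eval v (G l)) =ᶠ[𝓝 v]
      fun v => ∑ m, P v l m * eval (φ v) (F m) := by
    filter_upwards [h1] with x hx
    exact congrFun hx l
  have := congrArg (fun D : (Fin 4 → ℂ) →L[ℂ] ℂ => D (Pi.single i 1))
    (hL.unique (hR.congr_of_eventuallyEq hcongr))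
  simp [Pi.single_apply] at this
  rw [this]
  simp only [← Finset.sum_add_distrib]
  simp [Fin.sum_univ_two]
  ring

/-- The Jacobian minors of `G = P · (F ∘ φ)` are combinations of those of `F` and of `F` itself, so
they vanish to the same order. -/
theorem isBigO_jacobianMinor_pull (hφ : AnalyticAt ℂ φ 0)
    (hP : ∀ i j, AnalyticAt ℂ (fun v => P v i j) 0)
    (heq : ∀ᶠ v in 𝓝 0, (fun k => eval v (G k)) = (P v).mulVec fun k => eval (φ v) (F k))
    (hv : Tendsto v (𝓝[≠] 0) (𝓝 0))
    (hF : ∀ l, (fun t => eval (φ (v t)) (F l)) =O[𝓝[≠] 0] fun t : ℂ => t ^ k)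
    (hM : ∀ i j, (fun t => eval (φ (v t)) (jacobianMinor F i j)) =O[𝓝[≠] 0] fun t : ℂ => t ^ k)
    (i i' : Fin 4) :
    (fun t => eval (v t) (jacobianMinor G i i')) =O[𝓝[≠] 0] fun t : ℂ => t ^ k := by
  have hPv : ∀ l m, (fun t => P (v t) l m) =O[𝓝[≠] 0] fun _ : ℂ => (1 : ℂ) := fun l m =>
    isBigO_one_of_analyticAt (hP l m) hv
  have hφv : ∀ i j, (fun t => fderiv ℂ φ (v t) (Pi.single i 1) j) =O[𝓝[≠] 0]
      fun _ : ℂ => (1 : ℂ) := fun i j => by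
    have hcont : ContinuousAt (fun x => fderiv ℂ φ x (Pi.single i 1) j) 0 :=
      (continuous_apply j).continuousAt.comp (hφ.fderiv.continuousAt.clm_apply continuousAt_const)
    exact (hcont.tendsto.comp hv).isBigO_one ℂ
  have hdP : ∀ l m i, (fun t => fderiv ℂ (fun v => P v l m) (v t) (Pi.single i 1)) =O[𝓝[≠] 0]
      fun _ : ℂ => (1 : ℂ) := fun l m i =>
    (((hP l m).fderiv.continuousAt.clm_apply continuousAt_const).tendsto.comp hv).isBigO_one ℂ
  have hdF : ∀ m j, (fun t => eval (φ (v t)) (pderiv j (F m))) =O[𝓝[≠] 0]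
      fun _ : ℂ => (1 : ℂ) := fun m j =>
    isBigO_one_of_analyticAt (g := fun v => eval (φ v) (pderiv j (F m)))
      (AnalyticAt.fun_comp (g := fun u => eval u (pderiv j (F m))) (analyticAt_eval _ _) hφ) hv
  -- the main terms of the partial derivatives, and the errors, which contain `F` itself
  set R : Fin 2 → Fin 4 → ℂ → ℂ := fun l i t => ∑ m, P (v t) l m *
    ∑ j, eval (φ (v t)) (pderiv j (F m)) * fderiv ℂ φ (v t) (Pi.single i 1) j with hRdef
  set S : Fin 2 → Fin 4 → ℂ → ℂ := fun l i t =>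
    ∑ m, fderiv ℂ (fun v => P v l m) (v t) (Pi.single i 1) * eval (φ (v t)) (F m) with hSdef
  have hR : ∀ l i, R l i =O[𝓝[≠] 0] fun _ : ℂ => (1 : ℂ) := fun l i =>
    Asymptotics.IsBigO.fun_sum fun m _ =>
      one_mul_isBigO (hPv l m) (Asymptotics.IsBigO.fun_sum fun j _ =>
        one_mul_isBigO (hdF m j) (hφv i j))
  have hS : ∀ l i, S l i =O[𝓝[≠] 0] fun t : ℂ => t ^ k := fun l i =>
    Asymptotics.IsBigO.fun_sum fun m _ => one_mul_isBigO (hdP l m i) (hF m)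
  have hS1 : ∀ l i, S l i =O[𝓝[≠] 0] fun _ : ℂ => (1 : ℂ) := fun l i => (hS l i).trans
    (((continuous_pow k).tendsto (0 : ℂ)).comp tendsto_id_punctured |>.isBigO_one ℂ)
  have hmain : (fun t => R 0 i t * R 1 i' t - R 0 i' t * R 1 i t) =O[𝓝[≠] 0]
      fun t : ℂ => t ^ k := by
    have : ∀ t, R 0 i t * R 1 i' t - R 0 i' t * R 1 i t =
        (P (v t) 0 0 * P (v t) 1 1 - P (v t) 0 1 * P (v t) 1 0) *
          ∑ j, ∑ j', fderiv ℂ φ (v t) (Pi.single i 1) j * fderiv ℂ φ (v t) (Pi.single i' 1) j' *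
            eval (φ (v t)) (jacobianMinor F j j') := fun t => by
      simp only [hRdef, jacobianMinor, map_sub, map_mul, Fin.sum_univ_two, Fin.sum_univ_four]
      ring
    simp only [this]
    have hsum : (fun t => ∑ j, ∑ j', fderiv ℂ φ (v t) (Pi.single i 1) j *
        fderiv ℂ φ (v t) (Pi.single i' 1) j' * eval (φ (v t)) (jacobianMinor F j j'))
        =O[𝓝[≠] 0] fun t : ℂ => t ^ k :=
      Asymptotics.IsBigO.fun_sum fun j _ => Asymptotics.IsBigO.fun_sum fun j' _ =>
        one_mul_isBigO (one_mul_isBigO (hφv i j) (hφv i' j')) (hM j j')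
    exact one_mul_isBigO ((one_mul_isBigO (hPv 0 0) (hPv 1 1)).sub
      (one_mul_isBigO (hPv 0 1) (hPv 1 0))) hsum
  have herr : (fun t => (R 0 i t * S 1 i' t + S 0 i t * R 1 i' t + S 0 i t * S 1 i' t) -
      (R 0 i' t * S 1 i t + S 0 i' t * R 1 i t + S 0 i' t * S 1 i t)) =O[𝓝[≠] 0]
        fun t : ℂ => t ^ k := by
    have key : ∀ i i', (fun t => R 0 i t * S 1 i' t + S 0 i t * R 1 i' t + S 0 i t * S 1 i' t)
        =O[𝓝[≠] 0] fun t : ℂ => t ^ k := fun i i' =>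
      ((one_mul_isBigO (hR 0 i) (hS 1 i')).add
        ((one_mul_isBigO (hR 1 i') (hS 0 i)).congr_left fun t => mul_comm _ _)).add
        (one_mul_isBigO (hS1 0 i) (hS 1 i'))
    exact (key i i').sub (key i' i)
  refine (hmain.add herr).congr' ?_ EventuallyEq.rfl
  filter_upwards [hv.eventually (eval_pderiv_pull hφ hP heq)] with t ht
  simp only [jacobianMinor, map_sub, map_mul, ht]
  simp only [hRdef, hSdef]
  ring

end Pull

theorem IsContactMap.symm_mem_zeroDirections {A : (Fin 4 → ℂ) ≃L[ℂ] (Fin 4 → ℂ)}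
    {F G : Fin 2 → Poly4} (h : IsContactMap A F G) {k : ℕ} {d : Fin 4 → ℂ}
    (hd : d ∈ zeroDirections k F) : A.symm d ∈ zeroDirections k G := by
  obtain ⟨φ, P, hφ, hφ0, hA, hP, -, heq⟩ := h
  obtain ⟨ψ, hψ, hψ0, hA', hinv⟩ := exists_analyticAt_localInverse hφ hφ0 hA
  obtain ⟨v, hv, hF⟩ := hd
  have hv' := hv.comp hψ0 hA'
  refine ⟨_, hv', isBigO_pull hP heq hv'.tendsto fun l => (hF l).congr' ?_ EventuallyEq.rfl⟩
  filter_upwards [hv.tendsto.eventually hinv] with t ht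
  rw [ht]

theorem IsContactMap.symm_mem_singularDirections {A : (Fin 4 → ℂ) ≃L[ℂ] (Fin 4 → ℂ)}
    {F G : Fin 2 → Poly4} (h : IsContactMap A F G) {k : ℕ} {d : Fin 4 → ℂ}
    (hd : d ∈ singularDirections k F) : A.symm d ∈ singularDirections k G := by
  obtain ⟨φ, P, hφ, hφ0, hA, hP, -, heq⟩ := h
  obtain ⟨ψ, hψ, hψ0, hA', hinv⟩ := exists_analyticAt_localInverse hφ hφ0 hA
  obtain ⟨v, hv, hF, hM⟩ := hd
  have hv' := hv.comp hψ0 hA'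
  have hφψ : ∀ᶠ t in 𝓝[≠] (0 : ℂ), v t = φ (ψ (v t)) := by
    filter_upwards [hv.tendsto.eventually hinv] with t ht using ht.symm
  have hF' : ∀ l, (fun t => eval (φ (ψ (v t))) (F l)) =O[𝓝[≠] 0] fun t : ℂ => t ^ k := fun l =>
    (hF l).congr' (hφψ.mono fun t ht => by dsimp only; rw [← ht]) EventuallyEq.rfl
  refine ⟨_, hv', isBigO_pull hP heq hv'.tendsto hF', isBigO_jacobianMinor_pull hφ hP heq
    hv'.tendsto hF' fun i j => (hM i j).congr' (hφψ.mono fun t ht => by dsimp only; rw [← ht])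
      EventuallyEq.rfl⟩

/-- The property that the equations have no terms of order less than two is invariant. -/
theorem IsContactMap.isBigO_sq {A : (Fin 4 → ℂ) ≃L[ℂ] (Fin 4 → ℂ)}
    {F G : Fin 2 → Poly4} (h : IsContactMap A F G)
    (hF : ∀ l, (fun v => eval v (F l)) =O[𝓝 0] fun v => ‖v‖ ^ 2) (l : Fin 2) :
    (fun v => eval v (G l)) =O[𝓝 0] fun v => ‖v‖ ^ 2 := by
  obtain ⟨φ, P, hφ, hφ0, hA, hP, -, heq⟩ := h
  have hlim : Tendsto φ (𝓝 0) (𝓝 0) := by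
    have := hφ.continuousAt.tendsto
    rwa [hφ0] at this
  have hO : φ =O[𝓝 0] fun v => v := by
    simpa [hφ0] using hA.isBigO_sub
  have h1 : ∀ m, (fun v => P v l m * eval (φ v) (F m)) =O[𝓝 0] fun v => ‖v‖ ^ 2 := fun m => by
    have h2 : (fun v => eval (φ v) (F m)) =O[𝓝 0] fun v => ‖v‖ ^ 2 :=
      ((hF m).comp_tendsto hlim).trans (hO.norm_norm.pow 2)
    simpa using ((hP l m).continuousAt.tendsto.isBigO_one ℝ).mul h2
  refine ((h1 0).add (h1 1)).congr' ?_ EventuallyEq.rfl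
  filter_upwards [heq] with v hv
  have := congrFun hv l
  simp only [Matrix.mulVec, dotProduct, Fin.sum_univ_two] at this
  exact this.symm

/-! ### Arcs of the cusp singularities -/

theorem frequently_pow_ne_zero (n : ℕ) : ∃ᶠ t : ℂ in 𝓝[≠] 0, t ^ n ≠ 0 := by
  have : ∀ᶠ t : ℂ in 𝓝[≠] 0, t ^ n ≠ 0 := by
    filter_upwards [self_mem_nhdsWithin] with t ht using pow_ne_zero _ ht
  exact this.frequently

theorem le_of_isBigO_pow {m n : ℕ}
    (h : (fun t : ℂ => t ^ m) =O[𝓝[≠] 0] fun t : ℂ => t ^ n) : n ≤ m := by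
  by_contra! hlt
  exact Asymptotics.isLittleO_irrefl (frequently_pow_ne_zero m)
    (h.trans_isLittleO ((Asymptotics.isLittleO_pow_pow hlt).mono nhdsWithin_le_nhds))

theorem isBigO_pow_pow_of_le {m n : ℕ} (h : n ≤ m) :
    (fun t : ℂ => t ^ m) =O[𝓝[≠] 0] fun t : ℂ => t ^ n := by
  rcases h.eq_or_lt with rfl | h
  · exact Asymptotics.isBigO_refl _ _
  · exact ((Asymptotics.isLittleO_pow_pow h).mono nhdsWithin_le_nhds).isBigO

/-- The term `0 ^ n` is the restriction of the power of another coordinate to an axis; it is `1` for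
`n = 0`. -/
theorem two_le_of_isBigO {m n : ℕ}
    (h : (fun t : ℂ => t ^ m + 0 ^ n) =O[𝓝[≠] 0] fun t : ℂ => t ^ 2) : 2 ≤ m := by
  have hlim : Tendsto (fun t : ℂ => t ^ m + 0 ^ n) (𝓝[≠] 0) (𝓝 (0 ^ m + 0 ^ n)) :=
    ((((continuous_pow m).tendsto (0 : ℂ)).mono_left nhdsWithin_le_nhds).add_const _)
  have hzero : Tendsto (fun t : ℂ => t ^ m + 0 ^ n) (𝓝[≠] 0) (𝓝 0) := by
    refine h.trans_tendsto ?_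
    simpa using ((continuous_pow 2).tendsto (0 : ℂ)).mono_left (nhdsWithin_le_nhds (s := {0}ᶜ))
  have := tendsto_nhds_unique hlim hzero
  rcases Nat.eq_zero_or_pos n with rfl | hn
  · rcases Nat.eq_zero_or_pos m with rfl | hm
    · norm_num at this
    · simp [hm.ne'] at this
  · simp only [zero_pow hn.ne', add_zero] at h
    exact le_of_isBigO_pow h

section Cusp

variable {a b c d k : ℕ}

theorem eval_cusp_zero (v : Fin 4 → ℂ) :
    eval v (cusp a b c d 0) = v 0 * v 1 - v 2 ^ a - v 3 ^ b := by
  simp [cusp]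

theorem eval_cusp_one (v : Fin 4 → ℂ) :
    eval v (cusp a b c d 1) = v 0 ^ c + v 1 ^ d - v 2 * v 3 := by
  simp [cusp]

theorem two_le_of_cusp_isBigO_sq
    (h : ∀ l, (fun v => eval v (cusp a b c d l)) =O[𝓝 0] fun v => ‖v‖ ^ 2) :
    2 ≤ a ∧ 2 ≤ b ∧ 2 ≤ c ∧ 2 ≤ d := by
  have key : ∀ i l, (fun t : ℂ => eval (Pi.single i t) (cusp a b c d l)) =O[𝓝[≠] 0]
      fun t : ℂ => t ^ 2 := fun i l => by
    have hlim : Tendsto (fun t : ℂ => (Pi.single i t : Fin 4 → ℂ)) (𝓝[≠] 0) (𝓝 0) := by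
      have : Continuous fun t : ℂ => (Pi.single i t : Fin 4 → ℂ) :=
        continuous_single (A := fun _ : Fin 4 => ℂ) i
      simpa using (this.tendsto 0).mono_left (nhdsWithin_le_nhds (s := {0}ᶜ))
    refine ((h l).comp_tendsto hlim).trans (Asymptotics.isBigO_of_le _ fun t => ?_)
    simp [Pi.norm_single]
  have h20 := (key 2 0).neg_left
  have h30 := (key 3 0).neg_left
  have h01 := key 0 1
  have h11 := key 1 1
  simp only [eval_cusp_zero, eval_cusp_one] at h20 h30 h01 h11
  refine ⟨two_le_of_isBigO (n := b) (h20.congr_left fun t => ?_),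
    two_le_of_isBigO (n := a) (h30.congr_left fun t => ?_),
    two_le_of_isBigO (n := d) (h01.congr_left fun t => ?_),
    two_le_of_isBigO (n := c) (h11.congr_left fun t => ?_)⟩
  all_goals simp
  all_goals ring

theorem cusp_isBigO_sq (ha : 2 ≤ a) (hb : 2 ≤ b) (hc : 2 ≤ c) (hd : 2 ≤ d) (l : Fin 2) :
    (fun v => eval v (cusp a b c d l)) =O[𝓝 0] fun v => ‖v‖ ^ 2 := by
  have hv : ∀ i, (fun v : Fin 4 → ℂ => v i) =O[𝓝 0] fun v => ‖v‖ := fun i =>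
    Asymptotics.IsBigO.of_norm_le fun v => by simpa using norm_le_pi_norm v i
  have hmul : ∀ i j, (fun v : Fin 4 → ℂ => v i * v j) =O[𝓝 0] fun v => ‖v‖ ^ 2 := fun i j =>
    ((hv i).mul (hv j)).congr_right fun v => (sq _).symm
  have hone : ∀ i n, (fun v : Fin 4 → ℂ => v i ^ n) =O[𝓝 0] fun _ => (1 : ℝ) := fun i n =>
    (((continuous_apply i).pow n).tendsto 0).isBigO_one ℝ
  have hpow : ∀ i n, 2 ≤ n → (fun v : Fin 4 → ℂ => v i ^ n) =O[𝓝 0] fun v => ‖v‖ ^ 2 :=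
    fun i n hn => ((hmul i i).mul (hone i (n - 2))).congr
      (fun v => by rw [← sq, ← pow_add, Nat.add_sub_cancel' hn]) fun v => mul_one _
  fin_cases l
  · exact (((hmul 0 1).sub (hpow 2 a ha)).sub (hpow 3 b hb)).congr_left fun v =>
      (eval_cusp_zero v).symm
  · exact (((hpow 0 c hc).add (hpow 1 d hd)).sub (hmul 2 3)).congr_left fun v =>
      (eval_cusp_one v).symm

/-- The gradient of the first equation of the cusp singularity. -/
def cuspGrad₀ (a b : ℕ) (v : Fin 4 → ℂ) : Fin 4 → ℂ :=
  ![v 1, v 0, -(a * v 2 ^ (a - 1)), -(b * v 3 ^ (b - 1))]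

/-- The gradient of the second equation of the cusp singularity. -/
def cuspGrad₁ (c d : ℕ) (v : Fin 4 → ℂ) : Fin 4 → ℂ :=
  ![c * v 0 ^ (c - 1), d * v 1 ^ (d - 1), -v 3, -v 2]

theorem eval_jacobianMinor_cusp (v : Fin 4 → ℂ) (i j : Fin 4) :
    eval v (jacobianMinor (cusp a b c d) i j) =
      cuspGrad₀ a b v i * cuspGrad₁ c d v j - cuspGrad₀ a b v j * cuspGrad₁ c d v i := by
  have h₀ : ∀ i, eval v (pderiv i (cusp a b c d 0)) = cuspGrad₀ a b v i := fun i => by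
    fin_cases i <;> simp [cusp, cuspGrad₀, pderiv_X]
  have h₁ : ∀ i, eval v (pderiv i (cusp a b c d 1)) = cuspGrad₁ c d v i := fun i => by
    fin_cases i <;> simp [cusp, cuspGrad₁, pderiv_X]
  simp only [jacobianMinor, map_sub, map_mul, h₀, h₁]

/-- If `f` and `g` are, up to `O(h)`, equal to functions that are small relative to `g` and to `f`,
respectively, then they are `O(h)` themselves. -/
theorem isBigO_of_mutual {f g e₁ e₂ h : ℂ → ℂ} {l : Filter ℂ} (hf : (fun t => f t - e₁ t) =O[l] h)
    (hg : (fun t => g t - e₂ t) =O[l] h) (he₁ : e₁ =o[l] g) (he₂ : e₂ =o[l] f) : f =O[l] h := by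
  obtain ⟨C₁, hC₁⟩ := hf.bound
  obtain ⟨C₂, hC₂⟩ := hg.bound
  refine Asymptotics.IsBigO.of_bound (2 * (C₁ + C₂)) ?_
  filter_upwards [hC₁, hC₂, he₁.bound (c := 1 / 2) (by norm_num),
    he₂.bound (c := 1 / 2) (by norm_num)] with t h1 h2 h3 h4
  have h5 := norm_sub_norm_le (f t) (e₁ t)
  have h6 := norm_sub_norm_le (g t) (e₂ t)
  nlinarith [norm_nonneg (f t), norm_nonneg (g t), norm_nonneg (f t - e₁ t),
    norm_nonneg (g t - e₂ t)]

/-- Along an arc tangent to the first axis, the vanishing of the equations and of the Jacobian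
minors to order `k` forces `z` and `w` to be small, and then `x ^ c` to vanish to order `k`. -/
theorem le_of_axis_arc (ha : 2 ≤ a) (hb : 2 ≤ b) (hd : 2 ≤ d) (hk : 2 ≤ k) {p : ℂ}
    (hp : p ≠ 0) {x y z w : ℂ → ℂ} (hx : (fun t => x t - t * p) =o[𝓝[≠] 0] fun t : ℂ => t)
    (hy : y =o[𝓝[≠] 0] fun t : ℂ => t) (hz : z =o[𝓝[≠] 0] fun t : ℂ => t)
    (hw : w =o[𝓝[≠] 0] fun t : ℂ => t)
    (h1 : (fun t => x t ^ c + y t ^ d - z t * w t) =O[𝓝[≠] 0] fun t : ℂ => t ^ k)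
    (h2 : (fun t => d * y t ^ d - c * x t ^ c) =O[𝓝[≠] 0] fun t : ℂ => t ^ k)
    (h3 : (fun t => x t * z t - b * d * w t ^ (b - 1) * y t ^ (d - 1)) =O[𝓝[≠] 0]
      fun t : ℂ => t ^ k)
    (h4 : (fun t => x t * w t - a * d * z t ^ (a - 1) * y t ^ (d - 1)) =O[𝓝[≠] 0]
      fun t : ℂ => t ^ k) : k ≤ c := by
  have hxt : (fun t : ℂ => t) =O[𝓝[≠] 0] x := by
    have hpt : (fun t : ℂ => t) =O[𝓝[≠] 0] fun t : ℂ => t * p :=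
      Asymptotics.IsBigO.of_bound ‖p‖⁻¹ (Eventually.of_forall fun t => by
        rw [norm_mul, mul_comm ‖t‖, inv_mul_cancel_left₀ (norm_ne_zero_iff.2 hp)])
    exact hpt.trans ((hx.trans_isBigO hpt).right_isBigO_add.congr_right fun t => by simp)
  have hone : ∀ {f : ℂ → ℂ} (n : ℕ), f =o[𝓝[≠] 0] (fun t : ℂ => t) →
      (fun t => f t ^ n) =O[𝓝[≠] 0] fun _ : ℂ => (1 : ℂ) := fun n hf =>
    ((hf.isBigO.trans_tendsto tendsto_id_punctured).pow n).isBigO_one ℂ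
  have hsmall : ∀ {f : ℂ → ℂ} {n : ℕ} (C : ℂ), 2 ≤ n → f =o[𝓝[≠] 0] (fun t : ℂ => t) →
      (fun t => C * f t ^ (n - 1) * y t ^ (d - 1)) =o[𝓝[≠] 0] fun t => x t * f t := by
    intro f n C hn hf
    have hf' : (fun t => f t ^ (n - 1)) =O[𝓝[≠] 0] f :=
      ((hone (n - 2) hf).mul (Asymptotics.isBigO_refl f _)).congr
        (fun t => by rw [← pow_succ]; congr 1; omega) fun t => one_mul _
    have hy' : (fun t => y t ^ (d - 1)) =o[𝓝[≠] 0] x :=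
      (((hone (d - 2) hy).mul_isLittleO hy).congr
        (fun t => by rw [← pow_succ]; congr 1; omega) fun t => one_mul _).trans_isBigO hxt
    exact ((hf'.const_mul_left C).mul_isLittleO hy').congr_right fun t => mul_comm _ _
  have hxz := isBigO_of_mutual h3 h4 (hsmall (b * d) hb hw) (hsmall (a * d) ha hz)
  have hxw := isBigO_of_mutual h4 h3 (hsmall (a * d) ha hz) (hsmall (b * d) hb hw)
  have hzw : (fun t => t ^ 2 * (z t * w t)) =O[𝓝[≠] 0] fun t : ℂ => t ^ (k + 2) := by
    refine (((hxt.mul hxt).mul (Asymptotics.isBigO_refl (fun t => z t * w t) _)).congr_left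
      fun t => by ring).trans ?_
    refine ((hxz.mul hxw).congr_left fun t => by ring).trans ?_
    simp only [← pow_add]
    exact isBigO_pow_pow_of_le (by omega)
  have hmul : ∀ {f : ℂ → ℂ}, f =O[𝓝[≠] 0] (fun t : ℂ => t ^ k) →
      (fun t => t ^ 2 * f t) =O[𝓝[≠] 0] fun t : ℂ => t ^ (k + 2) := fun hf =>
    ((Asymptotics.isBigO_refl (fun t : ℂ => t ^ 2) _).mul hf).congr_right fun t => by ring
  have hcd : (c + d : ℂ) ≠ 0 := by
    rw [← Nat.cast_add]
    exact Nat.cast_ne_zero.2 (by omega)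
  have hsum : (fun t => t ^ 2 * x t ^ c) =O[𝓝[≠] 0] fun t : ℂ => t ^ (k + 2) := by
    refine (((((hmul h1).const_mul_left (d : ℂ)).sub (hmul h2)).add
      (hzw.const_mul_left (d : ℂ))).const_mul_left (c + d : ℂ)⁻¹).congr_left fun t => ?_
    field_simp
    ring
  have := ((Asymptotics.isBigO_refl (fun t : ℂ => t ^ 2) (𝓝[≠] 0)).mul (hxt.pow c)).trans hsum
  have := le_of_isBigO_pow (m := c + 2) (this.congr_left fun t => by ring)
  omega

/-! The quadratic parts of the equations at the tangent direction of an arc. The number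
`0 ^ (n - 2)` is `1` for `n = 2` and `0` for `n > 2`. -/

section Leading

variable {f g : ℂ → ℂ} {α β : ℂ}

theorem tendsto_pow_div (hf : Tendsto (fun t => f t / t) (𝓝[≠] 0) (𝓝 α)) {n : ℕ} (hn : 2 ≤ n) :
    Tendsto (fun t => f t ^ (n - 1) / t) (𝓝[≠] 0) (𝓝 (0 ^ (n - 2) * α)) := by
  have h0 : Tendsto f (𝓝[≠] 0) (𝓝 0) := by
    have := hf.mul tendsto_id_punctured
    rw [mul_zero] at this
    refine this.congr' ?_
    filter_upwards [self_mem_nhdsWithin] with t ht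
    exact div_mul_cancel₀ _ ht
  refine ((h0.pow (n - 2)).mul hf).congr fun t => ?_
  rw [← mul_div_assoc, ← pow_succ]
  congr 3
  omega

theorem tendsto_mul_div_sq (hf : Tendsto (fun t => f t / t) (𝓝[≠] 0) (𝓝 α))
    (hg : Tendsto (fun t => g t / t) (𝓝[≠] 0) (𝓝 β)) :
    Tendsto (fun t => f t * g t / t ^ 2) (𝓝[≠] 0) (𝓝 (α * β)) :=
  (hf.mul hg).congr fun t => by rw [div_mul_div_comm, sq]

theorem tendsto_pow_div_sq (hf : Tendsto (fun t => f t / t) (𝓝[≠] 0) (𝓝 α)) {n : ℕ}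
    (hn : 2 ≤ n) : Tendsto (fun t => f t ^ n / t ^ 2) (𝓝[≠] 0) (𝓝 (0 ^ (n - 2) * α ^ 2)) := by
  have := tendsto_mul_div_sq (tendsto_pow_div hf hn) hf
  rw [mul_assoc, ← sq] at this
  refine this.congr fun t => ?_
  rw [← pow_succ]
  congr 2
  omega

theorem eq_zero_of_isBigO_cube (hf : Tendsto (fun t => f t / t ^ 2) (𝓝[≠] 0) (𝓝 α))
    (h : f =O[𝓝[≠] 0] fun t : ℂ => t ^ 3) : α = 0 := by
  refine tendsto_nhds_unique hf ?_
  have : (fun t => f t / t ^ 2) =O[𝓝[≠] 0] fun t : ℂ => t := by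
    refine (h.mul (Asymptotics.isBigO_refl (fun t : ℂ => (t ^ 2)⁻¹) _)).congr'
      (Eventually.of_forall fun t => rfl) ?_
    filter_upwards [self_mem_nhdsWithin] with t ht
    have : t ≠ 0 := ht
    field_simp
  exact this.trans_tendsto tendsto_id_punctured

end Leading

theorem IsArc.tendsto_div {v : ℂ → Fin 4 → ℂ} {e : Fin 4 → ℂ} (h : IsArc v e) (i : Fin 4) :
    Tendsto (fun t => v t i / t) (𝓝[≠] 0) (𝓝 (e i)) := by
  have h1 : (fun t => v t i - t * e i) =o[𝓝[≠] 0] fun t : ℂ => t :=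
    (Asymptotics.isLittleO_pi.1 h i)
  have h2 := h1.tendsto_div_nhds_zero.add_const (e i)
  rw [zero_add] at h2
  refine h2.congr' ?_
  filter_upwards [self_mem_nhdsWithin] with t ht
  have : t ≠ 0 := ht
  field_simp
  ring

/-- The quadratic parts of the equations vanish at the direction of an arc along which the equations
vanish to order three. -/
theorem quadratic_relations_of_mem_zeroDirections (ha : 2 ≤ a) (hb : 2 ≤ b) (hc : 2 ≤ c)
    (hd : 2 ≤ d) {e : Fin 4 → ℂ} (he : e ∈ zeroDirections 3 (cusp a b c d)) :
    e 0 * e 1 - 0 ^ (a - 2) * e 2 ^ 2 - 0 ^ (b - 2) * e 3 ^ 2 = 0 ∧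
      0 ^ (c - 2) * e 0 ^ 2 + 0 ^ (d - 2) * e 1 ^ 2 - e 2 * e 3 = 0 := by
  obtain ⟨v, hv, hF⟩ := he
  have h0 := hF 0
  have h1 := hF 1
  simp only [eval_cusp_zero, eval_cusp_one] at h0 h1
  constructor
  · refine eq_zero_of_isBigO_cube ?_ h0
    simp only [sub_div]
    exact ((tendsto_mul_div_sq (hv.tendsto_div 0) (hv.tendsto_div 1)).sub
      (tendsto_pow_div_sq (hv.tendsto_div 2) ha)).sub (tendsto_pow_div_sq (hv.tendsto_div 3) hb)
  · refine eq_zero_of_isBigO_cube ?_ h1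
    simp only [sub_div, add_div]
    exact ((tendsto_pow_div_sq (hv.tendsto_div 0) hc).add
      (tendsto_pow_div_sq (hv.tendsto_div 1) hd)).sub
      (tendsto_mul_div_sq (hv.tendsto_div 2) (hv.tendsto_div 3))

end Cusp

/-! ### Directions of arcs of the cusp singularities -/

section Cusp

variable {a b c d k : ℕ}

/-- The exponents of the cusp singularity, in the order of the coordinates `x, y, z, w`. -/
def cuspOrder (a b c d : ℕ) : Fin 4 → ℕ := ![c, d, a, b]

/-- The tangent direction of an arc along which the equations and the Jacobian minors vanish to
order three lies on a coordinate axis. -/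
theorem eq_single_of_quadratic_relations (ha : 2 ≤ a) (hb : 2 ≤ b) (hc : 2 ≤ c) (hd : 2 ≤ d)
    {e : Fin 4 → ℂ}
    (h : e 0 * e 1 - 0 ^ (a - 2) * e 2 ^ 2 - 0 ^ (b - 2) * e 3 ^ 2 = 0 ∧
      0 ^ (c - 2) * e 0 ^ 2 + 0 ^ (d - 2) * e 1 ^ 2 - e 2 * e 3 = 0)
    (h01 : e 1 * (d * (0 ^ (d - 2) * e 1)) - e 0 * (c * (0 ^ (c - 2) * e 0)) = 0)
    (h02 : e 1 * -e 3 - -(a * (0 ^ (a - 2) * e 2)) * (c * (0 ^ (c - 2) * e 0)) = 0)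
    (h03 : e 1 * -e 2 - -(b * (0 ^ (b - 2) * e 3)) * (c * (0 ^ (c - 2) * e 0)) = 0)
    (h12 : e 0 * -e 3 - -(a * (0 ^ (a - 2) * e 2)) * (d * (0 ^ (d - 2) * e 1)) = 0)
    (h13 : e 0 * -e 2 - -(b * (0 ^ (b - 2) * e 3)) * (d * (0 ^ (d - 2) * e 1)) = 0)
    (h23 : -(a * (0 ^ (a - 2) * e 2)) * -e 2 - -(b * (0 ^ (b - 2) * e 3)) * -e 3 = 0) :
    (e 1 = 0 ∧ e 2 = 0 ∧ e 3 = 0) ∨ (e 0 = 0 ∧ e 2 = 0 ∧ e 3 = 0) ∨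
      (e 0 = 0 ∧ e 1 = 0 ∧ e 3 = 0) ∨ (e 0 = 0 ∧ e 1 = 0 ∧ e 2 = 0) := by
  have key : ∀ n : ℕ, 2 ≤ n →
      (n : ℂ) = 2 ∧ (0 : ℂ) ^ (n - 2) = 1 ∨ (0 : ℂ) ^ (n - 2) = 0 ∧ (0 : ℂ) ^ (n - 2) = 0 := by
    intro n hn
    rcases hn.eq_or_lt with rfl | h
    · simp
    · exact Or.inr ⟨zero_pow (by omega), zero_pow (by omega)⟩
  obtain ⟨h0, h1⟩ := h
  rcases key a ha with ⟨ea, ea'⟩ | ⟨ea, ea'⟩ <;> rcases key b hb with ⟨eb, eb'⟩ | ⟨eb, eb'⟩ <;>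
    rcases key c hc with ⟨ec, ec'⟩ | ⟨ec, ec'⟩ <;> rcases key d hd with ⟨ed, ed'⟩ | ⟨ed, ed'⟩ <;>
    simp only [ea', eb', ec', ed', ea, eb, ec, ed, zero_mul, mul_zero, neg_zero, sub_zero, zero_add,
      add_zero, one_mul, zero_sub] at h0 h1 h01 h02 h03 h12 h13 h23 <;> clear key <;> grind

/-- For `k ≥ 3` the nonzero directions of arcs along which the equations and the Jacobian minors
vanish to order `k` lie on the axes whose exponent is at least `k`. -/
theorem exists_eq_single_of_mem_singularDirections (ha : 2 ≤ a) (hb : 2 ≤ b) (hc : 2 ≤ c)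
    (hd : 2 ≤ d) (hk : 3 ≤ k) {e : Fin 4 → ℂ} (he0 : e ≠ 0)
    (he : e ∈ singularDirections k (cusp a b c d)) :
    ∃ i s, e = Pi.single i s ∧ k ≤ cuspOrder a b c d i := by
  obtain ⟨v, hv, hF, hM⟩ := he
  simp only [eval_jacobianMinor_cusp] at hM
  have h3 : ∀ {f : ℂ → ℂ}, f =O[𝓝[≠] 0] (fun t : ℂ => t ^ k) →
      f =O[𝓝[≠] 0] fun t : ℂ => t ^ 3 := fun hf => hf.trans (isBigO_pow_pow_of_le hk)
  have hquad := quadratic_relations_of_mem_zeroDirections ha hb hc hd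
    ⟨v, hv, fun l => h3 (hF l)⟩
  have hg₀ : ∀ i, Tendsto (fun t => cuspGrad₀ a b (v t) i / t) (𝓝[≠] 0) (𝓝
      ((![e 1, e 0, -(a * (0 ^ (a - 2) * e 2)), -(b * (0 ^ (b - 2) * e 3))] : Fin 4 → ℂ) i)) := by
    intro i
    fin_cases i
    · exact hv.tendsto_div 1
    · exact hv.tendsto_div 0
    · exact ((tendsto_pow_div (hv.tendsto_div 2) ha).const_mul (a : ℂ)).neg.congr fun t => by
        simp [cuspGrad₀, mul_div_assoc, neg_div]
    · exact ((tendsto_pow_div (hv.tendsto_div 3) hb).const_mul (b : ℂ)).neg.congr fun t => by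
        simp [cuspGrad₀, mul_div_assoc, neg_div]
  have hg₁ : ∀ i, Tendsto (fun t => cuspGrad₁ c d (v t) i / t) (𝓝[≠] 0) (𝓝
      ((![c * (0 ^ (c - 2) * e 0), d * (0 ^ (d - 2) * e 1), -e 3, -e 2] : Fin 4 → ℂ) i)) := by
    intro i
    fin_cases i
    · exact ((tendsto_pow_div (hv.tendsto_div 0) hc).const_mul (c : ℂ)).congr fun t => by
        simp [cuspGrad₁, mul_div_assoc]
    · exact ((tendsto_pow_div (hv.tendsto_div 1) hd).const_mul (d : ℂ)).congr fun t => by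
        simp [cuspGrad₁, mul_div_assoc]
    · exact (hv.tendsto_div 3).neg.congr fun t => by simp [cuspGrad₁, neg_div]
    · exact (hv.tendsto_div 2).neg.congr fun t => by simp [cuspGrad₁, neg_div]
  have hlim := fun i j => eq_zero_of_isBigO_cube
    (((tendsto_mul_div_sq (hg₀ i) (hg₁ j)).sub (tendsto_mul_div_sq (hg₀ j) (hg₁ i))).congr
      fun t => (sub_div _ _ _).symm) (h3 (hM i j))
  have haxis := eq_single_of_quadratic_relations ha hb hc hd hquad (hlim 0 1) (hlim 0 2)
    (hlim 0 3) (hlim 1 2) (hlim 1 3) (hlim 2 3)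
  have hx : ∀ i, (fun t => v t i - t * e i) =o[𝓝[≠] 0] fun t : ℂ => t := fun i =>
    Asymptotics.isLittleO_pi.1 hv i
  have hx0 : ∀ i, e i = 0 → (fun t => v t i) =o[𝓝[≠] 0] fun t : ℂ => t := fun i hi => by
    simpa [hi] using hx i
  have hpow : ∀ (s : ℂ) {n : ℕ}, 2 ≤ n → s ^ n = s * s ^ (n - 1) := fun s n hn => by
    rw [← pow_succ']
    congr 1
    omega
  have hne : ∀ i, e = Pi.single i (e i) → e i ≠ 0 := fun i h h0 =>
    he0 (by rw [h, h0, Pi.single_zero])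
  have F0 := hF 0
  have F1 := hF 1
  simp only [eval_cusp_zero, eval_cusp_one] at F0 F1
  have hk2 : 2 ≤ k := by omega
  have M01 : (fun t => v t 1 * (d * v t 1 ^ (d - 1)) - v t 0 * (c * v t 0 ^ (c - 1)))
      =O[𝓝[≠] 0] fun t : ℂ => t ^ k := hM 0 1
  have M02 : (fun t => v t 1 * -v t 3 - -(a * v t 2 ^ (a - 1)) * (c * v t 0 ^ (c - 1)))
      =O[𝓝[≠] 0] fun t : ℂ => t ^ k := hM 0 2
  have M03 : (fun t => v t 1 * -v t 2 - -(b * v t 3 ^ (b - 1)) * (c * v t 0 ^ (c - 1)))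
      =O[𝓝[≠] 0] fun t : ℂ => t ^ k := hM 0 3
  have M12 : (fun t => v t 0 * -v t 3 - -(a * v t 2 ^ (a - 1)) * (d * v t 1 ^ (d - 1)))
      =O[𝓝[≠] 0] fun t : ℂ => t ^ k := hM 1 2
  have M13 : (fun t => v t 0 * -v t 2 - -(b * v t 3 ^ (b - 1)) * (d * v t 1 ^ (d - 1)))
      =O[𝓝[≠] 0] fun t : ℂ => t ^ k := hM 1 3
  have M23 : (fun t => -(a * v t 2 ^ (a - 1)) * -v t 2 - -(b * v t 3 ^ (b - 1)) * -v t 3)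
      =O[𝓝[≠] 0] fun t : ℂ => t ^ k := hM 2 3
  -- by the symmetry of the equations, every axis can play the role of the first one
  rcases haxis with h | h | h | h
  · have hs : e = Pi.single 0 (e 0) := by
      funext j
      fin_cases j <;> simp [h.1, h.2.1, h.2.2]
    refine ⟨0, _, hs, le_of_axis_arc (a := a) (b := b) (c := c) (d := d) ha hb hd hk2
      (hne 0 hs) (hx 0) (hx0 1 h.1) (hx0 2 h.2.1) (hx0 3 h.2.2)
      (F1.congr_left fun t => by ring) (M01.congr_left fun t => ?_)
      (M13.neg_left.congr_left fun t => by ring) (M12.neg_left.congr_left fun t => by ring)⟩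
    rw [hpow _ hc, hpow _ hd]
    ring
  · have hs : e = Pi.single 1 (e 1) := by
      funext j
      fin_cases j <;> simp [h.1, h.2.1, h.2.2]
    refine ⟨1, _, hs, le_of_axis_arc (a := a) (b := b) (c := d) (d := c) ha hb hc hk2
      (hne 1 hs) (hx 1) (hx0 0 h.1) (hx0 2 h.2.1) (hx0 3 h.2.2)
      (F1.congr_left fun t => by ring) (M01.neg_left.congr_left fun t => ?_)
      (M03.neg_left.congr_left fun t => by ring) (M02.neg_left.congr_left fun t => by ring)⟩
    rw [hpow _ hc, hpow _ hd]
    ring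
  · have hs : e = Pi.single 2 (e 2) := by
      funext j
      fin_cases j <;> simp [h.1, h.2.1, h.2.2]
    refine ⟨2, _, hs, le_of_axis_arc (a := c) (b := d) (c := a) (d := b) hc hd hb hk2
      (hne 2 hs) (hx 2) (hx0 3 h.2.2) (hx0 0 h.1) (hx0 1 h.2.1)
      (F0.neg_left.congr_left fun t => by ring) (M23.neg_left.congr_left fun t => ?_)
      (M13.neg_left.congr_left fun t => by ring) (M03.neg_left.congr_left fun t => by ring)⟩
    rw [hpow _ ha, hpow _ hb]
    ring
  · have hs : e = Pi.single 3 (e 3) := by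
      funext j
      fin_cases j <;> simp [h.1, h.2.1, h.2.2]
    refine ⟨3, _, hs, le_of_axis_arc (a := c) (b := d) (c := b) (d := a) hc hd ha hk2
      (hne 3 hs) (hx 3) (hx0 2 h.2.2) (hx0 0 h.1) (hx0 1 h.2.1)
      (F0.neg_left.congr_left fun t => by ring) (M23.congr_left fun t => ?_)
      (M12.neg_left.congr_left fun t => by ring) (M02.neg_left.congr_left fun t => by ring)⟩
    rw [hpow _ ha, hpow _ hb]
    ring

theorem isArc_smul (e : Fin 4 → ℂ) : IsArc (fun t => t • e) e := by
  simp only [IsArc, sub_self]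
  exact Asymptotics.isLittleO_zero _ _

theorem isBigO_mul_pow_of_le (s r : ℂ) {n : ℕ} (h : k ≤ n) :
    (fun t => r * (t * s) ^ n) =O[𝓝[≠] 0] fun t : ℂ => t ^ k := by
  simp only [mul_pow, mul_comm (_ ^ n) (s ^ n)]
  exact ((isBigO_pow_pow_of_le h).const_mul_left _).const_mul_left _

theorem single_mem_singularDirections (ha : 2 ≤ a) (hb : 2 ≤ b) (hc : 2 ≤ c) (hd : 2 ≤ d)
    {i : Fin 4} (hk : k ≤ cuspOrder a b c d i) (s : ℂ) :
    Pi.single i s ∈ singularDirections k (cusp a b c d) := by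
  have hpow : ∀ (s : ℂ) {n : ℕ}, 2 ≤ n → s * s ^ (n - 1) = s ^ n := fun s n hn => by
    rw [← pow_succ']
    congr 1
    omega
  have hz : ∀ {n : ℕ}, 2 ≤ n → n ≠ 0 ∧ n - 1 ≠ 0 := fun hn => by omega
  obtain ⟨za, za'⟩ := hz ha
  obtain ⟨zb, zb'⟩ := hz hb
  obtain ⟨zc, zc'⟩ := hz hc
  obtain ⟨zd, zd'⟩ := hz hd
  have key : ∀ r : ℂ, (fun t => r * (t * s) ^ cuspOrder a b c d i) =O[𝓝[≠] 0]
      fun t : ℂ => t ^ k := fun r => isBigO_mul_pow_of_le s r hk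
  refine ⟨_, isArc_smul _, fun l => ?_, fun j j' => ?_⟩
  · fin_cases l <;> fin_cases i
    all_goals
      first
      | (refine (key 0).congr_left fun t => ?_
         simp [eval_cusp_zero, eval_cusp_one, za, zb, zc, zd]
         done)
      | (refine (key 1).congr_left fun t => ?_
         simp [eval_cusp_zero, eval_cusp_one, cuspOrder, za, zb, zc, zd]
         done)
      | (refine (key (-1)).congr_left fun t => ?_
         simp [eval_cusp_zero, cuspOrder, za, zb])
  · simp only [eval_jacobianMinor_cusp]
    have hgrad : ∀ j j', (fun t : ℂ => cuspGrad₀ a b (t • Pi.single i s) j *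
        cuspGrad₁ c d (t • Pi.single i s) j') =O[𝓝[≠] 0] fun t : ℂ => t ^ k := by
      intro j j'
      fin_cases i <;> fin_cases j <;> fin_cases j' <;>
      first
      | (refine (key 0).congr_left fun t => ?_
         simp [cuspGrad₀, cuspGrad₁, za', zb', zc', zd']
         done)
      | (refine (key c).congr_left fun t => ?_
         simp [cuspGrad₀, cuspGrad₁, cuspOrder]
         rw [← hpow (t * s) hc]
         ring)
      | (refine (key d).congr_left fun t => ?_
         simp [cuspGrad₀, cuspGrad₁, cuspOrder]
         rw [← hpow (t * s) hd]
         ring)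
      | (refine (key a).congr_left fun t => ?_
         simp [cuspGrad₀, cuspGrad₁, cuspOrder]
         rw [← hpow (t * s) ha]
         ring)
      | (refine (key b).congr_left fun t => ?_
         simp [cuspGrad₀, cuspGrad₁, cuspOrder]
         rw [← hpow (t * s) hb]
         ring)
    exact (hgrad j j').sub (hgrad j' j)

end Cusp

/-! ### Uniqueness of the exponents of a cusp singularity -/

section Cusp

variable {a b c d a' b' c' d' k : ℕ}

/-- The pairs of coordinates `x, y` and `z, w`. -/
def axisPair : Fin 4 → Fin 2 := ![0, 0, 1, 1]

theorem mem_zeroDirections_three (ha : 2 ≤ a) (hb : 2 ≤ b) (hc : 2 ≤ c) (hd : 2 ≤ d)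
    {e : Fin 4 → ℂ} (h01 : e 0 * e 1 = 0) (h23 : e 2 * e 3 = 0)
    (h : ∀ i, e i = 0 ∨ 3 ≤ cuspOrder a b c d i) : e ∈ zeroDirections 3 (cusp a b c d) := by
  have key : ∀ i, (fun t : ℂ => (t * e i) ^ cuspOrder a b c d i) =O[𝓝[≠] 0]
      fun t : ℂ => t ^ 3 := fun i => by
    rcases h i with h | h
    · have : cuspOrder a b c d i ≠ 0 := by
        fin_cases i <;> simp [cuspOrder] <;> omega
      simp only [h, mul_zero, zero_pow this]
      exact Asymptotics.isBigO_zero _ _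
    · simpa using isBigO_mul_pow_of_le (e i) 1 h
  refine ⟨_, isArc_smul e, fun l => ?_⟩
  fin_cases l
  · refine ((key 2).add (key 3)).neg_left.congr_left fun t => ?_
    simp [eval_cusp_zero, cuspOrder]
    linear_combination (-t ^ 2) * h01
  · refine ((key 0).add (key 1)).congr_left fun t => ?_
    simp [eval_cusp_one, cuspOrder]
    linear_combination t ^ 2 * h23

/-- The pairing of the axes can be recognized from the arcs along which the equations vanish to
order three. -/
theorem single_add_single_mem_zeroDirections_iff (ha : 2 ≤ a) (hb : 2 ≤ b) (hc : 2 ≤ c)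
    (hd : 2 ≤ d) {i j : Fin 4} (hij : i ≠ j) (hi : 3 ≤ cuspOrder a b c d i)
    (hj : 3 ≤ cuspOrder a b c d j) {s r : ℂ} (hs : s ≠ 0) (hr : r ≠ 0) :
    Pi.single i s + Pi.single j r ∈ zeroDirections 3 (cusp a b c d) ↔
      axisPair i ≠ axisPair j := by
  constructor
  · intro h hpair
    obtain ⟨h0, h1⟩ := quadratic_relations_of_mem_zeroDirections ha hb hc hd h
    revert hij hpair
    fin_cases i <;> fin_cases j <;> intro hij hpair <;>
    first
    | exact hij rfl
    | exact absurd hpair (by decide)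
    | (simp [hs, hr] at h0; done)
    | simp [hs, hr] at h1
  · intro hpair
    have hprod : ∀ m n : Fin 4, axisPair m = axisPair n → m ≠ n →
        (Pi.single i s + Pi.single j r : Fin 4 → ℂ) m *
          (Pi.single i s + Pi.single j r : Fin 4 → ℂ) n = 0 := by
      intro m n hmn hne
      have h1 : ¬ ((m = i ∨ m = j) ∧ (n = i ∨ n = j)) := by
        rintro ⟨rfl | rfl, rfl | rfl⟩
        · exact hne rfl
        · exact hpair hmn
        · exact hpair hmn.symm
        · exact hne rfl
      rcases not_and_or.1 h1 with h | h <;> push Not at h <;>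
        simp [h.1, h.2]
    refine mem_zeroDirections_three ha hb hc hd (hprod 0 1 rfl (by decide))
      (hprod 2 3 rfl (by decide)) fun m => ?_
    by_cases hmi : m = i
    · exact Or.inr (hmi ▸ hi)
    · by_cases hmj : m = j
      · exact Or.inr (hmj ▸ hj)
      · simp [hmi, hmj]

theorem two_le_cuspOrder (ha : 2 ≤ a) (hb : 2 ≤ b) (hc : 2 ≤ c) (hd : 2 ≤ d) (i : Fin 4) :
    2 ≤ cuspOrder a b c d i := by
  fin_cases i <;> assumption

set_option maxHeartbeats 2000000 in
/-- A bijection of the axes that preserves the exponents, and preserves the pairing of those axes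
whose exponents are not `2`, preserves the unordered pair of unordered pairs of exponents. -/
theorem sym2_eq_of_bijection {δ δ' : Fin 4 → ℕ} (hδ : ∀ i, 2 ≤ δ i) {p₀ p₁ p₂ p₃ : Fin 4}
    (h₀₁ : p₀ ≠ p₁) (h₀₂ : p₀ ≠ p₂) (h₀₃ : p₀ ≠ p₃) (h₁₂ : p₁ ≠ p₂) (h₁₃ : p₁ ≠ p₃) (h₂₃ : p₂ ≠ p₃)
    (e₀ : δ 0 = δ' p₀) (e₁ : δ 1 = δ' p₁) (e₂ : δ 2 = δ' p₂) (e₃ : δ 3 = δ' p₃)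
    (q₀₁ : 3 ≤ δ 0 → 3 ≤ δ 1 → axisPair p₀ = axisPair p₁)
    (q₂₃ : 3 ≤ δ 2 → 3 ≤ δ 3 → axisPair p₂ = axisPair p₃)
    (q₀₂ : 3 ≤ δ 0 → 3 ≤ δ 2 → axisPair p₀ ≠ axisPair p₂)
    (q₀₃ : 3 ≤ δ 0 → 3 ≤ δ 3 → axisPair p₀ ≠ axisPair p₃)
    (q₁₂ : 3 ≤ δ 1 → 3 ≤ δ 2 → axisPair p₁ ≠ axisPair p₂)
    (q₁₃ : 3 ≤ δ 1 → 3 ≤ δ 3 → axisPair p₁ ≠ axisPair p₃) :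
    s(s(δ 2, δ 3), s(δ 0, δ 1)) = s(s(δ' 2, δ' 3), s(δ' 0, δ' 1)) := by
  have d₀ := hδ 0
  have d₁ := hδ 1
  have d₂ := hδ 2
  have d₃ := hδ 3
  clear hδ
  simp only [Sym2.eq_iff]
  fin_cases p₀ <;> fin_cases p₁ <;> first | exact absurd rfl h₀₁ | skip
  all_goals fin_cases p₂ <;> first | exact absurd rfl h₀₂ | exact absurd rfl h₁₂ | skip
  all_goals
    fin_cases p₃ <;> first
      | exact absurd rfl h₀₃
      | exact absurd rfl h₁₃
      | exact absurd rfl h₂₃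
      | skip
  all_goals
    simp [axisPair] at q₀₁ q₂₃ q₀₂ q₀₃ q₁₂ q₁₃ e₀ e₁ e₂ e₃
    omega

/-- The part of the classification of tangent directions that is transported by a contact map. -/
theorem exists_axis_image (ha : 2 ≤ a') (hb : 2 ≤ b') (hc : 2 ≤ c') (hd : 2 ≤ d')
    (ha0 : 2 ≤ a) (hb0 : 2 ≤ b) (hc0 : 2 ≤ c) (hd0 : 2 ≤ d)
    (B : (Fin 4 → ℂ) ≃L[ℂ] (Fin 4 → ℂ))
    (hB : ∀ k u, u ∈ singularDirections k (cusp a b c d) →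
      B u ∈ singularDirections k (cusp a' b' c' d')) (i : Fin 4) (hi : 3 ≤ cuspOrder a b c d i) :
    ∃ j s, s ≠ 0 ∧ B (Pi.single i 1) = Pi.single j s ∧
      cuspOrder a b c d i ≤ cuspOrder a' b' c' d' j := by
  have hne : B (Pi.single i 1) ≠ 0 := by simp
  obtain ⟨j, s, hjs, hj⟩ := exists_eq_single_of_mem_singularDirections ha hb hc hd hi hne
    (hB _ _ (single_mem_singularDirections ha0 hb0 hc0 hd0 le_rfl 1))
  exact ⟨j, s, fun h => hne (by rw [hjs, h, Pi.single_zero]), hjs, hj⟩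

theorem cusp_exponents_eq (ha : 2 ≤ a) (hb : 2 ≤ b) (hc : 2 ≤ c) (hd : 2 ≤ d)
    (ha' : 2 ≤ a') (hb' : 2 ≤ b') (hc' : 2 ≤ c') (hd' : 2 ≤ d')
    (B : (Fin 4 → ℂ) ≃L[ℂ] (Fin 4 → ℂ))
    (hB : ∀ k u, u ∈ singularDirections k (cusp a b c d) →
      B u ∈ singularDirections k (cusp a' b' c' d'))
    (hB' : ∀ k u, u ∈ singularDirections k (cusp a' b' c' d') →
      B.symm u ∈ singularDirections k (cusp a b c d))
    (hZ : ∀ u, u ∈ zeroDirections 3 (cusp a b c d) ↔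
      B u ∈ zeroDirections 3 (cusp a' b' c' d')) :
    s(s(a, b), s(c, d)) = s(s(a', b'), s(c', d')) := by
  set δ := cuspOrder a b c d with hδ
  set δ' := cuspOrder a' b' c' d' with hδ'
  have hσ := exists_axis_image ha' hb' hc' hd' ha hb hc hd B hB
  have hτ := exists_axis_image ha hb hc hd ha' hb' hc' hd' B.symm hB'
  choose σ s hs hσB hσle using hσ
  choose τ r hr hτB hτle using hτ
  have hsingle : ∀ (i : Fin 4) (x : ℂ), (Pi.single i x : Fin 4 → ℂ) = x • Pi.single i 1 :=
    fun i x => by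
      rw [← Pi.single_smul]
      simp
  have hinj : ∀ {i j : Fin 4} {x y : ℂ}, x ≠ 0 → (Pi.single i x : Fin 4 → ℂ) = Pi.single j y →
      i = j := fun {i j x y} hx h => by
    by_contra hij
    have := congrFun h i
    simp [hij, hx] at this
  have hτσ : ∀ i hi hi', τ (σ i hi) hi' = i := fun i hi hi' => by
    have h1 := congrArg B.symm (hσB i hi)
    rw [B.symm_apply_apply, hsingle (σ i hi), map_smul, hτB _ hi', ← Pi.single_smul] at h1
    exact (hinj one_ne_zero h1).symm
  have hστ : ∀ j hj hj', σ (τ j hj) hj' = j := fun j hj hj' => by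
    have h1 := congrArg B (hτB j hj)
    rw [B.apply_symm_apply, hsingle (τ j hj), map_smul, hσB _ hj', ← Pi.single_smul] at h1
    exact (hinj one_ne_zero h1).symm
  let ε : {i // 3 ≤ δ i} ≃ {j // 3 ≤ δ' j} :=
    { toFun := fun i => ⟨σ i.1 i.2, i.2.trans (hσle i.1 i.2)⟩
      invFun := fun j => ⟨τ j.1 j.2, j.2.trans (hτle j.1 j.2)⟩
      left_inv := fun i => Subtype.ext (hτσ _ _ _)
      right_inv := fun j => Subtype.ext (hστ _ _ _) }
  have hπ : ∀ i (hi : 3 ≤ δ i), ε.extendSubtype i = σ i hi := fun i hi =>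
    ε.extendSubtype_apply_of_mem i hi
  have heq : ∀ i, δ i = δ' (ε.extendSubtype i) := fun i => by
    by_cases hi : 3 ≤ δ i
    · rw [hπ i hi]
      refine (hσle i hi).antisymm ?_
      have h1 : 3 ≤ δ' (σ i hi) := hi.trans (hσle i hi)
      have h2 := hτle (σ i hi) h1
      rwa [hτσ] at h2
    · have h1 := ε.extendSubtype_not_mem i hi
      have h2 : 2 ≤ δ i := two_le_cuspOrder ha hb hc hd i
      have h3 : 2 ≤ δ' (ε.extendSubtype i) := two_le_cuspOrder ha' hb' hc' hd' (ε.extendSubtype i)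
      omega
  have hpair : ∀ i j, i ≠ j → 3 ≤ δ i → 3 ≤ δ j → (axisPair i ≠ axisPair j ↔
      axisPair (ε.extendSubtype i) ≠ axisPair (ε.extendSubtype j)) := by
    intro i j hij hi hj
    have hij' : σ i hi ≠ σ j hj := by
      rw [← hπ i hi, ← hπ j hj]
      exact fun h => hij (ε.extendSubtype.injective h)
    have h1 := hZ (Pi.single i 1 + Pi.single j 1)
    rw [map_add, hσB i hi, hσB j hj,
      single_add_single_mem_zeroDirections_iff ha hb hc hd hij hi hj one_ne_zero one_ne_zero,
      single_add_single_mem_zeroDirections_iff ha' hb' hc' hd' hij' (hi.trans (hσle i hi))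
        (hj.trans (hσle j hj)) (hs i hi) (hs j hj)] at h1
    rw [hπ i hi, hπ j hj]
    exact h1
  have hne : ∀ {i j : Fin 4}, i ≠ j → ε.extendSubtype i ≠ ε.extendSubtype j := fun h h' =>
    h (ε.extendSubtype.injective h')
  exact sym2_eq_of_bijection (δ := δ) (δ' := δ') (two_le_cuspOrder ha hb hc hd)
    (hne (by decide)) (hne (by decide)) (hne (by decide)) (hne (by decide)) (hne (by decide))
    (hne (by decide)) (heq 0) (heq 1) (heq 2) (heq 3)
    (fun h h' => not_ne_iff.1 fun hn => (hpair 0 1 (by decide) h h').2 hn rfl)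
    (fun h h' => not_ne_iff.1 fun hn => (hpair 2 3 (by decide) h h').2 hn rfl)
    (fun h h' => (hpair 0 2 (by decide) h h').1 (by decide))
    (fun h h' => (hpair 0 3 (by decide) h h').1 (by decide))
    (fun h h' => (hpair 1 2 (by decide) h h').1 (by decide))
    (fun h h' => (hpair 1 3 (by decide) h h').1 (by decide))

/-- The exponents of a cusp singularity to which a given singularity is `𝒦`-equivalent are
unique. -/
theorem KEquivalent.cusp_exponents_unique {F : Fin 2 → Poly4} (ha : 2 ≤ a) (hb : 2 ≤ b)
    (hc : 2 ≤ c) (hd : 2 ≤ d) (h : KEquivalent F (cusp a b c d))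
    (h' : KEquivalent F (cusp a' b' c' d')) :
    s(s(a, b), s(c, d)) = s(s(a', b'), s(c', d')) := by
  obtain ⟨A, hA⟩ := h.exists_isContactMap
  obtain ⟨A', hA'⟩ := h'.exists_isContactMap
  obtain ⟨ha', hb', hc', hd'⟩ := two_le_of_cusp_isBigO_sq
    (hA'.isBigO_sq (hA.symm.isBigO_sq (cusp_isBigO_sq ha hb hc hd)))
  refine cusp_exponents_eq ha hb hc hd ha' hb' hc' hd' (A.trans A'.symm)
    (fun k u hu => hA'.symm_mem_singularDirections (hA.symm.symm_mem_singularDirections hu))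
    (fun k u hu => hA.symm_mem_singularDirections (hA'.symm.symm_mem_singularDirections hu))
    fun u => ⟨fun hu => hA'.symm_mem_zeroDirections (hA.symm.symm_mem_zeroDirections hu),
      fun hu => ?_⟩
  have := hA.symm_mem_zeroDirections (hA'.symm.symm_mem_zeroDirections hu)
  simpa using this

end Cusp

theorem hasGabrielovNumbers_iff_of_kEquivalent {s : Series} {a b c d : ℕ}
    (h : KEquivalent ![gabrielovEq1 s, h₂ s - X 2 * X 3] (cusp (a + 2) (b + 2) (c + 2) (d + 2)))
    (n : Sym2 (Sym2 ℕ)) :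
    HasGabrielovNumbers s n ↔ n = s(s(a + 2, b + 2), s(c + 2, d + 2)) := by
  constructor
  · rintro ⟨a', b', c', d', rfl, h'⟩
    exact (h.cusp_exponents_unique (by omega) (by omega) (by omega) (by omega) h').symm
  · rintro rfl
    exact ⟨_, _, _, _, rfl, h⟩

/-! ### The numbers of the eight virtual singularities -/

/-- The Dolgachev numbers. The first pair belongs to the face that misses the term `1` of `h₂`. -/
def dolgachevNumbers (s : Series) : Sym2 (Sym2 ℕ) :=
  s(s(isotropyOrder s 1 0, isotropyOrder s 1 1), s(isotropyOrder s 0 0, isotropyOrder s 0 1))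

theorem hasDolgachevNumbers_iff_eq (s : Series) (n : Sym2 (Sym2 ℕ)) :
    HasDolgachevNumbers s n ↔ n = dolgachevNumbers s :=
  hasDolgachevNumbers_iff (hasDolgachevPair_facePoly_iff s 1) (hasDolgachevPair_facePoly_iff s 0) n

/-- The Gabrielov numbers are the Dolgachev numbers of the dual singularity. -/
theorem hasGabrielovNumbers_iff_eq (s : Series) (n : Sym2 (Sym2 ℕ)) :
    HasGabrielovNumbers s n ↔ n = dolgachevNumbers (dualSeries s) := by
  cases s
  · rw [hasGabrielovNumbers_iff_of_kEquivalent (a := 0) (b := 0) (c := 0) (d := 4)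
      Term.kEquivalent_cusp_J]
    exact iff_of_eq (congrArg (n = ·) (by decide))
  · rw [hasGabrielovNumbers_iff_of_kEquivalent (a := 0) (b := 0) (c := 2) (d := 2)
      Term.kEquivalent_cusp_K]
    exact iff_of_eq (congrArg (n = ·) (by decide))
  · rw [hasGabrielovNumbers_iff_of_kEquivalent (a := 0) (b := 0) (c := 3) (d := 1)
      Term.kEquivalent_cusp_Kflat]
    exact iff_of_eq (congrArg (n = ·) (by decide))
  · rw [hasGabrielovNumbers_iff_of_kEquivalent (a := 0) (b := 2) (c := 0) (d := 2)
      Term.kEquivalent_cusp_L]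
    exact iff_of_eq (congrArg (n = ·) (by decide))
  · rw [hasGabrielovNumbers_iff_of_kEquivalent (a := 0) (b := 1) (c := 0) (d := 3)
      Term.kEquivalent_cusp_Lsharp]
    exact iff_of_eq (congrArg (n = ·) (by decide))
  · rw [hasGabrielovNumbers_iff_of_kEquivalent (a := 0) (b := 2) (c := 1) (d := 1)
      Term.kEquivalent_cusp_M]
    exact iff_of_eq (congrArg (n = ·) (by decide))
  · rw [hasGabrielovNumbers_iff_of_kEquivalent (a := 0) (b := 1) (c := 1) (d := 2)
      Term.kEquivalent_cusp_Msharp]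
    exact iff_of_eq (congrArg (n = ·) (by decide))
  · rw [hasGabrielovNumbers_iff_of_kEquivalent (a := 1) (b := 1) (c := 1) (d := 1)
      Term.kEquivalent_cusp_I]
    exact iff_of_eq (congrArg (n = ·) (by decide))

end QuadrangleDuality

end

theorem mainTheorem1 :
    (∀ s t : QuadrangleDuality.Series,
      QuadrangleDuality.IsDual s t ↔ t = QuadrangleDuality.dualSeries s) ∧
    ∀ s t : QuadrangleDuality.Series, QuadrangleDuality.IsDual s t →
      (∃ n : Sym2 (Sym2 ℕ),
        (∀ m, QuadrangleDuality.HasGabrielovNumbers s m ↔ m = n) ∧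
        (∀ m, QuadrangleDuality.HasDolgachevNumbers t m ↔ m = n)) ∧
      (∃ n : Sym2 (Sym2 ℕ),
        (∀ m, QuadrangleDuality.HasDolgachevNumbers s m ↔ m = n) ∧
        (∀ m, QuadrangleDuality.HasGabrielovNumbers t m ↔ m = n)) := by
  refine ⟨QuadrangleDuality.isDual_iff, fun s t hst => ?_⟩
  obtain rfl := (QuadrangleDuality.isDual_iff s t).1 hst
  refine ⟨⟨_, QuadrangleDuality.hasGabrielovNumbers_iff_eq s,
    QuadrangleDuality.hasDolgachevNumbers_iff_eq _⟩,
    ⟨_, QuadrangleDuality.hasDolgachevNumbers_iff_eq s, fun m => ?_⟩⟩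
  have hdual : QuadrangleDuality.dualSeries (QuadrangleDuality.dualSeries s) = s := by
    cases s <;> rfl
  rw [QuadrangleDuality.hasGabrielovNumbers_iff_eq, hdual]
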